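/- Let $d\ge 1$ and $b\ge 2$ be integers, and let $\{P_m(\mathbf t):\mathbf t\in[0,1]^d\}_{m\ge 0}$ be a sequence of independent (jointly measurable) stochastic processes on a probability space with $P_m(\mathbf t)\ge 0$ and $\mathbb E[P_m(\mathbf t)]=1$ for all $m$ and $\mathbf t$. Put $\mu_m(d\mathbf t)=\prod_{j=0}^m P_j(\mathbf t)\,d\mathbf t$ on $[0,1]^d$. Almost surely, all $\mu_m$ are finite measures and $\mu_m$ converges weakly (Kahane's $T$-martingale limit) to a finite random measure $\mu_\infty$. Let $\mathscr D_m^b$ be the family of $b$-adic cubes $\prod_{\beta=1}^d[\frac{h_\beta-1}{b^m},\frac{h_\beta}{b^m})$, $h_\beta\in\{1,\dots,b^m\}$. Let $p_0\in(1,2]$ and $\alpha_0\in(0,1]$, and assume: (1) (Sub-exponential partition.) There are an integer $k_0\ge 0$ such that $P_k\not\equiv 1$ for all $k>k_0$, positive integers $N_m$ with $N_m=o(b^{m\varepsilon})$ as $m\to\infty$ for every $\varepsilon>0$, and partitions $\mathscr D_m^b=\bigsqcup_{i=1}^{N_m}\mathscr D_{m,i}^b$, such that for all $k>k_0$ and $1\le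 i\le N_{k-1}$ the restricted processes $\{P_k(\mathbf t):\mathbf t\in\mathbf I\}$, $\mathbf I\in\mathscr D_{k-1,i}^b$, are jointly independent. (Empty sub-families are allowed.) (2) (Uniform Mandelbrot–Kahane $L^{p_0}$-condition.) $\sup_{\mathbf t\in[0,1)^d}\mathbb E[P_j(\mathbf t)^{p_0}]<\infty$ for all $j\ge 0$, and $\limsup_{j\to\infty}\sup_{\mathbf t\in[0,1)^d}\mathbb E[P_j(\mathbf t)^{p_0}]<b^{d(p_0-1)}$. (3) (Uniform $L^{p_0}$-Hölder condition.) $$\sup_{j\ge 0}\ \sup_{\mathbf I\in\mathscr D_j^b}\ \sup_{\mathbf t,\mathbf s\in\mathbf I,\ \mathbf t\ne\mathbf s}\mathbb E\Big[\Big|\frac{P_j(\mathbf t)-P_j(\mathbf s)}{b^{j\alpha_0}|\mathbf t-\mathbf s|^{\alpha_0}}\Big|^{p_0}\Big]<\infty,$$ where $|\cdot|$ is the Euclidean norm. Define the structure function $$\Theta(p)=d(p-1)\log b-\log\Big(\limsup_{j\to\infty}\sup_{\mathbf t\in[0,1)^d}\mathbb E[P_j(\mathbf t)^p]\Big).$$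 For a finite measure $\nu$ on $[0,1]^d$ let $\widehat\nu(\mathbf x)=\int e^{-2\pi i\,\mathbf x\cdot\mathbf t}\,\nu(d\mathbf t)$, $\mathbf x\in\mathbb R^d$, and $$\dim_F(\nu)=\sup\{D\in[0,d):|\widehat\nu(\mathbf x)|^2=O(|\mathbf x|^{-D})\text{ as }|\mathbf x|\to\infty\}.$$ Then, almost surely on $\{\mu_\infty\ne 0\}$, the measure $\mu_\infty$ has polynomial Fourier decay, that is, $|\widehat{\mu_\infty}(\mathbf x)|^2=O(|\mathbf x|^{-D})$ as $|\mathbf x|\to\infty$ for some $D>0$, and $$\dim_F(\mu_\infty)\ \ge\ \min\Big\{2\alpha_0,\ \sup_{1<p\le p_0}\frac{2\Theta(p)}{p\log b}\Big\}\ >\ 0.$$ -/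

import Mathlib

open MeasureTheory ProbabilityTheory Filter Topology Asymptotics
open scoped ENNReal

namespace Chaos

/-- The closed unit cube `[0,1]^d` in Euclidean space. Its points form a compact metric space with
the Euclidean distance. -/
def cube (d : ℕ) : Set (EuclideanSpace ℝ (Fin d)) :=
  {x | ∀ i, x i ∈ Set.Icc (0 : ℝ) 1}

/-- Lebesgue measure on `[0,1]^d`. -/
noncomputable def cubeVolume (d : ℕ) : Measure (cube d) :=
  Measure.comap Subtype.val (volume : Measure (EuclideanSpace ℝ (Fin d)))

/-- The half-open unit cube `[0,1)^d`, as a set of points of `[0,1]^d`. -/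
def halfOpenCube (d : ℕ) : Set (cube d) :=
  {t | ∀ i, t.1 i < 1}

/-- The `b`-adic cubes of generation `m`: the cube `∏_i [h_i / b^m, (h_i + 1) / b^m)` with
`h_i ∈ {0, …, b^m - 1}`. The generation `m` family is indexed by `h : Fin d → Fin (b ^ m)`. -/
def adicCube (d b m : ℕ) (h : Fin d → Fin (b ^ m)) : Set (cube d) :=
  {t | ∀ i, ((h i : ℕ) : ℝ) / (b : ℝ) ^ m ≤ t.1 i ∧ t.1 i < (((h i : ℕ) : ℝ) + 1) / (b : ℝ) ^ m}

section Setting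

variable {d : ℕ} {Ω : Type*} [MeasurableSpace Ω]

/-- A sequence of independent, nonnegative, (jointly) measurable stochastic processes
`P_0, P_1, …` indexed by the points of `[0,1]^d`, all of whose values have expectation one.
(An integral with value `1` is the integral of an integrable function.) -/
structure IsChaosSequence (Pr : Measure Ω) (P : ℕ → cube d → Ω → ℝ) : Prop where
  measurable : ∀ j, Measurable (fun x : cube d × Ω => P j x.1 x.2)
  nonneg : ∀ j t ω, 0 ≤ P j t ω
  mean_one : ∀ j t, ∫ ω, P j t ω ∂Pr = 1
  indep : iIndepFun (fun (j : ℕ) (ω : Ω) (t : cube d) => P j t ω) Pr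

/-- The random measure `μ_m(dt) = (∏_{j ≤ m} P_j(t)) dt` on `[0,1]^d`. -/
noncomputable def approxMeasure (P : ℕ → cube d → Ω → ℝ) (m : ℕ) (ω : Ω) : Measure (cube d) :=
  (cubeVolume d).withDensity
    (fun t => ∏ j ∈ Finset.range (m + 1), ENNReal.ofReal (P j t ω))

open Classical in
/-- `μ_m` as a finite measure. As `μ_m([0,1]^d)` has expectation one, `μ_m` is finite almost
surely; on the exceptional null event the value `0` is used. -/
noncomputable def approx (P : ℕ → cube d → Ω → ℝ) (m : ℕ) (ω : Ω) : FiniteMeasure (cube d) :=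
  if h : IsFiniteMeasure (approxMeasure P m ω) then ⟨approxMeasure P m ω, h⟩ else 0

/-- The multiplicative chaos measure `μ_∞`, the limit of `μ_m` for weak convergence of measures
(the topology of `FiniteMeasure`). -/
noncomputable def chaosMeasure (P : ℕ → cube d → Ω → ℝ) (ω : Ω) : FiniteMeasure (cube d) :=
  limUnder atTop (fun m => approx P m ω)

/-- Sub-exponential partition and independence inside sub-families. The partition of the
generation `m` cubes into `N m` sub-families is given by the colouring `c m`, whose colour classes
are the sub-families. From some `k₀` on, `P_k` (`k > k₀`, written `k = m + 1`) is not the constant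
process `1`, and its restrictions to the cubes of generation `k - 1 = m` in one sub-family are
independent processes. -/
def SubexponentialPartition (Pr : Measure Ω) (b : ℕ) (P : ℕ → cube d → Ω → ℝ) : Prop :=
  ∃ k₀ : ℕ,
    (∀ k, k₀ < k → ¬ ∀ t, ∀ᵐ ω ∂Pr, P k t ω = 1) ∧
    ∃ (N : ℕ → ℕ) (c : ∀ m, (Fin d → Fin (b ^ m)) → Fin (N m)),
      (∀ m, 0 < N m) ∧
      (∀ ε : ℝ, 0 < ε →
        (fun m : ℕ => (N m : ℝ)) =o[atTop] (fun m : ℕ => (b : ℝ) ^ ((m : ℝ) * ε))) ∧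
      ∀ m, k₀ ≤ m → ∀ i : Fin (N m),
        iIndepFun
          (fun (h : {h : Fin d → Fin (b ^ m) // c m h = i}) (ω : Ω)
            (t : adicCube d b m h.1) => P (m + 1) t.1 ω) Pr

/-- `sup_{t ∈ [0,1)^d} E[P_j(t)^p]`, as an extended nonnegative number. -/
noncomputable def supMoment (Pr : Measure Ω) (P : ℕ → cube d → Ω → ℝ) (p : ℝ) (j : ℕ) : ℝ≥0∞ :=
  ⨆ t ∈ halfOpenCube d, ∫⁻ ω, ENNReal.ofReal (P j t ω) ^ p ∂Pr

/-- `limsup_{j → ∞} sup_{t ∈ [0,1)^d} E[P_j(t)^p]`. -/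
noncomputable def limsupMoment (Pr : Measure Ω) (P : ℕ → cube d → Ω → ℝ) (p : ℝ) : ℝ≥0∞ :=
  limsup (fun j => supMoment Pr P p j) atTop

/-- The uniform Mandelbrot–Kahane `L^p` condition with exponent `p₀`. -/
def MandelbrotKahane (Pr : Measure Ω) (b : ℕ) (P : ℕ → cube d → Ω → ℝ) (p₀ : ℝ) : Prop :=
  (∀ j, supMoment Pr P p₀ j < ∞) ∧
    limsupMoment Pr P p₀ < ENNReal.ofReal ((b : ℝ) ^ ((d : ℝ) * (p₀ - 1)))

/-- The uniform `L^p`-Hölder condition with exponents `p₀` and `α₀`, in which generation `j` is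
rescaled by `b ^ j` and only points in the same generation `j` cube are compared. -/
def UniformHolder (Pr : Measure Ω) (b : ℕ) (P : ℕ → cube d → Ω → ℝ) (p₀ α₀ : ℝ) : Prop :=
  (⨆ (j : ℕ) (h : Fin d → Fin (b ^ j)) (t ∈ adicCube d b j h) (s ∈ adicCube d b j h) (_ : t ≠ s),
    ∫⁻ ω, ENNReal.ofReal
      (|(P j t ω - P j s ω) / ((b : ℝ) ^ ((j : ℝ) * α₀) * dist t s ^ α₀)| ^ p₀) ∂Pr) < ∞

/-- The structure function
`Θ(p) = d (p - 1) log b - log (limsup_j sup_t E[P_j(t)^p])`. -/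
noncomputable def structureFunction (Pr : Measure Ω) (b : ℕ) (P : ℕ → cube d → Ω → ℝ) (p : ℝ) : ℝ :=
  (d : ℝ) * (p - 1) * Real.log b - Real.log (limsupMoment Pr P p).toReal

/-- `min {2 α₀, sup_{1 < p ≤ p₀} 2 Θ(p) / (p log b)}`. -/
noncomputable def fourierBound (Pr : Measure Ω) (b : ℕ) (P : ℕ → cube d → Ω → ℝ) (p₀ α₀ : ℝ) : ℝ :=
  min (2 * α₀) (⨆ p : Set.Ioc (1 : ℝ) p₀,
    2 * structureFunction Pr b P (p : ℝ) / ((p : ℝ) * Real.log b))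

end Setting

section Fourier

variable {d : ℕ}

/-- The Fourier transform `ν̂(x) = ∫ exp(-2πi x·t) ν(dt)` of a finite measure on `[0,1]^d`. -/
noncomputable def fourierTransform (ν : FiniteMeasure (cube d)) (x : EuclideanSpace ℝ (Fin d)) : ℂ :=
  ∫ t : cube d, Complex.exp (-2 * Real.pi * Complex.I * ((inner ℝ x t.1 : ℝ) : ℂ))
    ∂(ν : Measure (cube d))

/-- `|ν̂(x)|² = O(|x|^{-D})` as `|x| → ∞`. -/
def FourierDecay (ν : FiniteMeasure (cube d)) (D : ℝ) : Prop :=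
  (fun x : EuclideanSpace ℝ (Fin d) => ‖fourierTransform ν x‖ ^ 2)
    =O[Bornology.cobounded (EuclideanSpace ℝ (Fin d))] (fun x => ‖x‖ ^ (-D))

/-- Polynomial Fourier decay of a (non-zero) measure. -/
def PolynomialFourierDecay (ν : FiniteMeasure (cube d)) : Prop :=
  ∃ D : ℝ, 0 < D ∧ FourierDecay ν D

/-- The Fourier dimension `sup {D ∈ [0, d) : |ν̂(x)|² = O(|x|^{-D})}`. For `d ≥ 1` the set
contains `0`, and it is bounded by `d`. -/
noncomputable def fourierDim (ν : FiniteMeasure (cube d)) : ℝ :=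
  sSup {D : ℝ | D ∈ Set.Ico (0 : ℝ) d ∧ FourierDecay ν D}

end Fourier

end Chaos

namespace Chaos

/-! ### Smoothness of the `ℓ^{2K}` norm with constants independent of the dimension -/

section TypeP

/-! Write `D_n` for the product of `P_j` over `j < n`, so that `μ_m` has density `D_{m+1}`. The
increment `D_{m+2} - D_{m+1} = D_{m+1} (P_{m+1} - 1)`, integrated against a test function, is a sum
of contributions of the cells of generation `m`. Inside one colour class each contribution is
centred conditionally on the past and on the other contributions. Hence the `p`-th moment of the sum
is at most a constant times the sum of the `p`-th moments: `b^{md}` cells cost only `b^{md/p}`. The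
triangle inequality over the `N m` colours costs a subexponential factor.

All frequencies of size about `b^k` have to be treated at once. They are replaced by a finite grid
whose cardinality is polynomial in `b^k`, and the vector of integrals over the grid is measured in
`ℓ^{2K}`. This norm dominates the supremum, has type `p` with a constant that does not depend on the
size `|G|` of the grid (`exists_powSum_add_rpow_le`, `integral_powSum_sum_le`), and exceeds the
supremum by a factor of at most `|G|^{1/(2K)}`. For large `K` this factor is at most a constant
times `b^{kη}`.

One cell is estimated by telescoping through the averages over finer cells
(`enorm_integral_wave_mul_le_cellOsc`). Oscillation of the character over cells coarser than
`b^{-k}`, together with the Hölder condition in the mean, gives the factor `min(1, b^{(m-k)α₀})`, up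
to polynomial factors (`pNorm_freqBound_le`). The size of the contribution is the volume `b^{-md}`
times the `L^p` norm of the density, which is of order `b^{mℓ/p}` for `ℓ` just above the base `b`
logarithm of the limsup of the moments.

Altogether the increment has `L^p` norm at most about `b^{-mθ} min(1, b^{(m-k)α₀})` with `θ =
(d(p-1) - ℓ)/p`, a number close to `Θ(p)/(p log b)`. If `β < min(θ, α₀)`, this is at most `b^{-kβ}`
times a factor that is summable in `m` and `k`
(`IsChaosSequence.exists_pNorm_iSup_increment_bound`). Summation gives an almost sure bound `C
b^{-kβ}` on the grids, uniform in the generation (`IsChaosSequence.ae_exists_fourier_bound`). The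
same estimate for a single test function gives weak convergence
(`IsChaosSequence.ae_tendsto_approx`). The limit inherits the grid bound, and Lipschitz continuity
of its Fourier transform fills the gaps in the grid (`fourierDecay_of_frequencyGrid`). The resulting
exponent is `2β`, and `p` and `β` are then optimised. -/

theorem exists_abs_add_pow_sub_le (e : ℕ) : ∃ C : ℝ, 0 ≤ C ∧ ∀ s x : ℝ,
    |(s + x) ^ (e + 2) - s ^ (e + 2) - (e + 2) * s ^ (e + 1) * x| ≤
      C * (|s| ^ e * x ^ 2 + |x| ^ (e + 2)) := by
  induction e with
  | zero =>
    refine ⟨1, zero_le_one, fun s x => ?_⟩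
    have : (s + x) ^ (0 + 2) - s ^ (0 + 2) - ((0 : ℕ) + 2) * s ^ (0 + 1) * x = x ^ 2 := by
      push_cast; ring
    rw [this, abs_of_nonneg (sq_nonneg x)]
    simp
    positivity
  | succ e ih =>
    obtain ⟨C, hC, h⟩ := ih
    refine ⟨4 * C + (e + 2), by positivity, fun s x => ?_⟩
    -- Multiplying the expansion of order `e + 2` by `s + x` produces the next one; the only new
    -- second order term is `(e + 2) s ^ (e + 1) x ^ 2`.
    have key : (s + x) ^ (e + 1 + 2) - s ^ (e + 1 + 2) - ((e + 1 : ℕ) + 2) * s ^ (e + 1 + 1) * x =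
        (s + x) * ((s + x) ^ (e + 2) - s ^ (e + 2) - (e + 2) * s ^ (e + 1) * x)
          + (e + 2) * s ^ (e + 1) * x ^ 2 := by
      push_cast; ring
    rw [key]
    have ha := abs_nonneg s
    have hr := abs_nonneg x
    have hx2 : x ^ 2 = |x| ^ 2 := (sq_abs x).symm
    set a := |s|
    set r := |x|
    -- Intermediate monomials of the same total degree are dominated by the two extreme ones,
    -- according to which of `a`, `r` is larger.
    have h1 : a ^ e * r ^ 3 ≤ a ^ (e + 1) * r ^ 2 + r ^ (e + 3) := by
      rcases le_total r a with hra | hra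
      · have : a ^ e * r ^ 3 ≤ a ^ (e + 1) * r ^ 2 := by
          calc a ^ e * r ^ 3 = a ^ e * r ^ 2 * r := by ring
            _ ≤ a ^ e * r ^ 2 * a := by gcongr
            _ = _ := by ring
        have : 0 ≤ r ^ (e + 3) := by positivity
        linarith
      · have : a ^ e * r ^ 3 ≤ r ^ e * r ^ 3 := by gcongr
        have h2 : r ^ (e + 3) = r ^ e * r ^ 3 := by ring
        have : 0 ≤ a ^ (e + 1) * r ^ 2 := by positivity
        linarith
    have h2 : a * r ^ (e + 2) ≤ a ^ (e + 1) * r ^ 2 + r ^ (e + 3) := by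
      rcases le_total r a with hra | hra
      · have : a * r ^ (e + 2) ≤ a ^ (e + 1) * r ^ 2 := by
          calc a * r ^ (e + 2) = a * r ^ 2 * r ^ e := by ring
            _ ≤ a * r ^ 2 * a ^ e := by gcongr
            _ = _ := by ring
        have : 0 ≤ r ^ (e + 3) := by positivity
        linarith
      · have : a * r ^ (e + 2) ≤ r * r ^ (e + 2) := by gcongr
        have h2 : r ^ (e + 3) = r * r ^ (e + 2) := by ring
        have : 0 ≤ a ^ (e + 1) * r ^ 2 := by positivity
        linarith
    have hB := h s x
    rw [hx2] at hB
    calc |(s + x) * ((s + x) ^ (e + 2) - s ^ (e + 2) - (e + 2) * s ^ (e + 1) * x)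
          + (e + 2) * s ^ (e + 1) * x ^ 2|
        ≤ |(s + x) * ((s + x) ^ (e + 2) - s ^ (e + 2) - (e + 2) * s ^ (e + 1) * x)|
          + |(e + 2) * s ^ (e + 1) * x ^ 2| := abs_add_le _ _
      _ ≤ (a + r) * (C * (a ^ e * r ^ 2 + r ^ (e + 2))) + (e + 2) * a ^ (e + 1) * r ^ 2 := by
          gcongr
          · rw [abs_mul]
            gcongr
            exact abs_add_le _ _
          · rw [abs_mul, abs_mul, abs_pow, abs_pow]
            have : |((e : ℝ) + 2)| = e + 2 := abs_of_nonneg (by positivity)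
            rw [this]
      _ = C * (a ^ (e + 1) * r ^ 2 + a * r ^ (e + 2) + a ^ e * r ^ 3 + r ^ (e + 3))
          + (e + 2) * (a ^ (e + 1) * r ^ 2) := by ring
      _ ≤ C * (4 * (a ^ (e + 1) * r ^ 2 + r ^ (e + 3)))
          + (e + 2) * (a ^ (e + 1) * r ^ 2 + r ^ (e + 3)) := by
          have e1 : 0 ≤ a ^ (e + 1) * r ^ 2 := by positivity
          have e2 : 0 ≤ r ^ (e + 3) := by positivity
          gcongr
          · linarith
          · linarith
      _ = (4 * C + (e + 2)) * (a ^ (e + 1) * r ^ 2 + r ^ (e + 1 + 2)) := by ring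
      _ = _ := by rw [hx2]

variable {G : Type*} [Fintype G]

/-- The sum of the `2 K`-th powers of the coordinates. -/
def powSum (K : ℕ) (y : G → ℝ) : ℝ := ∑ g, y g ^ (2 * K)

theorem powSum_nonneg (K : ℕ) (y : G → ℝ) : 0 ≤ powSum K y :=
  Finset.sum_nonneg fun g _ => (even_two_mul K).pow_nonneg (y g)

theorem abs_pow_two_mul (K : ℕ) (y : ℝ) : |y| ^ (2 * K) = y ^ (2 * K) :=
  (even_two_mul K).pow_abs y

/-- Hölder's inequality for the `ℓ^q` norm with `q = m + n` and powers `m`, `n`. -/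
theorem sum_pow_mul_pow_le {q m n : ℕ} (hq : m + n = q) (hm : 0 < m) (hn : 0 < n)
    (s x : G → ℝ) {a r : ℝ} (ha : 0 ≤ a) (hr : 0 ≤ r)
    (hs : ∑ g, |s g| ^ q = a ^ q) (hx : ∑ g, |x g| ^ q = r ^ q) :
    ∑ g, |s g| ^ m * |x g| ^ n ≤ a ^ m * r ^ n := by
  have hm' : (0 : ℝ) < m := by exact_mod_cast hm
  have hn' : (0 : ℝ) < n := by exact_mod_cast hn
  have hq' : (q : ℝ) = m + n := by exact_mod_cast hq.symm
  have hq0 : (0 : ℝ) < q := by rw [hq']; positivity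
  have hc : Real.HolderConjugate ((q : ℝ) / m) ((q : ℝ) / n) := by
    rw [Real.holderConjugate_iff]
    refine ⟨?_, ?_⟩
    · rw [one_lt_div hm', hq']; linarith
    · rw [inv_div, inv_div, ← add_div, ← hq', div_self hq0.ne']
  have := Real.inner_le_Lp_mul_Lq_of_nonneg (s := Finset.univ) (f := fun g => |s g| ^ m)
    (g := fun g => |x g| ^ n) hc (fun g _ => by positivity) (fun g _ => by positivity)
  have e1 : ∀ (y : ℝ) (k : ℕ), 0 < k → 0 ≤ y → (y ^ k) ^ ((q : ℝ) / k) = y ^ q := by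
    intro y k hk hy
    have hk' : (k : ℝ) ≠ 0 := by positivity
    rw [← Real.rpow_natCast, ← Real.rpow_mul hy, mul_div_cancel₀ _ hk', Real.rpow_natCast]
  have e2 : ∀ (y : ℝ) (k : ℕ), 0 < k → 0 ≤ y → (y ^ q) ^ (1 / ((q : ℝ) / k)) = y ^ k := by
    intro y k hk hy
    rw [← Real.rpow_natCast, ← Real.rpow_mul hy, one_div_div, mul_div_cancel₀ _ hq0.ne',
      Real.rpow_natCast]
  simp only [e1 _ m hm (abs_nonneg _), e1 _ n hn (abs_nonneg _)] at this
  rwa [hs, hx, e2 a m hm ha, e2 r n hn hr] at this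

/-- Introduces the `ℓ^{2K}` norm `a` itself, so that real powers of `powSum` turn into powers of
`a`. -/
theorem exists_powSum_eq_pow {K : ℕ} (hK : 0 < K) (y : G → ℝ) :
    ∃ a : ℝ, 0 ≤ a ∧ powSum K y = a ^ (2 * K) := by
  refine ⟨powSum K y ^ (((2 * K : ℕ) : ℝ)⁻¹), Real.rpow_nonneg (powSum_nonneg K y) _, ?_⟩
  rw [Real.rpow_inv_natCast_pow (powSum_nonneg K y) (by omega)]

theorem pow_rpow_div {a : ℝ} (ha : 0 ≤ a) {q : ℕ} (hq : 0 < q) (z : ℝ) :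
    (a ^ q) ^ (z / q) = a ^ z := by
  have : (q : ℝ) ≠ 0 := by positivity
  rw [← Real.rpow_natCast, ← Real.rpow_mul ha, mul_div_cancel₀ _ this]

/-- The coefficient of the derivative of `powSum K y ^ (p / (2 K))`. -/
noncomputable def powSumGrad (K : ℕ) (p : ℝ) (y : G → ℝ) (g : G) : ℝ :=
  p * powSum K y ^ ((p - (2 * K : ℕ)) / (2 * K : ℕ)) * y g ^ (2 * K - 1)

/-- The gradient of the `p`-th power of a norm is homogeneous of degree `p - 1`, and each coordinate
is at most the norm. -/
theorem abs_powSumGrad_le {K : ℕ} (hK : 0 < K) {p : ℝ} (hp : 0 ≤ p) (y : G → ℝ) (g : G) :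
    |powSumGrad K p y g| ≤ p * powSum K y ^ ((p - 1) / (2 * K : ℕ)) := by
  obtain ⟨a, ha, hay⟩ := exists_powSum_eq_pow hK y
  have hq : 0 < 2 * K := by omega
  rw [powSumGrad, hay, pow_rpow_div ha hq, pow_rpow_div ha hq, abs_mul, abs_mul, abs_of_nonneg hp,
    abs_pow, abs_of_nonneg (Real.rpow_nonneg ha _), mul_assoc]
  gcongr
  have hle : |y g| ≤ a := by
    have : |y g| ^ (2 * K) ≤ a ^ (2 * K) := by
      rw [← hay, abs_pow_two_mul]
      exact Finset.single_le_sum (f := fun g => y g ^ (2 * K))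
        (fun g _ => (even_two_mul K).pow_nonneg (y g)) (Finset.mem_univ g)
    exact le_of_pow_le_pow_left₀ (by omega) ha this
  rcases ha.eq_or_lt with h0 | h0
  · have : |y g| = 0 := le_antisymm (h0 ▸ hle) (abs_nonneg _)
    rw [this, zero_pow (by omega), mul_zero]
    exact Real.rpow_nonneg ha _
  · calc a ^ (p - (2 * K : ℕ)) * |y g| ^ (2 * K - 1) ≤ a ^ (p - (2 * K : ℕ)) * a ^ (2 * K - 1) := by
          gcongr
      _ = a ^ (p - 1) := by
          rw [← Real.rpow_natCast a (2 * K - 1), ← Real.rpow_add h0]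
          congr 1
          push_cast [Nat.cast_sub (show 1 ≤ 2 * K by omega)]
          ring

/-- `p`-smoothness of the `ℓ^{2K}` norm, with a constant independent of the dimension. -/
theorem exists_powSum_add_rpow_le {K : ℕ} (hK : 2 ≤ K) {p : ℝ} (hp1 : 1 ≤ p) (hp2 : p ≤ 2) :
    ∃ C : ℝ, 0 ≤ C ∧ ∀ (G : Type) [Fintype G] (s x : G → ℝ),
      powSum K (s + x) ^ (p / (2 * K : ℕ)) ≤ powSum K s ^ (p / (2 * K : ℕ))
        + ∑ g, powSumGrad K p s g * x g + C * powSum K x ^ (p / (2 * K : ℕ)) := by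
  obtain ⟨e, he⟩ : ∃ e, 2 * K = e + 2 := ⟨2 * K - 2, by omega⟩
  obtain ⟨C₀, hC₀, hT⟩ := exists_abs_add_pow_sub_le e
  -- A perturbation smaller than `s` uses `2 * C₀`; a larger one uses `4` for the left side and `2`
  -- for the linear term.
  refine ⟨6 + 2 * C₀, by positivity, fun G _ s x => ?_⟩
  set q := 2 * K with hqdef
  have hq : 0 < q := by omega
  have hq4 : 4 ≤ q := by omega
  have hqR : (4 : ℝ) ≤ q := by exact_mod_cast hq4
  have hp0 : 0 < p := by linarith
  obtain ⟨a, ha, hay⟩ := exists_powSum_eq_pow (K := K) (by omega) s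
  obtain ⟨r, hr, hrx⟩ := exists_powSum_eq_pow (K := K) (by omega) x
  have hs' : ∑ g, |s g| ^ q = a ^ q := by
    rw [← hay]; exact Finset.sum_congr rfl fun g _ => abs_pow_two_mul K _
  have hx' : ∑ g, |x g| ^ q = r ^ q := by
    rw [← hrx]; exact Finset.sum_congr rfl fun g _ => abs_pow_two_mul K _
  have hgrad : ∑ g, powSumGrad K p s g * x g
      = p * a ^ (p - q) * ∑ g, s g ^ (q - 1) * x g := by
    rw [Finset.mul_sum]
    refine Finset.sum_congr rfl fun g _ => ?_
    rw [powSumGrad, hay, pow_rpow_div ha hq]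
    ring
  rw [hgrad, hay, hrx, pow_rpow_div ha hq, pow_rpow_div hr hq]
  set Λ := ∑ g, s g ^ (q - 1) * x g
  have hΛ : |Λ| ≤ a ^ (q - 1) * r := by
    have := sum_pow_mul_pow_le (q := q) (m := q - 1) (n := 1) (by omega) (by omega) (by omega)
      s x ha hr hs' hx'
    simp only [pow_one] at this
    refine le_trans (Finset.abs_sum_le_sum_abs _ _) (le_trans (le_of_eq ?_) this)
    refine Finset.sum_congr rfl fun g _ => ?_
    rw [abs_mul, abs_pow]
  rcases ha.eq_or_lt with h0 | h0
  · have hs0 : s = 0 := by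
      funext g
      have : powSum K s = 0 := by rw [hay, ← h0, zero_pow hq.ne']
      have := (Finset.sum_eq_zero_iff_of_nonneg
        (fun g _ => (even_two_mul K).pow_nonneg (s g))).1 this g (Finset.mem_univ g)
      exact pow_eq_zero_iff (by omega) |>.1 this
    have hΛ0 : Λ = 0 := by
      have : |Λ| ≤ 0 := by
        refine hΛ.trans (le_of_eq ?_)
        rw [← h0, zero_pow (by omega), zero_mul]
      exact abs_nonpos_iff.1 this
    rw [hs0, zero_add, hrx, pow_rpow_div hr hq, hΛ0, ← h0, Real.zero_rpow hp0.ne']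
    have : 0 ≤ r ^ p := Real.rpow_nonneg hr _
    nlinarith
  have hapos : 0 < a ^ p := Real.rpow_pos_of_pos h0 _
  have hrp : 0 ≤ r ^ p := Real.rpow_nonneg hr _
  have hv0 := powSum_nonneg K (s + x)
  rcases le_or_gt r a with hra | hra
  · -- the perturbation is small
    have hv : powSum K (s + x) ≤ a ^ q + q * Λ + C₀ * (a ^ (q - 2) * r ^ 2 + r ^ q) := by
      have h1 : ∀ g, (s g + x g) ^ q ≤ s g ^ q + q * (s g ^ (q - 1) * x g)
          + C₀ * (|s g| ^ (q - 2) * |x g| ^ 2 + |x g| ^ q) := by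
        intro g
        have := (le_abs_self _).trans (hT (s g) (x g))
        have e1 : e = q - 2 := by omega
        have e2 : e + 1 = q - 1 := by omega
        have e3 : ((e : ℝ) + 2) = q := by rw [he]; push_cast; ring
        rw [e2, ← he, e3, e1, ← sq_abs (x g)] at this
        linarith
      calc powSum K (s + x) ≤ ∑ g, (s g ^ q + q * (s g ^ (q - 1) * x g)
          + C₀ * (|s g| ^ (q - 2) * |x g| ^ 2 + |x g| ^ q)) := Finset.sum_le_sum fun g _ => h1 g
        _ = powSum K s + q * Λ + C₀ * (∑ g, |s g| ^ (q - 2) * |x g| ^ 2 + ∑ g, |x g| ^ q) := by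
          rw [Finset.sum_add_distrib, Finset.sum_add_distrib, ← Finset.mul_sum, ← Finset.mul_sum,
            Finset.sum_add_distrib]
          rfl
        _ ≤ _ := by
          rw [hay, hx']
          gcongr
          exact sum_pow_mul_pow_le (by omega) (by omega) (by omega) s x ha hr hs' hx'
    have haq : 0 < a ^ q := by positivity
    -- As `p / q ≤ 1`, the function `u ↦ u ^ (p / q)` is concave and lies below its tangent at `a ^
    -- q`.
    have hbern : powSum K (s + x) ^ (p / q) ≤
        a ^ p + p / q * a ^ (p - q) * (powSum K (s + x) - a ^ q) := by
      have := rpow_one_add_le_one_add_mul_self (s := powSum K (s + x) / a ^ q - 1)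
        (by have : 0 ≤ powSum K (s + x) / a ^ q := by positivity
            linarith) (p := p / q) (by positivity) (by rw [div_le_one (by linarith)]; linarith)
      rw [add_sub_cancel, Real.div_rpow hv0 haq.le, pow_rpow_div ha hq, div_le_iff₀ hapos] at this
      refine this.trans (le_of_eq ?_)
      rw [Real.rpow_sub h0, Real.rpow_natCast]
      field_simp
    have hpq : 0 ≤ p / q * a ^ (p - q) := by positivity
    -- Here `p ≤ 2` enters: the second order term is `a ^ (p - 2) * r ^ 2`, and the nonpositive
    -- exponent allows `a` to be replaced by the smaller `r`.
    have t1 : a ^ (p - q) * (a ^ (q - 2) * r ^ 2) ≤ r ^ p := by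
      rcases hr.eq_or_lt with hr0 | hr0
      · rw [← hr0]; simp [Real.zero_rpow hp0.ne']
      have : a ^ (p - q) * (a ^ (q - 2) * r ^ 2) = a ^ (p - 2) * r ^ (2 : ℝ) := by
        rw [← mul_assoc, ← Real.rpow_natCast a (q - 2), ← Real.rpow_add h0, Real.rpow_two]
        congr 2
        push_cast [Nat.cast_sub (show 2 ≤ q by omega)]; ring
      rw [this]
      calc a ^ (p - 2) * r ^ (2 : ℝ) ≤ r ^ (p - 2) * r ^ (2 : ℝ) := by
            gcongr ?_ * _
            exact Real.rpow_le_rpow_of_nonpos hr0 hra (by linarith)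
        _ = r ^ p := by rw [← Real.rpow_add hr0]; congr 1; ring
    have t2 : a ^ (p - q) * r ^ q ≤ r ^ p := by
      rcases hr.eq_or_lt with hr0 | hr0
      · rw [← hr0, zero_pow (by omega)]; simp [Real.zero_rpow hp0.ne']
      calc a ^ (p - q) * r ^ q ≤ r ^ (p - q) * r ^ q := by
            gcongr ?_ * _
            exact Real.rpow_le_rpow_of_nonpos hr0 hra (by linarith)
        _ = r ^ p := by rw [← Real.rpow_natCast, ← Real.rpow_add hr0]; congr 1; ring
    calc powSum K (s + x) ^ (p / q)
        ≤ a ^ p + p / q * a ^ (p - q) * (powSum K (s + x) - a ^ q) := hbern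
      _ ≤ a ^ p + p / q * a ^ (p - q) * (q * Λ + C₀ * (a ^ (q - 2) * r ^ 2 + r ^ q)) := by
          gcongr; linarith
      _ = a ^ p + p * a ^ (p - q) * Λ
          + p / q * C₀ * (a ^ (p - q) * (a ^ (q - 2) * r ^ 2) + a ^ (p - q) * r ^ q) := by
          have : (q : ℝ) ≠ 0 := by positivity
          field_simp
          ring
      _ ≤ a ^ p + p * a ^ (p - q) * Λ + 1 * C₀ * (r ^ p + r ^ p) := by
          gcongr
          rw [div_le_one (by linarith)]; linarith
      _ ≤ _ := by nlinarith
  · -- the perturbation is large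
    have hr0 : 0 < r := h0.trans hra
    have hM : powSum K (s + x) ≤ (a + r) ^ q := by
      have := Real.Lp_add_le (Finset.univ : Finset G) s x (p := q) (by linarith)
      simp only [Real.rpow_natCast] at this
      rw [hs', hx', one_div, Real.pow_rpow_inv_natCast ha hq.ne',
        Real.pow_rpow_inv_natCast hr hq.ne'] at this
      have h2 : ∑ g, |s g + x g| ^ q = powSum K (s + x) :=
        Finset.sum_congr rfl fun g _ => abs_pow_two_mul K _
      rw [h2] at this
      calc powSum K (s + x) = (powSum K (s + x) ^ ((q : ℝ)⁻¹)) ^ q :=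
            (Real.rpow_inv_natCast_pow hv0 hq.ne').symm
        _ ≤ _ := by gcongr
    have hbig : powSum K (s + x) ^ (p / q) ≤ 4 * r ^ p := by
      calc powSum K (s + x) ^ (p / q) ≤ ((a + r) ^ q) ^ (p / q) := by gcongr
        _ = (a + r) ^ p := pow_rpow_div (by positivity) hq _
        _ ≤ (2 * r) ^ p := by gcongr; linarith
        _ = 2 ^ p * r ^ p := Real.mul_rpow (by norm_num) hr
        _ ≤ 2 ^ (2 : ℝ) * r ^ p := by gcongr; norm_num
        _ = 4 * r ^ p := by norm_num
    have hlin : -(2 * r ^ p) ≤ p * a ^ (p - q) * Λ := by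
      have h3 : a ^ (p - q) * |Λ| ≤ r ^ p := by
        calc a ^ (p - q) * |Λ| ≤ a ^ (p - q) * (a ^ (q - 1) * r) := by gcongr
          _ = a ^ (p - 1) * r := by
            rw [← mul_assoc, ← Real.rpow_natCast a (q - 1), ← Real.rpow_add h0]
            congr 2
            push_cast [Nat.cast_sub (show 1 ≤ q by omega)]; ring
          _ ≤ r ^ (p - 1) * r := by gcongr
          _ = r ^ p := by
            nth_rewrite 2 [← Real.rpow_one r]
            rw [← Real.rpow_add hr0]; congr 1; ring
      have h4 : p * (a ^ (p - q) * |Λ|) ≤ 2 * r ^ p := by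
        calc p * (a ^ (p - q) * |Λ|) ≤ 2 * (a ^ (p - q) * |Λ|) := by gcongr
          _ ≤ _ := by gcongr
      have h5 : p * a ^ (p - q) * (-|Λ|) ≤ p * a ^ (p - q) * Λ := by
        gcongr; exact neg_abs_le Λ
      linarith
    nlinarith

end TypeP

/-! ### Martingale type `p` in expectation -/

section TypePExpectation

theorem stronglyMeasurable_comp_pi {Ω : Type*} {m : MeasurableSpace Ω} {G : Type*}
    {S : G → Ω → ℝ} {Φ : (G → ℝ) → ℝ} (hΦ : Measurable Φ) (hS : ∀ g, StronglyMeasurable (S g)) :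
    StronglyMeasurable (fun ω => Φ (fun g => S g ω)) :=
  (hΦ.comp (measurable_pi_lambda _ fun g => (hS g).measurable)).stronglyMeasurable

/-- Over a countable index set the measurable versions of the coordinates agree simultaneously
outside one null set. -/
theorem aestronglyMeasurable_comp_pi {Ω : Type*} {m mΩ : MeasurableSpace Ω} {Pr : Measure[mΩ] Ω}
    {G : Type*} [Countable G] {S : Ω → G → ℝ} {Φ : (G → ℝ) → ℝ} (hΦ : Measurable Φ)
    (hS : ∀ g, AEStronglyMeasurable[m] (fun ω => S ω g) Pr) :
    AEStronglyMeasurable[m] (fun ω => Φ (S ω)) Pr := by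
  choose S' hS' hSS' using hS
  refine ⟨fun ω => Φ (fun g => S' g ω), stronglyMeasurable_comp_pi hΦ hS', ?_⟩
  · filter_upwards [ae_all_iff.2 hSS'] with ω hω
    exact congrArg Φ (funext hω)

theorem integral_mul_eq_zero_of_condExp_eq_zero {Ω : Type*} {m mΩ : MeasurableSpace Ω}
    {Pr : Measure[mΩ] Ω} [IsFiniteMeasure Pr] (hm : m ≤ mΩ) {W Y : Ω → ℝ}
    (hW : AEStronglyMeasurable[m] W Pr) (hY : Integrable Y Pr)
    (hWY : Integrable (fun ω => W ω * Y ω) Pr) (hzero : Pr[Y | m] =ᵐ[Pr] 0) :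
    ∫ ω, W ω * Y ω ∂Pr = 0 := by
  rw [← integral_condExp hm]
  have h1 := condExp_mul_of_aestronglyMeasurable_left (μ := Pr) hW hWY hY
  have h2 : Pr[fun ω => W ω * Y ω | m] =ᵐ[Pr] 0 := by
    refine h1.trans ?_
    filter_upwards [hzero] with ω hω
    simp [hω]
  rw [integral_congr_ae h2]
  simp

variable {G : Type} [Fintype G]

theorem measurable_powSum (K : ℕ) : Measurable (powSum K : (G → ℝ) → ℝ) := by
  unfold powSum
  fun_prop

theorem measurable_powSumGrad (K : ℕ) (p : ℝ) (g : G) :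
    Measurable (fun y : G → ℝ => powSumGrad K p y g) := by
  unfold powSumGrad
  have := measurable_powSum (G := G) K
  fun_prop

theorem abs_le_powSum_rpow {K : ℕ} (hK : 0 < K) (y : G → ℝ) (g : G) :
    |y g| ≤ powSum K y ^ (1 / (2 * K : ℕ) : ℝ) := by
  obtain ⟨a, ha, hay⟩ := exists_powSum_eq_pow hK y
  rw [hay, pow_rpow_div ha (by omega), Real.rpow_one]
  have : |y g| ^ (2 * K) ≤ a ^ (2 * K) := by
    rw [← hay, abs_pow_two_mul]
    exact Finset.single_le_sum (f := fun g => y g ^ (2 * K))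
      (fun g _ => (even_two_mul K).pow_nonneg (y g)) (Finset.mem_univ g)
  exact le_of_pow_le_pow_left₀ (by omega) ha this

theorem rpow_sub_one_mul_le {a r p : ℝ} (ha : 0 ≤ a) (hr : 0 ≤ r) (hp : 1 ≤ p) :
    a ^ (p - 1) * r ≤ a ^ p + r ^ p := by
  have key : ∀ z : ℝ, 0 ≤ z → z ^ (p - 1) * z = z ^ p := fun z hz => by
    rcases hz.eq_or_lt with h | h
    · rw [← h, mul_zero, Real.zero_rpow (by linarith)]
    · nth_rewrite 2 [← Real.rpow_one z]
      rw [← Real.rpow_add h]; congr 1; ring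
  have h1 := Real.rpow_nonneg ha p
  have h2 := Real.rpow_nonneg hr p
  rcases le_total a r with h | h
  · have : a ^ (p - 1) * r ≤ r ^ (p - 1) * r := by gcongr
    rw [key r hr] at this
    linarith
  · have : a ^ (p - 1) * r ≤ a ^ (p - 1) * a := by gcongr
    rw [key a ha] at this
    linarith

/-- Makes the first order term integrable: its factors have degrees `p - 1` and `1`, so it is
dominated by the two `p`-th powers. -/
theorem abs_powSumGrad_mul_le {K : ℕ} (hK : 0 < K) {p : ℝ} (hp : 1 ≤ p) (s x : G → ℝ) (g : G) :
    |powSumGrad K p s g * x g| ≤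
      p * (powSum K s ^ (p / (2 * K : ℕ)) + powSum K x ^ (p / (2 * K : ℕ))) := by
  have h1 := abs_powSumGrad_le hK (by linarith : 0 ≤ p) s g
  have h2 := abs_le_powSum_rpow hK x g
  obtain ⟨a, ha, hay⟩ := exists_powSum_eq_pow hK s
  obtain ⟨r, hr, hrx⟩ := exists_powSum_eq_pow hK x
  have hq : 0 < 2 * K := by omega
  rw [hay, pow_rpow_div ha hq] at h1 ⊢
  rw [hrx, pow_rpow_div hr hq] at h2 ⊢
  rw [Real.rpow_one] at h2
  rw [abs_mul]
  calc _ ≤ (p * a ^ (p - 1)) * r := by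
        gcongr
    _ = p * (a ^ (p - 1) * r) := by ring
    _ ≤ _ := by
      gcongr
      exact rpow_sub_one_mul_le ha hr hp

/-- The `ℓ^{2K}` norm has martingale type `p`, for sums of vectors each of which is centred
conditionally on the other ones. -/
theorem integral_powSum_sum_le {Ω : Type*} [mΩ : MeasurableSpace Ω] {Pr : Measure Ω}
    [IsProbabilityMeasure Pr] {K : ℕ} (hK : 2 ≤ K) {p C : ℝ} (hp : 1 ≤ p)
    (hsmooth : ∀ s x : G → ℝ, powSum K (s + x) ^ (p / (2 * K : ℕ)) ≤
      powSum K s ^ (p / (2 * K : ℕ)) + ∑ g, powSumGrad K p s g * x g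
        + C * powSum K x ^ (p / (2 * K : ℕ)))
    {ι : Type*} (T : Finset ι) (Y : ι → Ω → G → ℝ) (𝒢 : ι → MeasurableSpace Ω)
    (h𝒢 : ∀ i, 𝒢 i ≤ mΩ)
    (hY : ∀ i ∈ T, ∀ g, AEStronglyMeasurable (fun ω => Y i ω g) Pr)
    (hadapt : ∀ i ∈ T, ∀ j ∈ T, j ≠ i → ∀ g, AEStronglyMeasurable[𝒢 i] (fun ω => Y j ω g) Pr)
    (hzero : ∀ i ∈ T, ∀ g, Pr[fun ω => Y i ω g | 𝒢 i] =ᵐ[Pr] 0)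
    (hint : ∀ i ∈ T, Integrable (fun ω => powSum K (Y i ω) ^ (p / (2 * K : ℕ))) Pr) :
    Integrable (fun ω => powSum K (∑ i ∈ T, Y i ω) ^ (p / (2 * K : ℕ))) Pr ∧
      ∫ ω, powSum K (∑ i ∈ T, Y i ω) ^ (p / (2 * K : ℕ)) ∂Pr ≤
        C * ∑ i ∈ T, ∫ ω, powSum K (Y i ω) ^ (p / (2 * K : ℕ)) ∂Pr := by
  classical
  have hK0 : 0 < K := by omega
  have hq : (0 : ℝ) < (2 * K : ℕ) := by exact_mod_cast (by omega : 0 < 2 * K)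
  induction T using Finset.induction_on with
  | empty =>
    have : powSum K (0 : G → ℝ) ^ (p / (2 * K : ℕ)) = 0 := by
      have : powSum K (0 : G → ℝ) = 0 := by
        simp [powSum, hK0.ne']
      rw [this, Real.zero_rpow (by positivity)]
    simp only [Finset.sum_empty, this, integral_zero, mul_zero, le_refl, and_true]
    exact integrable_zero _ _ _
  | insert i T hi ih =>
    obtain ⟨hSint, hSle⟩ := ih (fun j hj => hY j (Finset.mem_insert_of_mem hj))
      (fun j hj k hk => hadapt j (Finset.mem_insert_of_mem hj) k (Finset.mem_insert_of_mem hk))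
      (fun j hj => hzero j (Finset.mem_insert_of_mem hj))
      (fun j hj => hint j (Finset.mem_insert_of_mem hj))
    have hiT := Finset.mem_insert_self i T
    have hYi := hint i hiT
    set S : Ω → G → ℝ := fun ω => ∑ j ∈ T, Y j ω with hS
    -- The partial sum contains only indices other than `i`, so it is measurable for the σ-algebra
    -- conditionally on which `Y i` is centred.
    have hSad : ∀ g, AEStronglyMeasurable[𝒢 i] (fun ω => S ω g) Pr := fun g => by
      have : (fun ω => S ω g) = fun ω => ∑ j : T, Y j ω g := by
        funext ω
        simp only [hS, Finset.sum_apply]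
        exact (Finset.sum_coe_sort T (fun j => Y j ω g)).symm
      rw [this]
      exact aestronglyMeasurable_comp_pi (G := T) (S := fun ω j => Y j ω g)
        (Φ := fun y => ∑ j, y j) (by fun_prop) fun j =>
          hadapt i hiT j (Finset.mem_insert_of_mem j.2) (fun h => hi (h ▸ j.2)) g
    have hSm : ∀ g, AEStronglyMeasurable (fun ω => S ω g) Pr := fun g => (hSad g).mono (h𝒢 i)
    have hYint : ∀ g, Integrable (fun ω => Y i ω g) Pr := fun g => by
      refine Integrable.mono' ((integrable_const (1 : ℝ)).add hYi) (hY i hiT g)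
        (Eventually.of_forall fun ω => ?_)
      have h1 := abs_le_powSum_rpow hK0 (Y i ω) g
      obtain ⟨r, hr, hrx⟩ := exists_powSum_eq_pow hK0 (Y i ω)
      simp only [Pi.add_apply, Real.norm_eq_abs]
      rw [hrx, pow_rpow_div hr (by omega)] at h1 ⊢
      rw [Real.rpow_one] at h1
      refine h1.trans ?_
      rcases le_total r 1 with h | h
      · have := Real.rpow_nonneg hr p
        linarith
      · have := Real.rpow_le_rpow_of_exponent_le h hp
        rw [Real.rpow_one] at this
        linarith
    have hlin : ∀ g, Integrable (fun ω => powSumGrad K p (S ω) g * Y i ω g) Pr := fun g => by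
      refine Integrable.mono' ((hSint.add hYi).const_mul p) ?_
        (Eventually.of_forall fun ω => ?_)
      · exact (aestronglyMeasurable_comp_pi (measurable_powSumGrad K p g) hSm).mul (hY i hiT g)
      · exact abs_powSumGrad_mul_le hK0 hp (S ω) (Y i ω) g
    -- The gradient depends on the partial sum alone, so the linear term of the smoothness
    -- inequality has mean zero; only the `p`-th power of the new summand is added.
    have hlin0 : ∀ g, ∫ ω, powSumGrad K p (S ω) g * Y i ω g ∂Pr = 0 := fun g =>
      integral_mul_eq_zero_of_condExp_eq_zero (h𝒢 i)
        (aestronglyMeasurable_comp_pi (measurable_powSumGrad K p g) hSad) (hYint g) (hlin g)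
        (hzero i hiT g)
    have hle : ∀ ω, powSum K (∑ j ∈ insert i T, Y j ω) ^ (p / (2 * K : ℕ)) ≤
        powSum K (S ω) ^ (p / (2 * K : ℕ)) + ∑ g, powSumGrad K p (S ω) g * Y i ω g
          + C * powSum K (Y i ω) ^ (p / (2 * K : ℕ)) := fun ω => by
      rw [Finset.sum_insert hi, add_comm]
      exact hsmooth _ _
    have hRint : Integrable (fun ω => powSum K (S ω) ^ (p / (2 * K : ℕ))
        + ∑ g, powSumGrad K p (S ω) g * Y i ω g
        + C * powSum K (Y i ω) ^ (p / (2 * K : ℕ))) Pr :=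
      (hSint.add (integrable_finsetSum _ fun g _ => hlin g)).add (hYi.const_mul C)
    have hmeas : AEStronglyMeasurable
        (fun ω => powSum K (∑ j ∈ insert i T, Y j ω) ^ (p / (2 * K : ℕ))) Pr := by
      refine aestronglyMeasurable_comp_pi (Φ := fun y : G → ℝ => powSum K y ^ (p / (2 * K : ℕ)))
        ((measurable_powSum K).pow_const _) fun g => ?_
      have : (fun ω => (∑ j ∈ insert i T, Y j ω) g) = ∑ j ∈ insert i T, fun ω => Y j ω g := by
        funext ω; simp [Finset.sum_apply]
      rw [this]
      exact Finset.aestronglyMeasurable_sum _ fun j hj => hY j hj g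
    have hnn : ∀ ω, 0 ≤ powSum K (∑ j ∈ insert i T, Y j ω) ^ (p / (2 * K : ℕ)) :=
      fun ω => Real.rpow_nonneg (powSum_nonneg K _) _
    have hLint : Integrable
        (fun ω => powSum K (∑ j ∈ insert i T, Y j ω) ^ (p / (2 * K : ℕ))) Pr := by
      refine hRint.mono' hmeas (Eventually.of_forall fun ω => ?_)
      rw [Real.norm_of_nonneg (hnn ω)]
      exact hle ω
    refine ⟨hLint, ?_⟩
    calc _ ≤ ∫ ω, (powSum K (S ω) ^ (p / (2 * K : ℕ))
        + ∑ g, powSumGrad K p (S ω) g * Y i ω g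
        + C * powSum K (Y i ω) ^ (p / (2 * K : ℕ))) ∂Pr := integral_mono hLint hRint hle
      _ = ∫ ω, powSum K (S ω) ^ (p / (2 * K : ℕ)) ∂Pr
          + C * ∫ ω, powSum K (Y i ω) ^ (p / (2 * K : ℕ)) ∂Pr := by
        have i2 : Integrable (fun ω => ∑ g, powSumGrad K p (S ω) g * Y i ω g) Pr :=
          integrable_finsetSum _ fun g _ => hlin g
        have i1 : Integrable (fun ω => powSum K (S ω) ^ (p / (2 * K : ℕ))
            + ∑ g, powSumGrad K p (S ω) g * Y i ω g) Pr := hSint.add i2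
        rw [integral_add i1 (hYi.const_mul C), integral_add hSint i2,
          integral_finsetSum _ (fun g _ => hlin g), Finset.sum_eq_zero (fun g _ => hlin0 g),
          integral_const_mul, add_zero]
      _ ≤ _ := by
        rw [Finset.sum_insert hi, mul_add]
        linarith

end TypePExpectation

/-! ### Conditional expectation of time integrals -/

section IntegralMeasurability

/-- If a jointly measurable process is, at each time, measurable for a sub-σ-algebra, then its time
integral is almost everywhere equal to a function measurable for the sub-σ-algebra. -/
theorem aestronglyMeasurable_integral_process {Ω X : Type*} {m mΩ : MeasurableSpace Ω}
    [MeasurableSpace X] {Pr : Measure[mΩ] Ω} [IsProbabilityMeasure Pr] {ν : Measure X}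
    [SFinite ν] (hm : m ≤ mΩ)
    {f : X → Ω → ℝ} (hf : Integrable (fun z : X × Ω => f z.1 z.2) (ν.prod Pr))
    (hfm : ∀ᵐ t ∂ν, StronglyMeasurable[m] (f t)) :
    AEStronglyMeasurable[m] (fun ω => ∫ t, f t ω ∂ν) Pr := by
  -- Joint measurability is only available for the big σ-algebra, so Fubini alone does not make `Z`
  -- measurable for `m`. Instead `Z` is shown to equal `Pr[Z | m]` almost everywhere, by duality
  -- with bounded functions `V`.
  set Z : Ω → ℝ := fun ω => ∫ t, f t ω ∂ν with hZ
  have hZint : Integrable Z Pr := hf.integral_prod_right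
  -- testing against a bounded function
  have key : ∀ V : Ω → ℝ, StronglyMeasurable V → (∀ ω, |V ω| ≤ 1) →
      ∫ ω, (Z ω - Pr[Z | m] ω) * V ω ∂Pr = 0 := by
    intro V hV hVb
    have hVint : Integrable V Pr :=
      Integrable.mono' (integrable_const (1 : ℝ)) hV.aestronglyMeasurable
        (Eventually.of_forall hVb)
    have hVc : ∀ᵐ ω ∂Pr, |(Pr[V | m]) ω| ≤ 1 := by
      exact ae_bdd_abs_condExp_of_ae_bdd_abs (m := m) (μ := Pr) (R := 1) (f := V)
        (Eventually.of_forall hVb)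
    have hbd : ∀ {A B : Ω → ℝ}, Integrable A Pr → AEStronglyMeasurable B Pr →
        (∀ᵐ ω ∂Pr, |B ω| ≤ 1) → Integrable (fun ω => A ω * B ω) Pr := by
      intro A B hA hB hb
      have := hA.bdd_mul (c := 1) hB (by simpa using hb)
      exact this.congr (Eventually.of_forall fun ω => mul_comm _ _)
    have hVm : AEStronglyMeasurable (Pr[V | m]) Pr := integrable_condExp.aestronglyMeasurable
    -- self-adjointness of the conditional expectation
    have e1 : ∫ ω, (Pr[Z | m]) ω * V ω ∂Pr = ∫ ω, Z ω * (Pr[V | m]) ω ∂Pr := by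
      have i1 : Integrable ((Pr[Z | m]) * V) Pr :=
        hbd integrable_condExp hV.aestronglyMeasurable (Eventually.of_forall hVb)
      have i2 : Integrable (Z * Pr[V | m]) Pr := hbd hZint hVm hVc
      have c1 := condExp_mul_of_stronglyMeasurable_left (m := m) (μ := Pr)
        (f := Pr[Z | m]) stronglyMeasurable_condExp i1 hVint
      have c2 := condExp_mul_of_stronglyMeasurable_right (m := m) (μ := Pr)
        (g := Pr[V | m]) stronglyMeasurable_condExp i2 hZint
      calc ∫ ω, (Pr[Z | m]) ω * V ω ∂Pr = ∫ ω, ((Pr[Z | m]) * V) ω ∂Pr := rfl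
        _ = ∫ ω, (Z * Pr[V | m]) ω ∂Pr := by
          rw [← integral_condExp hm, integral_congr_ae (c1.trans c2.symm), integral_condExp hm]
    -- Fubini reduces this to one time `t`, where `f t` is measurable for `m` and `V - Pr[V | m]` is
    -- centred given `m`.
    have e2 : ∫ ω, Z ω * (V ω - (Pr[V | m]) ω) ∂Pr = 0 := by
      have hprod : Integrable (fun z : X × Ω => f z.1 z.2 * (V z.2 - (Pr[V | m]) z.2))
          (ν.prod Pr) := by
        have hq : Measurable[mΩ] (Pr[V | m]) := (stronglyMeasurable_condExp.mono hm).measurable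
        have := hf.bdd_mul (c := 2) (f := fun z : X × Ω => (V z.2 - (Pr[V | m]) z.2))
          ((hV.measurable.comp measurable_snd).sub
            (hq.comp measurable_snd)).aestronglyMeasurable ?_
        · exact this.congr (Eventually.of_forall fun z => mul_comm _ _)
        · have h2 : ∀ᵐ z ∂(ν.prod Pr), |(Pr[V | m]) z.2| ≤ 1 :=
            Measure.quasiMeasurePreserving_snd.ae hVc
          filter_upwards [h2] with z hz
          have := hVb z.2
          rw [Real.norm_eq_abs]
          exact (abs_sub _ _).trans (by linarith)
      calc ∫ ω, Z ω * (V ω - (Pr[V | m]) ω) ∂Pr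
          = ∫ ω, ∫ t, f t ω * (V ω - (Pr[V | m]) ω) ∂ν ∂Pr := by
            refine integral_congr_ae (Eventually.of_forall fun ω => ?_)
            simp only [hZ]
            rw [integral_mul_const]
        _ = ∫ t, ∫ ω, f t ω * (V ω - (Pr[V | m]) ω) ∂Pr ∂ν :=
            (integral_integral_swap (f := fun t ω => f t ω * (V ω - (Pr[V | m]) ω)) hprod).symm
        _ = 0 := by
          refine integral_eq_zero_of_ae ?_
          filter_upwards [hfm, hf.prod_right_ae] with t ht hti
          have hVVint : Integrable (fun ω => V ω - (Pr[V | m]) ω) Pr :=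
            hVint.sub integrable_condExp
          refine integral_mul_eq_zero_of_condExp_eq_zero hm ht.aestronglyMeasurable hVVint ?_ ?_
          · refine ((hti.bdd_mul (c := 2) hVVint.aestronglyMeasurable ?_).congr
              (Eventually.of_forall fun ω => mul_comm _ _))
            filter_upwards [hVc] with ω hω
            have := hVb ω
            rw [Real.norm_eq_abs]
            exact (abs_sub _ _).trans (by linarith)
          · have := condExp_sub hVint (integrable_condExp (m := m) (μ := Pr) (f := V)) m
            refine this.trans ?_
            rw [condExp_of_stronglyMeasurable hm stronglyMeasurable_condExp integrable_condExp]
            simp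
    have i1 : Integrable (fun ω => Z ω * V ω) Pr :=
      hbd hZint hV.aestronglyMeasurable (Eventually.of_forall hVb)
    have i2 : Integrable (fun ω => (Pr[Z | m]) ω * V ω) Pr :=
      hbd integrable_condExp hV.aestronglyMeasurable (Eventually.of_forall hVb)
    have i3 : Integrable (fun ω => Z ω * (Pr[V | m]) ω) Pr := hbd hZint hVm hVc
    simp only [sub_mul]
    rw [integral_sub i1 i2, e1]
    simp only [mul_sub] at e2
    rwa [integral_sub i1 i3] at e2
  obtain ⟨Z', hZ', hZZ'⟩ := hZint.aestronglyMeasurable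
  set W : Ω → ℝ := fun ω => Z' ω - (Pr[Z | m]) ω with hW
  have hWm : StronglyMeasurable W := hZ'.sub (stronglyMeasurable_condExp.mono hm)
  have hWint : Integrable W Pr := (hZint.congr hZZ').sub integrable_condExp
  -- Testing `W` against its own sign gives the integral of `|W|`.
  have hV : StronglyMeasurable (fun ω => (SignType.sign (W ω) : ℝ)) := by
    have : Measurable (fun x : ℝ => ((SignType.sign x : SignType) : ℝ)) := by
      have : (fun x : ℝ => ((SignType.sign x : SignType) : ℝ)) =
          fun x => if 0 < x then 1 else if x < 0 then -1 else 0 := by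
        funext x
        rw [sign_apply]
        split_ifs <;> simp
      rw [this]
      exact Measurable.ite measurableSet_Ioi measurable_const
        (Measurable.ite measurableSet_Iio measurable_const measurable_const)
    exact (this.comp hWm.measurable).stronglyMeasurable
  have h0 := key _ hV (fun ω => by
    rcases lt_trichotomy (W ω) 0 with h | h | h <;> simp [h])
  have h1 : ∫ ω, |W ω| ∂Pr = 0 := by
    rw [← h0]
    refine integral_congr_ae ?_
    filter_upwards [hZZ'] with ω hω
    rw [hω]
    change |W ω| = W ω * _
    rw [mul_comm]; exact (sign_mul_self (W ω)).symm
  have h2 : (fun ω => |W ω|) =ᵐ[Pr] 0 :=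
    (integral_eq_zero_iff_of_nonneg (fun ω => abs_nonneg _) hWint.abs).1 h1
  refine ⟨Pr[Z | m], stronglyMeasurable_condExp, ?_⟩
  filter_upwards [h2, hZZ'] with ω hω hω'
  have : W ω = 0 := abs_eq_zero.1 hω
  simp only [hW, sub_eq_zero] at this
  rw [hω', this]

/-- If `Y = ∫ A_t B_t dt` with `A_t` measurable for `m` and `B_t` centred and independent of `m`,
then `Y` is centred conditionally on `m`. -/
theorem condExp_integral_process_eq_zero {Ω X : Type*} {m mΩ : MeasurableSpace Ω}
    [MeasurableSpace X] {Pr : Measure[mΩ] Ω} [IsProbabilityMeasure Pr] {ν : Measure X}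
    [SFinite ν] (hm : m ≤ mΩ) {f : X → Ω → ℝ}
    (hf : Integrable (fun z : X × Ω => f z.1 z.2) (ν.prod Pr))
    (hzero : ∀ᵐ t ∂ν, ∀ s, MeasurableSet[m] s → ∫ ω in s, f t ω ∂Pr = 0) :
    Pr[fun ω => ∫ t, f t ω ∂ν | m] =ᵐ[Pr] 0 := by
  have hZint : Integrable (fun ω => ∫ t, f t ω ∂ν) Pr := hf.integral_prod_right
  refine (ae_eq_condExp_of_forall_setIntegral_eq hm hZint (g := 0)
    (fun s _ _ => integrableOn_zero) (fun s hs _ => ?_) ?_).symm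
  · have hs' := hm s hs
    have : Integrable (fun z : X × Ω => f z.1 z.2) (ν.prod (Pr.restrict s)) := by
      refine hf.mono_measure ?_
      exact Measure.prod_mono le_rfl Measure.restrict_le_self
    rw [← integral_integral_swap this]
    simp only [Pi.zero_apply, integral_zero]
    symm
    refine integral_eq_zero_of_ae ?_
    filter_upwards [hzero] with t ht
    exact ht s hs
  · exact stronglyMeasurable_zero.aestronglyMeasurable

end IntegralMeasurability

/-! ### The cube, its `b`-adic cells, and characters integrated over cells -/

section Geometry

variable {d b : ℕ}

/-- The character `exp (-2 π i x · t)`. -/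
noncomputable def wave (x : EuclideanSpace ℝ (Fin d)) (t : cube d) : ℂ :=
  Complex.exp (-2 * Real.pi * Complex.I * ((inner ℝ x t.1 : ℝ) : ℂ))

theorem wave_eq_exp (x : EuclideanSpace ℝ (Fin d)) (t : cube d) :
    wave x t = Complex.exp (((-2 * Real.pi * inner ℝ x t.1 : ℝ) : ℂ) * Complex.I) := by
  rw [wave]; congr 1; push_cast; ring

theorem norm_wave (x : EuclideanSpace ℝ (Fin d)) (t : cube d) : ‖wave x t‖ = 1 := by
  rw [wave_eq_exp, Complex.norm_exp_ofReal_mul_I]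

theorem continuous_wave (x : EuclideanSpace ℝ (Fin d)) : Continuous (wave x) := by
  unfold wave
  fun_prop

theorem measurableSet_cube (d : ℕ) : MeasurableSet (cube d) := by
  have : cube d = ⋂ i, {x : EuclideanSpace ℝ (Fin d) | x i ∈ Set.Icc (0 : ℝ) 1} := by
    ext x; simp [cube]
  rw [this]
  refine MeasurableSet.iInter fun i => ?_
  have hm : Measurable fun x : EuclideanSpace ℝ (Fin d) => x i := by fun_prop
  exact hm measurableSet_Icc

theorem measurable_coord (i : Fin d) : Measurable (fun t : cube d => t.1 i) := by
  have hm : Measurable fun x : EuclideanSpace ℝ (Fin d) => x i := by fun_prop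
  exact hm.comp measurable_subtype_coe

theorem measurableSet_adicCube (l : ℕ) (h : Fin d → Fin (b ^ l)) :
    MeasurableSet (adicCube d b l h) := by
  have : adicCube d b l h = ⋂ i, {t : cube d | t.1 i ∈ Set.Ico (((h i : ℕ) : ℝ) / (b : ℝ) ^ l)
      ((((h i : ℕ) : ℝ) + 1) / (b : ℝ) ^ l)} := by
    ext t; simp [adicCube]
  rw [this]
  exact MeasurableSet.iInter fun i => measurable_coord i measurableSet_Ico

theorem adicCube_bounds (hb : 2 ≤ b) {l m : ℕ} (hm : m < b ^ l) :
    0 ≤ (m : ℝ) / (b : ℝ) ^ l ∧ ((m : ℝ) + 1) / (b : ℝ) ^ l ≤ 1 := by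
  have hbl : (0 : ℝ) < (b : ℝ) ^ l := by positivity
  refine ⟨by positivity, ?_⟩
  rw [div_le_one hbl]
  exact_mod_cast hm

/-- The coordinates of a point of the cube. -/
def cubeCoord (t : cube d) : Fin d → ℝ := fun i => t.1 i

theorem measurableEmbedding_cubeCoord : MeasurableEmbedding (cubeCoord : cube d → Fin d → ℝ) :=
  (MeasurableEquiv.toLp 2 (Fin d → ℝ)).symm.measurableEmbedding.comp
    (MeasurableEmbedding.subtype_coe (measurableSet_cube d))

/-- Transports integrals to a product measure, for which cells are boxes and characters are products
of one-dimensional exponentials. -/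
theorem measurePreserving_cubeCoord :
    MeasurePreserving (cubeCoord : cube d → Fin d → ℝ) (cubeVolume d)
      (Measure.pi fun _ => (volume : Measure ℝ).restrict (Set.Icc 0 1)) := by
  refine ⟨measurableEmbedding_cubeCoord.measurable, ?_⟩
  have h1 : (cubeVolume d).map Subtype.val
      = (volume : Measure (EuclideanSpace ℝ (Fin d))).restrict (cube d) :=
    map_comap_subtype_coe (measurableSet_cube d) _
  have h2 : (cubeCoord : cube d → Fin d → ℝ)
      = (MeasurableEquiv.toLp 2 (Fin d → ℝ)).symm ∘ Subtype.val := rfl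
  rw [h2, ← Measure.map_map (MeasurableEquiv.measurable _) measurable_subtype_coe, h1]
  have h3 : cube d = (MeasurableEquiv.toLp 2 (Fin d → ℝ)).symm ⁻¹'
      (Set.univ.pi fun _ => Set.Icc 0 1) := by
    ext x
    simp only [cube, Set.mem_ofPred_eq, Set.mem_preimage, Set.mem_univ_pi]
    rfl
  rw [h3]
  have h4 := (EuclideanSpace.volume_preserving_symm_measurableEquiv_toLp (Fin d)).restrict_preimage
    (s := Set.univ.pi fun _ => Set.Icc 0 1)
    (MeasurableSet.univ_pi fun _ => measurableSet_Icc)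
  rw [h4.map_eq, volume_pi, Measure.restrict_pi_pi]

instance : IsProbabilityMeasure (cubeVolume d) := by
  refine ⟨?_⟩
  rw [← Set.preimage_univ (f := (cubeCoord : cube d → Fin d → ℝ)),
    measurePreserving_cubeCoord.measure_preimage MeasurableSet.univ.nullMeasurableSet]
  simp [Measure.pi_univ]

theorem mem_adicCube_iff {l : ℕ} {h : Fin d → Fin (b ^ l)} {t : cube d} :
    t ∈ adicCube d b l h ↔ ∀ i, t.1 i ∈ Set.Ico (((h i : ℕ) : ℝ) / (b : ℝ) ^ l)
      ((((h i : ℕ) : ℝ) + 1) / (b : ℝ) ^ l) := Iff.rfl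

theorem Ico_subset_Icc_of_lt (hb : 2 ≤ b) {l m : ℕ} (hm : m < b ^ l) :
    Set.Ico ((m : ℝ) / (b : ℝ) ^ l) (((m : ℝ) + 1) / (b : ℝ) ^ l) ⊆ Set.Icc 0 1 := fun _ hy =>
  ⟨(adicCube_bounds hb hm).1.trans hy.1, hy.2.le.trans (adicCube_bounds hb hm).2⟩

theorem cubeVolume_adicCube (hb : 2 ≤ b) (l : ℕ) (h : Fin d → Fin (b ^ l)) :
    cubeVolume d (adicCube d b l h) = ENNReal.ofReal ((((b : ℝ) ^ l)⁻¹) ^ d) := by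
  have h1 : adicCube d b l h = cubeCoord ⁻¹' (Set.univ.pi fun i =>
      Set.Ico (((h i : ℕ) : ℝ) / (b : ℝ) ^ l) ((((h i : ℕ) : ℝ) + 1) / (b : ℝ) ^ l)) := by
    ext t; simp only [mem_adicCube_iff, Set.mem_preimage, Set.mem_univ_pi]; rfl
  rw [h1, measurePreserving_cubeCoord.measure_preimage
    (MeasurableSet.univ_pi fun _ => measurableSet_Ico).nullMeasurableSet, Measure.pi_pi]
  have h2 : ∀ i, (volume : Measure ℝ).restrict (Set.Icc 0 1)
      (Set.Ico (((h i : ℕ) : ℝ) / (b : ℝ) ^ l) ((((h i : ℕ) : ℝ) + 1) / (b : ℝ) ^ l))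
      = ENNReal.ofReal (((b : ℝ) ^ l)⁻¹) := fun i => by
    rw [Measure.restrict_apply measurableSet_Ico,
      Set.inter_eq_left.2 (Ico_subset_Icc_of_lt hb (h i).2), Real.volume_Ico]
    congr 1
    rw [← sub_div, add_sub_cancel_left, one_div]
  simp only [h2, Finset.prod_const, Finset.card_univ, Fintype.card_fin]
  rw [ENNReal.ofReal_pow (by positivity)]

theorem norm_setIntegral_exp_le_length {a c ξ : ℝ} (hac : a ≤ c) :
    ‖∫ y in Set.Ico a c, Complex.exp (((-2 * Real.pi * (ξ * y) : ℝ) : ℂ) * Complex.I)‖ ≤ c - a := by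
  have := norm_setIntegral_le_of_norm_le_const (μ := volume) (s := Set.Ico a c) (C := 1)
    (f := fun y : ℝ => Complex.exp (((-2 * Real.pi * (ξ * y) : ℝ) : ℂ) * Complex.I))
    (by simp) (fun y _ => (Complex.norm_exp_ofReal_mul_I _).le)
  simpa [Real.volume_real_Ico_of_le hac] using this

/-- The antiderivative has modulus `1 / (2 π |ξ|)` at both endpoints. -/
theorem norm_setIntegral_exp_le_inv {a c ξ : ℝ} (hac : a ≤ c) (hξ : ξ ≠ 0) :
    ‖∫ y in Set.Ico a c, Complex.exp (((-2 * Real.pi * (ξ * y) : ℝ) : ℂ) * Complex.I)‖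
      ≤ 1 / |ξ| := by
  rw [integral_Ico_eq_integral_Ioc, ← intervalIntegral.integral_of_le hac]
  have hz : ((-2 * Real.pi * ξ : ℝ) : ℂ) * Complex.I ≠ 0 := by
    refine mul_ne_zero ?_ Complex.I_ne_zero
    exact_mod_cast (by simp [hξ, Real.pi_ne_zero] : -2 * Real.pi * ξ ≠ 0)
  have h1 : ∀ y : ℝ, Complex.exp (((-2 * Real.pi * (ξ * y) : ℝ) : ℂ) * Complex.I)
      = Complex.exp ((((-2 * Real.pi * ξ : ℝ) : ℂ) * Complex.I) * y) := fun y => by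
    congr 1; push_cast; ring
  have h2 : ∀ y : ℝ, ‖Complex.exp ((((-2 * Real.pi * ξ : ℝ) : ℂ) * Complex.I) * y)‖ = 1 :=
    fun y => by rw [← h1, Complex.norm_exp_ofReal_mul_I]
  simp only [h1]
  rw [integral_exp_mul_complex hz, norm_div, norm_mul, Complex.norm_I, Complex.norm_real, mul_one]
  have h3 : ‖(-2 * Real.pi * ξ : ℝ)‖ = 2 * Real.pi * |ξ| := by
    rw [Real.norm_eq_abs, abs_mul, abs_mul]
    rw [abs_of_pos Real.pi_pos]; norm_num
  rw [h3]
  have hξ' : 0 < |ξ| := abs_pos.2 hξ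
  calc _ ≤ (1 + 1) / (2 * Real.pi * |ξ|) := by
        gcongr
        exact (norm_sub_le _ _).trans (by rw [h2, h2])
    _ ≤ (1 + 1) / (2 * 1 * |ξ|) := by
        gcongr
        linarith [Real.pi_gt_three]
    _ = 1 / |ξ| := by field_simp; norm_num

theorem setIntegral_wave_adicCube (hb : 2 ≤ b) (l : ℕ) (h : Fin d → Fin (b ^ l))
    (x : EuclideanSpace ℝ (Fin d)) :
    ∫ t in adicCube d b l h, wave x t ∂(cubeVolume d) =
      ∏ i, ∫ y in Set.Ico (((h i : ℕ) : ℝ) / (b : ℝ) ^ l) ((((h i : ℕ) : ℝ) + 1) / (b : ℝ) ^ l),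
        Complex.exp (((-2 * Real.pi * (x i * y) : ℝ) : ℂ) * Complex.I) := by
  classical
  set S : Fin d → Set ℝ := fun i =>
    Set.Ico (((h i : ℕ) : ℝ) / (b : ℝ) ^ l) ((((h i : ℕ) : ℝ) + 1) / (b : ℝ) ^ l)
  set F : Fin d → ℝ → ℂ := fun i => (S i).indicator
    fun y => Complex.exp (((-2 * Real.pi * (x i * y) : ℝ) : ℂ) * Complex.I)
  have h1 : ∀ t : cube d, (adicCube d b l h).indicator (wave x) t = ∏ i, F i (cubeCoord t i) := by
    intro t
    by_cases ht : t ∈ adicCube d b l h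
    · have ht' : ∀ i, cubeCoord t i ∈ S i := mem_adicCube_iff.1 ht
      rw [Set.indicator_of_mem ht]
      simp only [F, Set.indicator_of_mem (ht' _)]
      rw [← Complex.exp_sum, wave_eq_exp, ← Finset.sum_mul, PiLp.inner_apply]
      congr 2
      rw [← Complex.ofReal_sum, Finset.mul_sum]
      congr 1
      refine Finset.sum_congr rfl fun i _ => ?_
      simp [cubeCoord, mul_comm]
    · rw [Set.indicator_of_notMem ht]
      rw [mem_adicCube_iff] at ht
      push Not at ht
      obtain ⟨i, hi⟩ := ht
      symm
      refine Finset.prod_eq_zero (Finset.mem_univ i) ?_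
      exact Set.indicator_of_notMem hi _
  rw [← integral_indicator (measurableSet_adicCube l h)]
  simp only [h1]
  rw [measurePreserving_cubeCoord.integral_comp measurableEmbedding_cubeCoord
    (fun y => ∏ i, F i (y i)), integral_fintype_prod_eq_prod]
  refine Finset.prod_congr rfl fun i _ => ?_
  rw [integral_indicator measurableSet_Ico, Measure.restrict_restrict measurableSet_Ico,
    Set.inter_eq_left.2 (Ico_subset_Icc_of_lt hb (h i).2)]

theorem exists_norm_le_sqrt_mul_abs (hd : 1 ≤ d) (x : EuclideanSpace ℝ (Fin d)) :
    ∃ i, ‖x‖ ≤ Real.sqrt d * |x i| := by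
  have : Nonempty (Fin d) := ⟨⟨0, hd⟩⟩
  obtain ⟨i, hi⟩ := Finite.exists_max fun i => |x i|
  refine ⟨i, ?_⟩
  rw [EuclideanSpace.norm_eq, ← Real.sqrt_sq (abs_nonneg (x i)), ← Real.sqrt_mul (by positivity)]
  refine Real.sqrt_le_sqrt ?_
  calc ∑ j, ‖x j‖ ^ 2 ≤ ∑ _j : Fin d, |x i| ^ 2 := by
        refine Finset.sum_le_sum fun j _ => ?_
        rw [Real.norm_eq_abs]
        have := hi j
        gcongr
    _ = _ := by simp

/-- Some coordinate of `x` has absolute value at least `‖x‖ / √d`. The integral in that direction is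
bounded by cancellation, in the other directions by the side length. -/
theorem norm_setIntegral_wave_le (hd : 1 ≤ d) (hb : 2 ≤ b) (l : ℕ) (h : Fin d → Fin (b ^ l))
    {x : EuclideanSpace ℝ (Fin d)} (hx : x ≠ 0) :
    ‖∫ t in adicCube d b l h, wave x t ∂(cubeVolume d)‖ ≤
      (((b : ℝ) ^ l)⁻¹) ^ d * (Real.sqrt d * (b : ℝ) ^ l / ‖x‖) := by
  have hbl : (0 : ℝ) < (b : ℝ) ^ l := by positivity
  have hxpos : 0 < ‖x‖ := norm_pos_iff.2 hx
  obtain ⟨i, hi⟩ := exists_norm_le_sqrt_mul_abs hd x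
  have hdpos : 0 < Real.sqrt d := Real.sqrt_pos.2 (by exact_mod_cast hd)
  have hxi : 0 < |x i| := by
    by_contra h0
    have h0 : |x i| = 0 := le_antisymm (not_lt.1 h0) (abs_nonneg _)
    rw [h0, mul_zero] at hi
    linarith
  rw [setIntegral_wave_adicCube hb, norm_prod, ← Finset.mul_prod_erase _ _ (Finset.mem_univ i)]
  have hle : ∀ j : Fin d, ((h j : ℕ) : ℝ) / (b : ℝ) ^ l ≤ (((h j : ℕ) : ℝ) + 1) / (b : ℝ) ^ l :=
    fun j => by gcongr; linarith
  have hlen : ∀ j : Fin d, (((h j : ℕ) : ℝ) + 1) / (b : ℝ) ^ l - ((h j : ℕ) : ℝ) / (b : ℝ) ^ l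
      = ((b : ℝ) ^ l)⁻¹ := fun j => by rw [← sub_div, add_sub_cancel_left, one_div]
  have hcard : (Finset.univ.erase i).card = d - 1 := by simp
  calc _ ≤ (1 / |x i|) * ∏ _j ∈ Finset.univ.erase i, ((b : ℝ) ^ l)⁻¹ := by
        gcongr with j hj
        · exact norm_setIntegral_exp_le_inv (hle i) (abs_pos.1 hxi)
        · exact (norm_setIntegral_exp_le_length (hle j)).trans (hlen j).le
    _ = (((b : ℝ) ^ l)⁻¹) ^ d * (1 / |x i| * (b : ℝ) ^ l) := by
        rw [Finset.prod_const, hcard]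
        obtain ⟨e, rfl⟩ : ∃ e, d = e + 1 := ⟨d - 1, by omega⟩
        rw [Nat.add_sub_cancel, pow_succ]
        field_simp
    _ ≤ _ := by
        gcongr
        rw [mul_comm, mul_one_div, div_le_div_iff₀ hxi hxpos]
        calc (b : ℝ) ^ l * ‖x‖ ≤ (b : ℝ) ^ l * (Real.sqrt d * |x i|) := by gcongr
          _ = _ := by ring

theorem exists_mem_adicCube (hb : 2 ≤ b) (l : ℕ) {t : cube d} (ht : t ∈ halfOpenCube d) :
    ∃ h, t ∈ adicCube d b l h := by
  have hbl : (0 : ℝ) < (b : ℝ) ^ l := by positivity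
  have h0 : ∀ i, 0 ≤ t.1 i := fun i => (t.2 i).1
  refine ⟨fun i => ⟨⌊t.1 i * (b : ℝ) ^ l⌋₊, ?_⟩, fun i => ⟨?_, ?_⟩⟩
  · rw [Nat.floor_lt (mul_nonneg (h0 i) hbl.le)]
    push_cast
    have := mul_lt_mul_of_pos_right (ht i) hbl
    linarith
  · rw [div_le_iff₀ hbl]
    exact Nat.floor_le (mul_nonneg (h0 i) hbl.le)
  · rw [lt_div_iff₀ hbl]
    exact Nat.lt_floor_add_one _

theorem eq_of_mem_adicCube (hb : 2 ≤ b) {l : ℕ} {h h' : Fin d → Fin (b ^ l)} {t : cube d}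
    (ht : t ∈ adicCube d b l h) (ht' : t ∈ adicCube d b l h') : h = h' := by
  have hbl : (0 : ℝ) < (b : ℝ) ^ l := by positivity
  funext i
  have h1 := ht i
  have h2 := ht' i
  have e1 : ((h i : ℕ) : ℝ) < ((h' i : ℕ) : ℝ) + 1 := by
    have := h1.1.trans_lt h2.2
    rwa [div_lt_div_iff_of_pos_right hbl] at this
  have e2 : ((h' i : ℕ) : ℝ) < ((h i : ℕ) : ℝ) + 1 := by
    have := h2.1.trans_lt h1.2
    rwa [div_lt_div_iff_of_pos_right hbl] at this
  have e1' : (h i : ℕ) < (h' i : ℕ) + 1 := by exact_mod_cast e1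
  have e2' : (h' i : ℕ) < (h i : ℕ) + 1 := by exact_mod_cast e2
  exact Fin.ext (by omega)

theorem adicCube_subset_halfOpenCube (hb : 2 ≤ b) {l : ℕ} (h : Fin d → Fin (b ^ l)) :
    adicCube d b l h ⊆ halfOpenCube d := fun _ ht i =>
  (ht i).2.trans_le (adicCube_bounds hb (h i).2).2

theorem iUnion_adicCube (hb : 2 ≤ b) (l : ℕ) :
    ⋃ h, adicCube d b l h = halfOpenCube d := by
  ext t
  simp only [Set.mem_iUnion]
  exact ⟨fun ⟨h, ht⟩ => adicCube_subset_halfOpenCube hb h ht, exists_mem_adicCube hb l⟩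

theorem pairwise_disjoint_adicCube (hb : 2 ≤ b) (l : ℕ) :
    Pairwise (Function.onFun Disjoint (adicCube d b l)) := fun _ _ hne =>
  Set.disjoint_left.2 fun _ ht ht' => hne (eq_of_mem_adicCube hb ht ht')

theorem exists_adicCube_subset_of_succ (hb : 2 ≤ b) (l : ℕ) (h : Fin d → Fin (b ^ (l + 1))) :
    ∃ h', adicCube d b (l + 1) h ⊆ adicCube d b l h' := by
  have hb0 : 0 < b := by omega
  have hbR : (0 : ℝ) < b := by exact_mod_cast hb0
  have hbl : (0 : ℝ) < (b : ℝ) ^ l := by positivity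
  have hlt : ∀ i, (h i : ℕ) / b < b ^ l := fun i =>
    Nat.div_lt_of_lt_mul (by rw [← pow_succ']; exact (h i).2)
  refine ⟨fun i => ⟨(h i : ℕ) / b, hlt i⟩, fun t ht i => ?_⟩
  obtain ⟨h1, h2⟩ := ht i
  have e1 : (((h i : ℕ) / b : ℕ) : ℝ) * b ≤ (h i : ℕ) := by
    exact_mod_cast Nat.div_mul_le_self _ _
  have e2 : ((h i : ℕ) : ℝ) + 1 ≤ ((((h i : ℕ) / b : ℕ) : ℝ) + 1) * b := by
    have := Nat.lt_div_mul_add (a := (h i : ℕ)) hb0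
    have : (h i : ℕ) + 1 ≤ ((h i : ℕ) / b + 1) * b := by rw [add_mul, one_mul]; omega
    exact_mod_cast this
  constructor
  · refine le_trans ?_ h1
    rw [div_le_div_iff₀ hbl (by positivity)]
    calc _ = ((((h i : ℕ) / b : ℕ) : ℝ) * b) * (b : ℝ) ^ l := by ring
      _ ≤ _ := by gcongr
  · refine lt_of_lt_of_le h2 ?_
    rw [div_le_div_iff₀ (by positivity) hbl]
    calc _ ≤ (((((h i : ℕ) / b : ℕ) : ℝ) + 1) * b) * (b : ℝ) ^ l := by gcongr
      _ = _ := by ring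

theorem exists_adicCube_subset (hb : 2 ≤ b) {n l : ℕ} (hnl : n ≤ l) (h : Fin d → Fin (b ^ l)) :
    ∃ h', adicCube d b l h ⊆ adicCube d b n h' := by
  induction l, hnl using Nat.le_induction with
  | base => exact ⟨h, le_rfl⟩
  | succ l _ ih =>
    obtain ⟨h₁, hh₁⟩ := exists_adicCube_subset_of_succ hb l h
    obtain ⟨h₂, hh₂⟩ := ih h₁
    exact ⟨h₂, hh₁.trans hh₂⟩

theorem measurableSet_halfOpenCube : MeasurableSet (halfOpenCube d) := by
  rw [← iUnion_adicCube (b := 2) le_rfl 0]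
  exact MeasurableSet.iUnion fun h => measurableSet_adicCube 0 h

/-- The half-open cube is the single cell of generation `0`, whatever the base, and this cell has
full volume. -/
theorem ae_mem_halfOpenCube : ∀ᵐ t ∂(cubeVolume d), t ∈ halfOpenCube d := by
  rw [ae_iff, ← Set.compl_def, prob_compl_eq_zero_iff measurableSet_halfOpenCube,
    ← iUnion_adicCube (b := 2) le_rfl 0,
    measure_iUnion (pairwise_disjoint_adicCube le_rfl 0) (measurableSet_adicCube 0)]
  simp [cubeVolume_adicCube]

theorem restrict_halfOpenCube : (cubeVolume d).restrict (halfOpenCube d) = cubeVolume d :=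
  Measure.restrict_eq_self_of_ae_mem ae_mem_halfOpenCube

theorem lintegral_eq_sum_adicCube (hb : 2 ≤ b) (l : ℕ) (f : cube d → ℝ≥0∞) :
    ∫⁻ t, f t ∂(cubeVolume d) = ∑ h, ∫⁻ t in adicCube d b l h, f t ∂(cubeVolume d) := by
  rw [← restrict_halfOpenCube, ← iUnion_adicCube hb l,
    lintegral_iUnion (measurableSet_adicCube l) (pairwise_disjoint_adicCube hb l), tsum_fintype]
  simp only [iUnion_adicCube hb l, restrict_halfOpenCube]

theorem integral_eq_sum_adicCube (hb : 2 ≤ b) (l : ℕ) {E : Type*} [NormedAddCommGroup E]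
    [NormedSpace ℝ E] {f : cube d → E} (hf : Integrable f (cubeVolume d)) :
    ∫ t, f t ∂(cubeVolume d) = ∑ h, ∫ t in adicCube d b l h, f t ∂(cubeVolume d) := by
  conv_lhs => rw [← restrict_halfOpenCube, ← iUnion_adicCube hb l]
  exact integral_iUnion_fintype (measurableSet_adicCube l) (pairwise_disjoint_adicCube hb l)
    fun h => hf.integrableOn

theorem dist_le_of_mem_adicCube (hb : 2 ≤ b) {l : ℕ} {h : Fin d → Fin (b ^ l)} {t s : cube d}
    (ht : t ∈ adicCube d b l h) (hs : s ∈ adicCube d b l h) :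
    dist t s ≤ Real.sqrt d * ((b : ℝ) ^ l)⁻¹ := by
  have hbl : (0 : ℝ) < (b : ℝ) ^ l := by positivity
  rw [Subtype.dist_eq, EuclideanSpace.dist_eq, ← Real.sqrt_sq (inv_pos.2 hbl).le,
    ← Real.sqrt_mul (by positivity)]
  refine Real.sqrt_le_sqrt ?_
  calc ∑ i, dist (t.1 i) (s.1 i) ^ 2 ≤ ∑ _i : Fin d, (((b : ℝ) ^ l)⁻¹) ^ 2 := by
        refine Finset.sum_le_sum fun i _ => ?_
        have h1 := ht i
        have h2 := hs i
        have e : (((h i : ℕ) : ℝ) + 1) / (b : ℝ) ^ l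
            = ((h i : ℕ) : ℝ) / (b : ℝ) ^ l + ((b : ℝ) ^ l)⁻¹ := by
          rw [add_div, one_div]
        rw [e] at h1 h2
        gcongr
        rw [Real.dist_eq, abs_le]
        constructor <;> linarith [h1.1, h1.2, h2.1, h2.2]
    _ = _ := by simp

end Geometry

/-! ### Telescoping through cell averages -/

section Averages

variable {d b : ℕ}

/-- The average of `g` over the cell `h` of generation `l`. -/
noncomputable def cellMean (b l : ℕ) (g : cube d → ℝ) (h : Fin d → Fin (b ^ l)) : ℝ :=
  ((b : ℝ) ^ l) ^ d * ∫ s in adicCube d b l h, g s ∂(cubeVolume d)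

/-- The function obtained from `g` by averaging over the cells of generation `l`. -/
noncomputable def cellAvg (b l : ℕ) (g : cube d → ℝ) (t : cube d) : ℝ :=
  ∑ h, (adicCube d b l h).indicator (fun _ => cellMean b l g h) t

/-- The mean oscillation of `g` in the cells of generation `l`. -/
noncomputable def cellOsc (b l : ℕ) (g : cube d → ℝ) : ℝ≥0∞ :=
  ∑ h, ENNReal.ofReal (((b : ℝ) ^ l) ^ d) * ∫⁻ t in adicCube d b l h,
    ∫⁻ s in adicCube d b l h, ‖g t - g s‖ₑ ∂(cubeVolume d) ∂(cubeVolume d)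

theorem cellAvg_of_mem (hb : 2 ≤ b) {l : ℕ} (g : cube d → ℝ) {h : Fin d → Fin (b ^ l)} {t : cube d}
    (ht : t ∈ adicCube d b l h) : cellAvg b l g t = cellMean b l g h := by
  rw [cellAvg, Finset.sum_eq_single h]
  · exact Set.indicator_of_mem ht _
  · intro h' _ hne
    exact Set.indicator_of_notMem (fun ht' => hne (eq_of_mem_adicCube hb ht' ht)) _
  · simp

theorem integrable_cellAvg (l : ℕ) (g : cube d → ℝ) : Integrable (cellAvg b l g) (cubeVolume d) :=
  integrable_finsetSum _ fun h _ => (integrable_const _).indicator (measurableSet_adicCube l h)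

theorem ofReal_mul_cubeVolume_adicCube (hb : 2 ≤ b) (l : ℕ) (h : Fin d → Fin (b ^ l)) :
    ENNReal.ofReal (((b : ℝ) ^ l) ^ d) * cubeVolume d (adicCube d b l h) = 1 := by
  have hbl : (0 : ℝ) < (b : ℝ) ^ l := by positivity
  rw [cubeVolume_adicCube hb, ← ENNReal.ofReal_mul (by positivity), ← mul_pow,
    mul_inv_cancel₀ hbl.ne', one_pow, ENNReal.ofReal_one]

theorem enorm_cellMean_mul_le (hb : 2 ≤ b) (l : ℕ) (g : cube d → ℝ) (h : Fin d → Fin (b ^ l)) :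
    ‖cellMean b l g h‖ₑ ≤
      ENNReal.ofReal (((b : ℝ) ^ l) ^ d) * ∫⁻ s in adicCube d b l h, ‖g s‖ₑ ∂(cubeVolume d) := by
  rw [cellMean, enorm_mul, Real.enorm_of_nonneg (by positivity)]
  gcongr
  exact enorm_integral_le_lintegral_enorm _

theorem enorm_sub_cellMean_le (hb : 2 ≤ b) (l : ℕ) {g : cube d → ℝ}
    (hg : Integrable g (cubeVolume d)) (h : Fin d → Fin (b ^ l)) (t : cube d) :
    ‖g t - cellMean b l g h‖ₑ ≤ ENNReal.ofReal (((b : ℝ) ^ l) ^ d) *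
      ∫⁻ s in adicCube d b l h, ‖g t - g s‖ₑ ∂(cubeVolume d) := by
  have hbl : (0 : ℝ) < (b : ℝ) ^ l := by positivity
  have h1 : g t - cellMean b l g h
      = ((b : ℝ) ^ l) ^ d * ∫ s in adicCube d b l h, (g t - g s) ∂(cubeVolume d) := by
    rw [integral_sub (integrable_const _) hg.integrableOn, cellMean, mul_sub]
    congr 1
    rw [setIntegral_const, smul_eq_mul, measureReal_def, cubeVolume_adicCube hb,
      ENNReal.toReal_ofReal (by positivity), ← mul_assoc, ← mul_pow, mul_inv_cancel₀ hbl.ne',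
      one_pow, one_mul]
  rw [h1, enorm_mul, Real.enorm_of_nonneg (by positivity)]
  gcongr
  exact enorm_integral_le_lintegral_enorm _

theorem lintegral_sub_cellAvg_le (hb : 2 ≤ b) (l : ℕ) {g : cube d → ℝ}
    (hg : Integrable g (cubeVolume d)) :
    ∫⁻ t, ‖g t - cellAvg b l g t‖ₑ ∂(cubeVolume d) ≤ cellOsc b l g := by
  rw [lintegral_eq_sum_adicCube hb l, cellOsc]
  refine Finset.sum_le_sum fun h _ => ?_
  rw [← lintegral_const_mul' _ _ ENNReal.ofReal_ne_top]
  refine setLIntegral_mono' (measurableSet_adicCube l h) fun t ht => ?_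
  rw [cellAvg_of_mem hb g ht]
  exact enorm_sub_cellMean_le hb l hg h t

/-- The factor by which the Fourier transform of a cell of generation `l` is smaller than its
volume. -/
noncomputable def cellDecay (b l : ℕ) (x : EuclideanSpace ℝ (Fin d)) : ℝ≥0∞ :=
  ENNReal.ofReal (Real.sqrt d * (b : ℝ) ^ l / ‖x‖)

theorem integrable_wave_mul (x : EuclideanSpace ℝ (Fin d)) {g : cube d → ℝ}
    (hg : Integrable g (cubeVolume d)) : Integrable (fun t => wave x t * (g t : ℂ))
      (cubeVolume d) :=
  hg.ofReal.bdd_mul (c := 1) (continuous_wave x).aestronglyMeasurable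
    (Eventually.of_forall fun t => (norm_wave x t).le)

theorem enorm_wave (x : EuclideanSpace ℝ (Fin d)) (t : cube d) : ‖wave x t‖ₑ = 1 := by
  rw [← ofReal_norm, norm_wave, ENNReal.ofReal_one]

theorem enorm_complex_ofReal (r : ℝ) : ‖(r : ℂ)‖ₑ = ‖r‖ₑ := by
  rw [← ofReal_norm, ← ofReal_norm, Complex.norm_real]

theorem enorm_integral_wave_mul_le (x : EuclideanSpace ℝ (Fin d)) (g : cube d → ℝ) :
    ‖∫ t, wave x t * (g t : ℂ) ∂(cubeVolume d)‖ₑ ≤ ∫⁻ t, ‖g t‖ₑ ∂(cubeVolume d) := by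
  refine (enorm_integral_le_lintegral_enorm _).trans (le_of_eq ?_)
  refine lintegral_congr fun t => ?_
  rw [enorm_mul, enorm_wave, one_mul, enorm_complex_ofReal]

/-- The average is constant on each cell, so the character can be integrated over the cell first;
the volume in its bound cancels the normalisation of the mean. -/
theorem enorm_integral_wave_mul_cellAvg_le (hd : 1 ≤ d) (hb : 2 ≤ b) (l : ℕ) (g : cube d → ℝ)
    {x : EuclideanSpace ℝ (Fin d)} (hx : x ≠ 0) :
    ‖∫ t, wave x t * (cellAvg b l g t : ℂ) ∂(cubeVolume d)‖ₑ ≤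
      cellDecay b l x * ∫⁻ t, ‖g t‖ₑ ∂(cubeVolume d) := by
  rw [integral_eq_sum_adicCube hb l (integrable_wave_mul x (integrable_cellAvg l g)),
    lintegral_eq_sum_adicCube hb l, Finset.mul_sum]
  refine (enorm_sum_le _ _).trans (Finset.sum_le_sum fun h _ => ?_)
  have h1 : ∫ t in adicCube d b l h, wave x t * (cellAvg b l g t : ℂ) ∂(cubeVolume d)
      = (∫ t in adicCube d b l h, wave x t ∂(cubeVolume d)) * (cellMean b l g h : ℂ) := by
    rw [← integral_mul_const]
    refine setIntegral_congr_fun (measurableSet_adicCube l h) fun t ht => ?_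
    simp only [cellAvg_of_mem hb g ht]
  rw [h1, enorm_mul, enorm_complex_ofReal]
  calc _ ≤ (ENNReal.ofReal ((((b : ℝ) ^ l)⁻¹) ^ d) * cellDecay b l x) *
        (ENNReal.ofReal (((b : ℝ) ^ l) ^ d) *
          ∫⁻ s in adicCube d b l h, ‖g s‖ₑ ∂(cubeVolume d)) := by
        gcongr
        · rw [cellDecay, ← ENNReal.ofReal_mul (by positivity), ← ofReal_norm]
          exact ENNReal.ofReal_le_ofReal (norm_setIntegral_wave_le hd hb l h hx)
        · exact enorm_cellMean_mul_le hb l g h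
    _ = (ENNReal.ofReal (((b : ℝ) ^ l) ^ d) * ENNReal.ofReal ((((b : ℝ) ^ l)⁻¹) ^ d)) *
        (cellDecay b l x * ∫⁻ s in adicCube d b l h, ‖g s‖ₑ ∂(cubeVolume d)) := by ring
    _ = _ := by
        rw [← cubeVolume_adicCube hb l h, ofReal_mul_cubeVolume_adicCube hb, one_mul]

/-- Because cells are nested, a function constant on coarse cells is unchanged by averaging over
finer ones. -/
theorem cellAvg_succ_cellAvg (hb : 2 ≤ b) (l : ℕ) (g : cube d → ℝ) :
    cellAvg b (l + 1) (cellAvg b l g) = cellAvg b l g := by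
  have hbl : (0 : ℝ) < (b : ℝ) ^ (l + 1) := by positivity
  funext t
  by_cases ht : t ∈ halfOpenCube d
  · obtain ⟨h, hth⟩ := exists_mem_adicCube hb (l + 1) ht
    obtain ⟨h', hh'⟩ := exists_adicCube_subset_of_succ hb l h
    rw [cellAvg_of_mem hb _ hth, cellAvg_of_mem hb _ (hh' hth), cellMean,
      setIntegral_congr_fun (g := fun _ => cellMean b l g h') (measurableSet_adicCube (l + 1) h)
      (fun s hs => cellAvg_of_mem hb g (hh' hs)), setIntegral_const, smul_eq_mul, measureReal_def,
      cubeVolume_adicCube hb, ENNReal.toReal_ofReal (by positivity), ← mul_assoc, ← mul_pow,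
      mul_inv_cancel₀ hbl.ne', one_pow, one_mul]
  · have h0 : ∀ (k : ℕ) (f : cube d → ℝ), cellAvg b k f t = 0 := fun k f =>
      Finset.sum_eq_zero fun h _ =>
        Set.indicator_of_notMem (fun hth => ht (adicCube_subset_halfOpenCube hb h hth)) _
    rw [h0, h0]

theorem cellAvg_sub (l : ℕ) {f g : cube d → ℝ} (hf : Integrable f (cubeVolume d))
    (hg : Integrable g (cubeVolume d)) (t : cube d) :
    cellAvg b l (fun s => f s - g s) t = cellAvg b l f t - cellAvg b l g t := by
  classical
  simp only [cellAvg, ← Finset.sum_sub_distrib]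
  refine Finset.sum_congr rfl fun h _ => ?_
  have : cellMean b l (fun s => f s - g s) h = cellMean b l f h - cellMean b l g h := by
    rw [cellMean, integral_sub hf.integrableOn hg.integrableOn, mul_sub]; rfl
  rw [this, Set.indicator_apply, Set.indicator_apply, Set.indicator_apply]
  split_ifs <;> simp

/-- The difference of the averages at generations `l + 1` and `l` is the finer average of `g -
cellAvg b l g`. It therefore gains `cellDecay` at generation `l + 1`, and its `L¹` size is
controlled by the oscillation at generation `l`. -/
theorem enorm_integral_wave_mul_cellAvg_succ_le (hd : 1 ≤ d) (hb : 2 ≤ b) (l : ℕ) {g : cube d → ℝ}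
    (hg : Integrable g (cubeVolume d)) {x : EuclideanSpace ℝ (Fin d)} (hx : x ≠ 0) :
    ‖∫ t, wave x t * (cellAvg b (l + 1) g t : ℂ) ∂(cubeVolume d)‖ₑ ≤
      cellDecay b (l + 1) x * cellOsc b l g +
        ‖∫ t, wave x t * (cellAvg b l g t : ℂ) ∂(cubeVolume d)‖ₑ := by
  have hl := integrable_cellAvg (b := b) l g
  have h1 : ∀ t, cellAvg b (l + 1) g t
      = cellAvg b (l + 1) (fun s => g s - cellAvg b l g s) t + cellAvg b l g t := fun t => by
    rw [cellAvg_sub (l + 1) hg hl, cellAvg_succ_cellAvg hb, sub_add_cancel]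
  simp only [h1, Complex.ofReal_add, mul_add]
  rw [integral_add (integrable_wave_mul x (integrable_cellAvg _ _)) (integrable_wave_mul x hl)]
  refine (enorm_add_le _ _).trans ?_
  gcongr
  refine (enorm_integral_wave_mul_cellAvg_le hd hb (l + 1) _ hx).trans ?_
  gcongr
  exact lintegral_sub_cellAvg_le hb l hg

/-- The bound for the Fourier transform of `g` at frequencies `x` by the mean oscillations of `g` at
the generations between `n` and `k`. -/
theorem enorm_integral_wave_mul_le_cellOsc (hd : 1 ≤ d) (hb : 2 ≤ b) {n k : ℕ} (hnk : n ≤ k)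
    (g : cube d → ℝ) {x : EuclideanSpace ℝ (Fin d)} (hx : x ≠ 0) :
    ‖∫ t, wave x t * (g t : ℂ) ∂(cubeVolume d)‖ₑ ≤ cellOsc b k g +
      ∑ l ∈ Finset.Ico n k, cellDecay b (l + 1) x * cellOsc b l g +
      cellDecay b n x * ∫⁻ t, ‖g t‖ₑ ∂(cubeVolume d) := by
  by_cases hg : Integrable g (cubeVolume d)
  · have h1 : ‖∫ t, wave x t * (cellAvg b k g t : ℂ) ∂(cubeVolume d)‖ₑ ≤
        ∑ l ∈ Finset.Ico n k, cellDecay b (l + 1) x * cellOsc b l g +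
        cellDecay b n x * ∫⁻ t, ‖g t‖ₑ ∂(cubeVolume d) := by
      induction k, hnk using Nat.le_induction with
      | base =>
        simpa using enorm_integral_wave_mul_cellAvg_le hd hb n g hx
      | succ k hk ih =>
        refine (enorm_integral_wave_mul_cellAvg_succ_le hd hb k hg hx).trans ?_
        rw [Finset.sum_Ico_succ_top hk, add_comm (∑ l ∈ Finset.Ico n k, _), add_assoc]
        gcongr
    have hk := integrable_cellAvg (b := b) k g
    have h2 : ∫ t, wave x t * (g t : ℂ) ∂(cubeVolume d)
        = ∫ t, wave x t * ((g t - cellAvg b k g t : ℝ) : ℂ) ∂(cubeVolume d)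
          + ∫ t, wave x t * (cellAvg b k g t : ℂ) ∂(cubeVolume d) := by
      rw [← integral_add (integrable_wave_mul x (g := fun t => g t - cellAvg b k g t) (hg.sub hk))
        (integrable_wave_mul x hk)]
      refine integral_congr_ae (Eventually.of_forall fun t => ?_)
      push_cast; ring
    rw [h2, add_assoc]
    refine (enorm_add_le _ _).trans ?_
    gcongr
    exact (enorm_integral_wave_mul_le x _).trans (lintegral_sub_cellAvg_le hb k hg)
  -- If `g` is not integrable, then neither is its product with a unimodular function, and the
  -- integral on the left has the default value `0`.
  · have : ¬ Integrable (fun t => wave x t * (g t : ℂ)) (cubeVolume d) := fun h => hg <| by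
      have h2 := (h.bdd_mul (c := 1) (f := fun t => wave (-x) t)
        (continuous_wave _).aestronglyMeasurable
        (Eventually.of_forall fun t => (norm_wave _ t).le)).re
      refine h2.congr (Eventually.of_forall fun t => ?_)
      have h3 : wave (-x) t * wave x t = 1 := by
        rw [wave, wave, ← Complex.exp_add]; simp
      simp only [← mul_assoc, h3, one_mul]
      exact RCLike.ofReal_re (K := ℂ) (g t)
    rw [integral_undef this]
    simp

end Averages

/-! ### `L^p` norms with values in `[0, ∞]` -/

section PNorm

variable {Ω : Type*} [MeasurableSpace Ω]

/-- The `L^p` norm of a random variable with values in `[0, ∞]`. -/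
noncomputable def pNorm (Pr : Measure Ω) (p : ℝ) (F : Ω → ℝ≥0∞) : ℝ≥0∞ :=
  (∫⁻ ω, F ω ^ p ∂Pr) ^ (1 / p)

variable {Pr : Measure Ω} {p : ℝ}

theorem pNorm_mono (hp : 1 ≤ p) {F F' : Ω → ℝ≥0∞} (h : ∀ᵐ ω ∂Pr, F ω ≤ F' ω) :
    pNorm Pr p F ≤ pNorm Pr p F' := by
  unfold pNorm
  refine ENNReal.rpow_le_rpow (lintegral_mono_ae ?_) (by positivity)
  filter_upwards [h] with ω hω
  exact ENNReal.rpow_le_rpow hω (by linarith)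

theorem pNorm_add_le (hp : 1 ≤ p) {F F' : Ω → ℝ≥0∞} (hF : AEMeasurable F Pr)
    (hF' : AEMeasurable F' Pr) :
    pNorm Pr p (fun ω => F ω + F' ω) ≤ pNorm Pr p F + pNorm Pr p F' :=
  ENNReal.lintegral_Lp_add_le hF hF' hp

theorem pNorm_zero (hp : 1 ≤ p) : pNorm Pr p (fun _ => 0) = 0 := by
  have h0 : 0 < p := by linarith
  simp [pNorm, ENNReal.zero_rpow_of_pos h0, h0]

theorem pNorm_sum_le (hp : 1 ≤ p) {ι : Type*} (T : Finset ι) {F : ι → Ω → ℝ≥0∞}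
    (hF : ∀ i ∈ T, AEMeasurable (F i) Pr) :
    pNorm Pr p (fun ω => ∑ i ∈ T, F i ω) ≤ ∑ i ∈ T, pNorm Pr p (F i) := by
  classical
  induction T using Finset.induction_on with
  | empty => simp [pNorm_zero hp]
  | insert i T hi ih =>
    simp only [Finset.sum_insert hi]
    refine (pNorm_add_le hp (hF i (Finset.mem_insert_self i T))
      (Finset.aemeasurable_fun_sum T fun j hj => hF j (Finset.mem_insert_of_mem hj))).trans ?_
    gcongr
    exact ih fun j hj => hF j (Finset.mem_insert_of_mem hj)

theorem pNorm_const_mul (hp : 1 ≤ p) (c : ℝ≥0∞) {F : Ω → ℝ≥0∞} (hF : AEMeasurable F Pr) :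
    pNorm Pr p (fun ω => c * F ω) = c * pNorm Pr p F := by
  have h0 : 0 < p := by linarith
  unfold pNorm
  simp only [ENNReal.mul_rpow_of_nonneg _ _ h0.le]
  rw [lintegral_const_mul'' _ (hF.pow_const p), ENNReal.mul_rpow_of_nonneg _ _ (by positivity),
    ← ENNReal.rpow_mul, mul_one_div, div_self h0.ne', ENNReal.rpow_one]

theorem pNorm_eq_eLpNorm' (F : Ω → ℝ≥0∞) : pNorm Pr p F = eLpNorm' F p Pr := rfl

theorem pNorm_le_pNorm [IsProbabilityMeasure Pr] {q : ℝ} (hp : 1 ≤ p) (hpq : p ≤ q)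
    {F : Ω → ℝ≥0∞} (hF : Measurable F) : pNorm Pr p F ≤ pNorm Pr q F := by
  rw [pNorm_eq_eLpNorm', pNorm_eq_eLpNorm']
  exact eLpNorm'_le_eLpNorm'_of_exponent_le (by linarith) hpq Pr hF.aestronglyMeasurable

theorem lintegral_le_pNorm [IsProbabilityMeasure Pr] (hp : 1 ≤ p)
    {F : Ω → ℝ≥0∞} (hF : Measurable F) : ∫⁻ ω, F ω ∂Pr ≤ pNorm Pr p F := by
  have := pNorm_le_pNorm (Pr := Pr) le_rfl hp hF
  simpa [pNorm] using this

theorem pNorm_mul_of_indepFun {F F' : Ω → ℝ≥0∞} (hp : 1 ≤ p) (hF : Measurable F)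
    (hF' : Measurable F') (h : IndepFun F F' Pr) :
    pNorm Pr p (fun ω => F ω * F' ω) = pNorm Pr p F * pNorm Pr p F' := by
  have h0 : 0 < p := by linarith
  unfold pNorm
  simp only [ENNReal.mul_rpow_of_nonneg _ _ h0.le]
  have hm : Measurable fun x : ℝ≥0∞ => x ^ p := by fun_prop
  rw [← ENNReal.mul_rpow_of_nonneg _ _ (by positivity)]
  congr 1
  exact lintegral_mul_eq_lintegral_mul_lintegral_of_indepFun (hm.comp hF) (hm.comp hF')
    (h.comp hm hm)

/-- Minkowski's inequality for integrals, with a uniform bound for the integrands. -/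
theorem pNorm_lintegral_le [SFinite Pr] {X : Type*} [MeasurableSpace X] {ρ : Measure X}
    [IsFiniteMeasure ρ] (hp : 1 ≤ p) {F : X → Ω → ℝ≥0∞}
    (hF : Measurable fun z : X × Ω => F z.1 z.2)
    {c : ℝ≥0∞} (hc : ∀ᵐ x ∂ρ, pNorm Pr p (F x) ≤ c) :
    pNorm Pr p (fun ω => ∫⁻ x, F x ω ∂ρ) ≤ ρ Set.univ * c := by
  have h0 : 0 < p := by linarith
  have hFs : Measurable fun z : Ω × X => F z.2 z.1 := hF.comp measurable_swap
  have hc' : ∀ᵐ x ∂ρ, ∫⁻ ω, F x ω ^ p ∂Pr ≤ c ^ p := by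
    filter_upwards [hc] with x hx
    have := ENNReal.rpow_le_rpow hx h0.le
    rwa [pNorm, ← ENNReal.rpow_mul, one_div_mul_cancel h0.ne', ENNReal.rpow_one] at this
  -- Hölder's inequality against the constant `1`; Tonelli's theorem then exchanges the integrals
  -- over `ρ` and `Pr`.
  have hJ : ∀ ω, (∫⁻ x, F x ω ∂ρ) ^ p ≤ ρ Set.univ ^ (p - 1) * ∫⁻ x, F x ω ^ p ∂ρ := by
    intro ω
    rcases hp.eq_or_lt with h1 | h1
    · rw [← h1]; simp
    have hpq := Real.HolderConjugate.conjExponent h1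
    have := ENNReal.lintegral_mul_le_Lp_mul_Lq ρ hpq
      (f := fun x => F x ω) (g := fun _ => 1)
      (hFs.comp (measurable_prodMk_left (x := ω))).aemeasurable
      aemeasurable_const
    simp only [Pi.mul_apply, mul_one, ENNReal.one_rpow, lintegral_one] at this
    refine (ENNReal.rpow_le_rpow this h0.le).trans (le_of_eq ?_)
    rw [ENNReal.mul_rpow_of_nonneg _ _ h0.le, ← ENNReal.rpow_mul, ← ENNReal.rpow_mul,
      one_div_mul_cancel h0.ne', ENNReal.rpow_one, mul_comm]
    congr 2
    rw [Real.conjExponent]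
    have : p - 1 ≠ 0 := by linarith
    field_simp
  have h2 : ∫⁻ ω, (∫⁻ x, F x ω ∂ρ) ^ p ∂Pr ≤ (ρ Set.univ * c) ^ p := by
    calc ∫⁻ ω, (∫⁻ x, F x ω ∂ρ) ^ p ∂Pr
        ≤ ∫⁻ ω, ρ Set.univ ^ (p - 1) * ∫⁻ x, F x ω ^ p ∂ρ ∂Pr := lintegral_mono hJ
      _ = ρ Set.univ ^ (p - 1) * ∫⁻ x, ∫⁻ ω, F x ω ^ p ∂Pr ∂ρ := by
        rw [lintegral_const_mul _ (hFs.pow_const p).lintegral_prod_right',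
          lintegral_lintegral_swap (hFs.pow_const p).aemeasurable]
      _ ≤ ρ Set.univ ^ (p - 1) * (c ^ p * ρ Set.univ) := by
        gcongr
        exact (lintegral_mono_ae hc').trans (by rw [lintegral_const])
      _ = (ρ Set.univ * c) ^ p := by
        rw [ENNReal.mul_rpow_of_nonneg _ _ h0.le]
        rcases eq_or_ne (ρ Set.univ) 0 with hz | hz
        · rw [hz, ENNReal.zero_rpow_of_pos h0]; simp
        · have : ρ Set.univ ^ p = ρ Set.univ ^ (p - 1) * ρ Set.univ := by
            nth_rewrite 3 [← ENNReal.rpow_one (ρ Set.univ)]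
            rw [← ENNReal.rpow_add _ _ hz (measure_ne_top _ _)]
            congr 1; ring
          rw [this]; ring
  calc _ ≤ ((ρ Set.univ * c) ^ p) ^ (1 / p) := ENNReal.rpow_le_rpow h2 (by positivity)
    _ = _ := by rw [← ENNReal.rpow_mul, mul_one_div, div_self h0.ne', ENNReal.rpow_one]

end PNorm

/-! ### Moments of the bound for one cell -/

section FrequencyBound

variable {d b : ℕ}

/-- The bound for the Fourier transform of `g` at the frequencies of norm at least `b ^ k`, in terms
of the oscillations of `g` from generation `n` on. -/
noncomputable def freqBound (b n k : ℕ) (g : cube d → ℝ) : ℝ≥0∞ :=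
  if n ≤ k then cellOsc b k g +
    ∑ l ∈ Finset.Ico n k, ENNReal.ofReal (Real.sqrt d * (b : ℝ) ^ (l + 1) / (b : ℝ) ^ k) *
      cellOsc b l g +
    ENNReal.ofReal (Real.sqrt d * (b : ℝ) ^ n / (b : ℝ) ^ k) * ∫⁻ t, ‖g t‖ₑ ∂(cubeVolume d)
  else ∫⁻ t, ‖g t‖ₑ ∂(cubeVolume d)

theorem enorm_integral_wave_mul_le_freqBound (hd : 1 ≤ d) (hb : 2 ≤ b) (n k : ℕ) (g : cube d → ℝ)
    {x : EuclideanSpace ℝ (Fin d)} (hx : (b : ℝ) ^ k ≤ ‖x‖) :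
    ‖∫ t, wave x t * (g t : ℂ) ∂(cubeVolume d)‖ₑ ≤ freqBound b n k g := by
  have hbk : (0 : ℝ) < (b : ℝ) ^ k := by positivity
  have hx0 : x ≠ 0 := norm_pos_iff.1 (hbk.trans_le hx)
  rw [freqBound]
  split_ifs with h
  · refine (enorm_integral_wave_mul_le_cellOsc hd hb h g hx0).trans ?_
    have key : ∀ l, cellDecay b l x ≤ ENNReal.ofReal (Real.sqrt d * (b : ℝ) ^ l / (b : ℝ) ^ k) :=
      fun l => ENNReal.ofReal_le_ofReal (by gcongr)
    gcongr
    · exact key _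
    · exact key _
  · exact enorm_integral_wave_mul_le x g

variable {Ω : Type*} [MeasurableSpace Ω] {Pr : Measure Ω} {p : ℝ}

theorem measurable_cellOsc (l : ℕ) {f : cube d → Ω → ℝ}
    (hf : Measurable fun z : cube d × Ω => f z.1 z.2) :
    Measurable fun ω => cellOsc b l (fun t => f t ω) := by
  unfold cellOsc
  refine Finset.measurable_fun_sum _ fun h _ => Measurable.const_mul ?_ _
  have h1 : Measurable fun z : (Ω × cube d) × cube d => ‖f z.1.2 z.1.1 - f z.2 z.1.1‖ₑ := by
    refine Measurable.enorm (Measurable.sub ?_ ?_)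
    · exact hf.comp ((measurable_snd.comp measurable_fst).prodMk
        (measurable_fst.comp measurable_fst))
    · exact hf.comp (measurable_snd.prodMk (measurable_fst.comp measurable_fst))
  exact (h1.lintegral_prod_right' (ν := (cubeVolume d).restrict (adicCube d b l h))).lintegral_prod_right'
    (ν := (cubeVolume d).restrict (adicCube d b l h))

theorem measurable_lintegral_enorm {f : cube d → Ω → ℝ}
    (hf : Measurable fun z : cube d × Ω => f z.1 z.2) :
    Measurable fun ω => ∫⁻ t, ‖f t ω‖ₑ ∂(cubeVolume d) :=
  (hf.comp measurable_swap).enorm.lintegral_prod_right'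

theorem measurable_freqBound (n k : ℕ) {f : cube d → Ω → ℝ}
    (hf : Measurable fun z : cube d × Ω => f z.1 z.2) :
    Measurable fun ω => freqBound b n k (fun t => f t ω) := by
  unfold freqBound
  have h1 := measurable_lintegral_enorm hf
  have h2 := fun l => measurable_cellOsc (b := b) l hf
  split_ifs
  · exact ((h2 k).add (Finset.measurable_fun_sum _ fun l _ => (h2 l).const_mul _)).add
      (h1.const_mul _)
  · exact h1

/-- No cell straddles the boundary of `I`, so the indicator creates no oscillation. Minkowski's
inequality on the product of a cell with itself gives two volumes, one of which cancels the
normalisation of `cellOsc`. -/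
theorem pNorm_cellOsc_indicator_le (hb : 2 ≤ b) [SFinite Pr] (hp : 1 ≤ p) (l : ℕ)
    {f : cube d → Ω → ℝ} (hf : Measurable fun z : cube d × Ω => f z.1 z.2)
    {I : Set (cube d)}
    (hIl : ∀ h, adicCube d b l h ⊆ I ∨ Disjoint (adicCube d b l h) I) {c : ℝ≥0∞}
    (hc : ∀ h, adicCube d b l h ⊆ I → ∀ t ∈ adicCube d b l h, ∀ s ∈ adicCube d b l h,
      pNorm Pr p (fun ω => ‖f t ω - f s ω‖ₑ) ≤ c) :
    pNorm Pr p (fun ω => cellOsc b l (fun t => I.indicator (fun t => f t ω) t)) ≤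
      cubeVolume d I * c := by
  classical
  set T : Finset (Fin d → Fin (b ^ l)) := Finset.univ.filter fun h => adicCube d b l h ⊆ I
  have h1 : ∀ ω, cellOsc b l (fun t => I.indicator (fun t => f t ω) t) =
      ∑ h ∈ T, ENNReal.ofReal (((b : ℝ) ^ l) ^ d) * ∫⁻ z, ‖f z.1 ω - f z.2 ω‖ₑ
        ∂(((cubeVolume d).restrict (adicCube d b l h)).prod
          ((cubeVolume d).restrict (adicCube d b l h))) := by
    intro ω
    rw [cellOsc, Finset.sum_filter]
    refine Finset.sum_congr rfl fun h _ => ?_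
    have hm := measurableSet_adicCube (d := d) (b := b) l h
    split_ifs with hh
    · congr 1
      rw [lintegral_prod]
      · refine setLIntegral_congr_fun hm fun t ht => ?_
        refine setLIntegral_congr_fun hm fun s hs => ?_
        simp only [Set.indicator_of_mem (hh ht), Set.indicator_of_mem (hh hs)]
      · refine Measurable.aemeasurable (Measurable.enorm (Measurable.sub ?_ ?_))
        · exact hf.comp (measurable_fst.prodMk measurable_const)
        · exact hf.comp (measurable_snd.prodMk measurable_const)
    · have hd := Set.disjoint_left.1 ((hIl h).resolve_left hh)
      have : ∫⁻ t in adicCube d b l h, ∫⁻ s in adicCube d b l h,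
          ‖I.indicator (fun t => f t ω) t - I.indicator (fun t => f t ω) s‖ₑ
            ∂(cubeVolume d) ∂(cubeVolume d) = 0 := by
        rw [setLIntegral_congr_fun (g := fun _ => 0) hm, lintegral_zero]
        intro t ht
        simp only
        rw [setLIntegral_congr_fun (g := fun _ => 0) hm, lintegral_zero]
        intro s hs
        simp [Set.indicator_of_notMem (hd ht), Set.indicator_of_notMem (hd hs)]
      rw [this, mul_zero]
  simp only [h1]
  have hmz : Measurable fun z : (cube d × cube d) × Ω => ‖f z.1.1 z.2 - f z.1.2 z.2‖ₑ := by
    refine Measurable.enorm (Measurable.sub ?_ ?_)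
    · exact hf.comp ((measurable_fst.comp measurable_fst).prodMk measurable_snd)
    · exact hf.comp ((measurable_snd.comp measurable_fst).prodMk measurable_snd)
  have hmi : ∀ h : Fin d → Fin (b ^ l), Measurable fun ω => ∫⁻ z, ‖f z.1 ω - f z.2 ω‖ₑ
        ∂(((cubeVolume d).restrict (adicCube d b l h)).prod
          ((cubeVolume d).restrict (adicCube d b l h))) := fun h =>
    (hmz.comp measurable_swap).lintegral_prod_right'
  calc _ ≤ ∑ h ∈ T, pNorm Pr p (fun ω => ENNReal.ofReal (((b : ℝ) ^ l) ^ d) *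
          ∫⁻ z, ‖f z.1 ω - f z.2 ω‖ₑ ∂(((cubeVolume d).restrict (adicCube d b l h)).prod
          ((cubeVolume d).restrict (adicCube d b l h)))) :=
        pNorm_sum_le hp T fun h _ => ((hmi h).const_mul _).aemeasurable
    _ ≤ ∑ h ∈ T, cubeVolume d (adicCube d b l h) * c := by
        refine Finset.sum_le_sum fun h hh => ?_
        have hhI : adicCube d b l h ⊆ I := (Finset.mem_filter.1 hh).2
        rw [pNorm_const_mul hp _ (hmi h).aemeasurable]
        have hm := measurableSet_adicCube (d := d) (b := b) l h
        have h3 : ∀ᵐ z ∂(((cubeVolume d).restrict (adicCube d b l h)).prod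
            ((cubeVolume d).restrict (adicCube d b l h))),
            pNorm Pr p (fun ω => ‖f z.1 ω - f z.2 ω‖ₑ) ≤ c := by
          rw [Measure.prod_restrict]
          filter_upwards [ae_restrict_mem (hm.prod hm)] with z hz
          exact hc h hhI z.1 hz.1 z.2 hz.2
        refine (mul_le_mul_right (pNorm_lintegral_le hp
          (F := fun (z : cube d × cube d) ω => ‖f z.1 ω - f z.2 ω‖ₑ) hmz h3) _).trans
          (le_of_eq ?_)
        rw [Measure.prod_restrict, Measure.restrict_apply_univ, Measure.prod_prod, ← mul_assoc,
          ← mul_assoc, ofReal_mul_cubeVolume_adicCube hb, one_mul]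
    _ = (∑ h ∈ T, cubeVolume d (adicCube d b l h)) * c := by rw [Finset.sum_mul]
    _ ≤ _ := by
        gcongr
        rw [← measure_biUnion_finset
          (fun h _ h' _ hne => pairwise_disjoint_adicCube hb l hne)
          (fun h _ => measurableSet_adicCube l h)]
        exact measure_mono (Set.iUnion₂_subset fun h hh => (Finset.mem_filter.1 hh).2)

theorem pNorm_lintegral_indicator_le [SFinite Pr] (hp : 1 ≤ p)
    {f : cube d → Ω → ℝ} (hf : Measurable fun z : cube d × Ω => f z.1 z.2)
    {I : Set (cube d)} (hI : MeasurableSet I) {c : ℝ≥0∞}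
    (hc : ∀ t ∈ I ∩ halfOpenCube d, pNorm Pr p (fun ω => ‖f t ω‖ₑ) ≤ c) :
    pNorm Pr p (fun ω => ∫⁻ t, ‖I.indicator (fun t => f t ω) t‖ₑ ∂(cubeVolume d)) ≤
      cubeVolume d I * c := by
  have h1 : ∀ ω, ∫⁻ t, ‖I.indicator (fun t => f t ω) t‖ₑ ∂(cubeVolume d)
      = ∫⁻ t, ‖f t ω‖ₑ ∂((cubeVolume d).restrict I) := fun ω => by
    rw [← lintegral_indicator hI]
    refine lintegral_congr fun t => ?_
    exact enorm_indicator_eq_indicator_enorm (fun t => f t ω) t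
  simp only [h1]
  refine (pNorm_lintegral_le hp (F := fun t ω => ‖f t ω‖ₑ) hf.enorm (c := c) ?_).trans
    (by rw [Measure.restrict_apply_univ])
  filter_upwards [ae_restrict_mem hI, ae_restrict_of_ae ae_mem_halfOpenCube] with t h2 h3
  exact hc t ⟨h2, h3⟩

/-- The moment bound for `freqBound`, for a random function with a Hölder bound in the mean. -/
theorem pNorm_freqBound_le (hb : 2 ≤ b) [SFinite Pr] (hp : 1 ≤ p) (n k : ℕ)
    {f : cube d → Ω → ℝ} (hf : Measurable fun z : cube d × Ω => f z.1 z.2)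
    {I : Set (cube d)} (hI : MeasurableSet I)
    (hIl : ∀ l, n ≤ l → ∀ h, adicCube d b l h ⊆ I ∨ Disjoint (adicCube d b l h) I)
    {c M : ℝ≥0∞} {α : ℝ} (hα : 0 < α) (hα1 : α ≤ 1)
    (hc : ∀ t ∈ I ∩ halfOpenCube d, pNorm Pr p (fun ω => ‖f t ω‖ₑ) ≤ c)
    (hosc : ∀ l, n ≤ l → ∀ h, adicCube d b l h ⊆ I → ∀ t ∈ adicCube d b l h,
      ∀ s ∈ adicCube d b l h, pNorm Pr p (fun ω => ‖f t ω - f s ω‖ₑ) ≤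
        c * M * ENNReal.ofReal ((b : ℝ) ^ (((n : ℝ) - l) * α))) :
    pNorm Pr p (fun ω => freqBound b n k (fun t => I.indicator (fun t => f t ω) t)) ≤
      cubeVolume d I * c * (M + 1) * ENNReal.ofReal ((Real.sqrt d * b + 1) * (k + 1)) *
        ENNReal.ofReal (min 1 ((b : ℝ) ^ (((n : ℝ) - k) * α))) := by
  have hb0 : (0 : ℝ) < b := by positivity
  have hb1 : (1 : ℝ) ≤ b := by exact_mod_cast (by omega : 1 ≤ b)
  have hb1' : (1 : ℝ) < b := by exact_mod_cast (by omega : 1 < b)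
  have hfI : Measurable fun z : cube d × Ω => I.indicator (fun t => f t z.2) z.1 := by
    have : (fun z : cube d × Ω => I.indicator (fun t => f t z.2) z.1)
        = (Prod.fst ⁻¹' I).indicator (fun z : cube d × Ω => f z.1 z.2) := by
      rfl
    rw [this]
    exact hf.indicator (measurable_fst hI)
  have hint := pNorm_lintegral_indicator_le hp hf hI hc
  have hmi := measurable_lintegral_enorm (f := fun t ω => I.indicator (fun t => f t ω) t) hfI
  have hmo := fun l => measurable_cellOsc (b := b) (f := fun t ω => I.indicator (fun t => f t ω) t) l hfI
  have hsq : 0 ≤ Real.sqrt d := Real.sqrt_nonneg _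
  unfold freqBound
  split_ifs with hnk
  · have hnkR : (n : ℝ) ≤ k := by exact_mod_cast hnk
    have hmin : min 1 ((b : ℝ) ^ (((n : ℝ) - k) * α)) = (b : ℝ) ^ (((n : ℝ) - k) * α) := by
      refine min_eq_right (Real.rpow_le_one_of_one_le_of_nonpos hb1 ?_)
      exact mul_nonpos_of_nonpos_of_nonneg (by linarith) hα.le
    rw [hmin]
    set E : ℝ := (b : ℝ) ^ (((n : ℝ) - k) * α) with hE
    have hE0 : 0 ≤ E := by positivity
    set v := cubeVolume d I
    -- Generation `l` gains `b ^ (l - k)` from the character and `b ^ ((n - l) * α)` from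
    -- regularity. Since `α ≤ 1`, the worst case is `l = k`. All generations thus have the same
    -- bound, and their number accounts for the factor `k + 1`.
    have hkey : ∀ l : ℕ, l ≤ k → (b : ℝ) ^ l / (b : ℝ) ^ k * (b : ℝ) ^ (((n : ℝ) - l) * α) ≤ E := by
      intro l hlk
      have hlk' : (l : ℝ) ≤ k := by exact_mod_cast hlk
      rw [← Real.rpow_natCast, ← Real.rpow_natCast, ← Real.rpow_sub hb0, ← Real.rpow_add hb0, hE]
      refine Real.rpow_le_rpow_of_exponent_le hb1 ?_
      nlinarith
    have hosc' : ∀ l, n ≤ l → pNorm Pr p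
        (fun ω => cellOsc b l (fun t => I.indicator (fun t => f t ω) t)) ≤
        v * (c * M * ENNReal.ofReal ((b : ℝ) ^ (((n : ℝ) - l) * α))) := fun l hl =>
      pNorm_cellOsc_indicator_le hb hp l hf (hIl l hl) (hosc l hl)
    have t1 := hosc' k hnk
    have t2 : ∀ l ∈ Finset.Ico n k, pNorm Pr p (fun ω =>
        ENNReal.ofReal (Real.sqrt d * (b : ℝ) ^ (l + 1) / (b : ℝ) ^ k) *
          cellOsc b l (fun t => I.indicator (fun t => f t ω) t)) ≤
        v * c * M * ENNReal.ofReal (Real.sqrt d * b * E) := by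
      intro l hl
      obtain ⟨hnl, hlk⟩ := Finset.mem_Ico.1 hl
      rw [pNorm_const_mul hp _ (hmo l).aemeasurable]
      calc _ ≤ ENNReal.ofReal (Real.sqrt d * (b : ℝ) ^ (l + 1) / (b : ℝ) ^ k) *
            (v * (c * M * ENNReal.ofReal ((b : ℝ) ^ (((n : ℝ) - l) * α)))) := by
            gcongr; exact hosc' l hnl
        _ = v * c * M * (ENNReal.ofReal (Real.sqrt d * (b : ℝ) ^ (l + 1) / (b : ℝ) ^ k) *
            ENNReal.ofReal ((b : ℝ) ^ (((n : ℝ) - l) * α))) := by ring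
        _ ≤ _ := by
            gcongr
            rw [← ENNReal.ofReal_mul (by positivity)]
            refine ENNReal.ofReal_le_ofReal ?_
            calc _ = Real.sqrt d * b * ((b : ℝ) ^ l / (b : ℝ) ^ k *
                  (b : ℝ) ^ (((n : ℝ) - l) * α)) := by rw [pow_succ]; ring
              _ ≤ _ := by
                  gcongr
                  exact hkey l hlk.le
    have t3 : ENNReal.ofReal (Real.sqrt d * (b : ℝ) ^ n / (b : ℝ) ^ k) * (v * c) ≤
        v * c * ENNReal.ofReal (Real.sqrt d * b * E) := by
      rw [mul_comm]
      gcongr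
      rw [mul_div_assoc]
      have := hkey n hnk
      rw [sub_self, zero_mul, Real.rpow_zero, mul_one] at this
      calc Real.sqrt d * ((b : ℝ) ^ n / (b : ℝ) ^ k) ≤ Real.sqrt d * E := by gcongr
        _ ≤ Real.sqrt d * (b * E) := by
            gcongr
            nlinarith
        _ = _ := by ring
    have hms : Measurable fun ω => ∑ l ∈ Finset.Ico n k,
        ENNReal.ofReal (Real.sqrt d * (b : ℝ) ^ (l + 1) / (b : ℝ) ^ k) *
          cellOsc b l (fun t => I.indicator (fun t => f t ω) t) :=
      Finset.measurable_fun_sum _ fun l _ => (hmo l).const_mul _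
    calc _ ≤ v * (c * M * ENNReal.ofReal E) +
          ∑ l ∈ Finset.Ico n k, v * c * M * ENNReal.ofReal (Real.sqrt d * b * E) +
          v * c * ENNReal.ofReal (Real.sqrt d * b * E) := by
          refine (pNorm_add_le hp ((hmo k).add hms).aemeasurable
            (hmi.const_mul _).aemeasurable).trans (add_le_add ?_ ?_)
          · refine (pNorm_add_le hp (hmo k).aemeasurable hms.aemeasurable).trans
              (add_le_add t1 ?_)
            refine (pNorm_sum_le hp _ fun l _ => ((hmo l).const_mul _).aemeasurable).trans
              (Finset.sum_le_sum t2)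
          · rw [pNorm_const_mul hp _ hmi.aemeasurable]
            exact (by gcongr : _ ≤ _ * (v * c)).trans t3
      _ ≤ v * c * (M + 1) * ENNReal.ofReal E +
          k * (v * c * (M + 1) * ENNReal.ofReal (Real.sqrt d * b * E)) +
          v * c * (M + 1) * ENNReal.ofReal (Real.sqrt d * b * E) := by
          rw [Finset.sum_const, nsmul_eq_mul, Nat.card_Ico]
          refine add_le_add (add_le_add ?_ ?_) ?_
          · calc v * (c * M * ENNReal.ofReal E) = v * c * M * ENNReal.ofReal E := by ring
              _ ≤ _ := by gcongr; exact le_self_add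
          · gcongr
            · exact Nat.sub_le _ _
            · exact le_self_add
          · calc _ = v * c * 1 * ENNReal.ofReal (Real.sqrt d * b * E) := by rw [mul_one]
              _ ≤ _ := by gcongr; exact le_add_self
      _ = v * c * (M + 1) * (ENNReal.ofReal E + k * ENNReal.ofReal (Real.sqrt d * b * E)
            + ENNReal.ofReal (Real.sqrt d * b * E)) := by ring
      _ ≤ v * c * (M + 1) * (ENNReal.ofReal ((Real.sqrt d * b + 1) * (k + 1)) *
            ENNReal.ofReal E) := by
          gcongr
          rw [← ENNReal.ofReal_natCast k, ← ENNReal.ofReal_mul (by positivity),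
            ← ENNReal.ofReal_add (by positivity) (by positivity),
            ← ENNReal.ofReal_add (by positivity) (by positivity),
            ← ENNReal.ofReal_mul (by positivity)]
          refine ENNReal.ofReal_le_ofReal ?_
          have : 0 ≤ (k : ℝ) * E := by positivity
          nlinarith
      _ = _ := by ring
  · have hnkR : (k : ℝ) ≤ n := by exact_mod_cast (not_le.1 hnk).le
    have hmin : min 1 ((b : ℝ) ^ (((n : ℝ) - k) * α)) = 1 := by
      refine min_eq_left (Real.one_le_rpow hb1 ?_)
      exact mul_nonneg (by linarith) hα.le
    rw [hmin, ENNReal.ofReal_one, mul_one]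
    refine hint.trans ?_
    calc cubeVolume d I * c = cubeVolume d I * c * 1 * 1 := by ring
      _ ≤ _ := by
        gcongr
        · exact le_add_self
        · rw [← ENNReal.ofReal_one]
          refine ENNReal.ofReal_le_ofReal ?_
          have : 0 ≤ Real.sqrt d * b := by positivity
          have : (0 : ℝ) ≤ k := by positivity
          nlinarith

end FrequencyBound

/-! ### Moments and mean Hölder regularity of the densities and increments -/

section Moments

variable {d b : ℕ} {Ω : Type*} {P : ℕ → cube d → Ω → ℝ}

/-- The product of the first `n` processes. -/
def density (P : ℕ → cube d → Ω → ℝ) (n : ℕ) (t : cube d) (ω : Ω) : ℝ :=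
  ∏ j ∈ Finset.range n, P j t ω

/-- The difference of two successive products. -/
def increment (P : ℕ → cube d → Ω → ℝ) (n : ℕ) (t : cube d) (ω : Ω) : ℝ :=
  density P n t ω * (P n t ω - 1)

theorem density_succ (n : ℕ) (t : cube d) (ω : Ω) :
    density P (n + 1) t ω = density P n t ω * P n t ω := Finset.prod_range_succ _ _

theorem increment_eq_sub (n : ℕ) (t : cube d) (ω : Ω) :
    increment P n t ω = density P (n + 1) t ω - density P n t ω := by
  rw [increment, density_succ]; ring

theorem density_eq_prod_attach (n : ℕ) (t : cube d) (ω : Ω) :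
    density P n t ω = ∏ j : Finset.range n, P j t ω :=
  (Finset.prod_coe_sort (Finset.range n) fun j => P j t ω).symm

variable [MeasurableSpace Ω] {Pr : Measure Ω}

/-- The product of the suprema of the `L^p` norms of the first `n` processes. -/
noncomputable def normProd (Pr : Measure Ω) (P : ℕ → cube d → Ω → ℝ) (p : ℝ) (n : ℕ) : ℝ≥0∞ :=
  ∏ j ∈ Finset.range n, supMoment Pr P p j ^ (1 / p)

theorem normProd_succ (p : ℝ) (n : ℕ) :
    normProd Pr P p (n + 1) = normProd Pr P p n * supMoment Pr P p n ^ (1 / p) :=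
  Finset.prod_range_succ _ _

namespace IsChaosSequence

theorem measurable_density (hP : IsChaosSequence Pr P) (n : ℕ) :
    Measurable fun z : cube d × Ω => density P n z.1 z.2 := by
  unfold density
  exact Finset.measurable_fun_prod _ fun j _ => hP.measurable j

theorem measurable_increment (hP : IsChaosSequence Pr P) (n : ℕ) :
    Measurable fun z : cube d × Ω => increment P n z.1 z.2 :=
  (hP.measurable_density n).mul ((hP.measurable n).sub_const 1)

theorem measurable_apply (hP : IsChaosSequence Pr P) (j : ℕ) (t : cube d) : Measurable (P j t) :=
  (hP.measurable j).comp measurable_prodMk_left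

theorem measurable_density_apply (hP : IsChaosSequence Pr P) (n : ℕ) (t : cube d) :
    Measurable (density P n t) := (hP.measurable_density n).comp measurable_prodMk_left

theorem measurable_path (hP : IsChaosSequence Pr P) (j : ℕ) : Measurable fun ω t => P j t ω :=
  measurable_pi_lambda _ fun t => hP.measurable_apply j t

theorem density_nonneg (hP : IsChaosSequence Pr P) (n : ℕ) (t : cube d) (ω : Ω) :
    0 ≤ density P n t ω := Finset.prod_nonneg fun j _ => hP.nonneg j t ω

theorem indepFun_past (hP : IsChaosSequence Pr P) (n : ℕ) :
    IndepFun (fun ω (j : Finset.range n) t => P j t ω) (fun ω t => P n t ω) Pr := by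
  have h := hP.indep.indepFun_finset (Finset.range n) {n} (by simp) hP.measurable_path
  exact h.comp (φ := id)
    (ψ := fun f : ({n} : Finset ℕ) → cube d → ℝ => f ⟨n, Finset.mem_singleton_self n⟩)
    measurable_id (measurable_pi_apply _)

theorem enorm_eq_ofReal (hP : IsChaosSequence Pr P) (j : ℕ) (t : cube d) (ω : Ω) :
    ‖P j t ω‖ₑ = ENNReal.ofReal (P j t ω) := Real.enorm_of_nonneg (hP.nonneg j t ω)

theorem lintegral_enorm (hP : IsChaosSequence Pr P) (j : ℕ) (t : cube d) :
    ∫⁻ ω, ‖P j t ω‖ₑ ∂Pr = 1 := by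
  have hi : Integrable (P j t) Pr := by
    by_contra h
    have := hP.mean_one j t
    rw [integral_undef h] at this
    exact zero_ne_one this
  simp only [hP.enorm_eq_ofReal]
  rw [← ofReal_integral_eq_lintegral_ofReal hi (Eventually.of_forall fun ω => hP.nonneg j t ω),
    hP.mean_one, ENNReal.ofReal_one]

theorem pNorm_le (hP : IsChaosSequence Pr P) {p : ℝ} (hp : 1 ≤ p) (j : ℕ) {t : cube d}
    (ht : t ∈ halfOpenCube d) :
    pNorm Pr p (fun ω => ‖P j t ω‖ₑ) ≤ supMoment Pr P p j ^ (1 / p) := by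
  unfold pNorm
  refine ENNReal.rpow_le_rpow ?_ (by positivity)
  simp only [hP.enorm_eq_ofReal]
  exact le_iSup₂ (f := fun t (_ : t ∈ halfOpenCube d) =>
    ∫⁻ ω, ENNReal.ofReal (P j t ω) ^ p ∂Pr) t ht

theorem exists_mem_halfOpenCube (d : ℕ) : ∃ t : cube d, t ∈ halfOpenCube d :=
  ⟨⟨0, fun i => by simp⟩, fun i => by simp⟩

/-- Factorization of moments of functions of the first `n` processes and of the next one. -/
theorem pNorm_mul (hP : IsChaosSequence Pr P) {p : ℝ} (hp : 1 ≤ p) (n : ℕ)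
    {Φ : (Finset.range n → cube d → ℝ) → ℝ} {Ψ : (cube d → ℝ) → ℝ} (hΦ : Measurable Φ)
    (hΨ : Measurable Ψ) :
    pNorm Pr p (fun ω => ‖Φ (fun j t => P j t ω) * Ψ (fun t => P n t ω)‖ₑ) =
      pNorm Pr p (fun ω => ‖Φ (fun j t => P j t ω)‖ₑ) *
        pNorm Pr p (fun ω => ‖Ψ (fun t => P n t ω)‖ₑ) := by
  simp only [enorm_mul]
  have hX : Measurable fun ω => fun (j : Finset.range n) t => P j t ω :=
    measurable_pi_lambda _ fun j => hP.measurable_path j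
  refine pNorm_mul_of_indepFun hp (hΦ.comp hX).enorm (hΨ.comp (hP.measurable_path n)).enorm ?_
  exact (hP.indepFun_past n).comp hΦ.enorm hΨ.enorm

theorem measurable_prod_eval (n : ℕ) (t : cube d) :
    Measurable fun f : Finset.range n → cube d → ℝ => ∏ j, f j t :=
  Finset.measurable_fun_prod _ fun j _ => (measurable_pi_apply t).comp (measurable_pi_apply j)

theorem pNorm_density_mul (hP : IsChaosSequence Pr P) {p : ℝ} (hp : 1 ≤ p) (n : ℕ) (t : cube d)
    {Ψ : (cube d → ℝ) → ℝ} (hΨ : Measurable Ψ) :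
    pNorm Pr p (fun ω => ‖density P n t ω * Ψ (fun t => P n t ω)‖ₑ) =
      pNorm Pr p (fun ω => ‖density P n t ω‖ₑ) * pNorm Pr p (fun ω => ‖Ψ (fun t => P n t ω)‖ₑ) := by
  simp only [density_eq_prod_attach]
  exact hP.pNorm_mul hp n (measurable_prod_eval n t) hΨ

variable [IsProbabilityMeasure Pr]

/-- Each `P j t` has mean one, and `L^p` norms on a probability space dominate the `L¹` norm. Hence
`normProd` is nondecreasing in the generation. -/
theorem one_le_supMoment_rpow (hP : IsChaosSequence Pr P) {p : ℝ} (hp : 1 ≤ p) (j : ℕ) :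
    1 ≤ supMoment Pr P p j ^ (1 / p) := by
  obtain ⟨t, ht⟩ := exists_mem_halfOpenCube d
  rw [← hP.lintegral_enorm j t]
  exact (lintegral_le_pNorm hp (hP.measurable_apply j t).enorm).trans (hP.pNorm_le hp j ht)

theorem one_le_supMoment (hP : IsChaosSequence Pr P) {p : ℝ} (hp : 1 ≤ p) (j : ℕ) :
    1 ≤ supMoment Pr P p j := by
  have := ENNReal.rpow_le_rpow (hP.one_le_supMoment_rpow hp j) (by linarith : 0 ≤ p)
  rwa [ENNReal.one_rpow, ← ENNReal.rpow_mul, one_div_mul_cancel (by linarith),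
    ENNReal.rpow_one] at this

theorem normProd_le_succ (hP : IsChaosSequence Pr P) {p : ℝ} (hp : 1 ≤ p) (n : ℕ) :
    normProd Pr P p n ≤ normProd Pr P p (n + 1) := by
  rw [normProd_succ]
  exact le_mul_of_one_le_right' (hP.one_le_supMoment_rpow hp n)

theorem supMoment_rpow_le (hP : IsChaosSequence Pr P) {p q : ℝ} (hp : 1 ≤ p) (hpq : p ≤ q) (j : ℕ) :
    supMoment Pr P p j ^ (1 / p) ≤ supMoment Pr P q j ^ (1 / q) := by
  have hp0 : 0 < p := by linarith
  have h1 : supMoment Pr P p j ≤ (supMoment Pr P q j ^ (1 / q)) ^ p := by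
    refine iSup₂_le fun t ht => ?_
    have h2 := ENNReal.rpow_le_rpow ((pNorm_le_pNorm (Pr := Pr) hp hpq
      (hP.measurable_apply j t).enorm).trans (hP.pNorm_le (hp.trans hpq) j ht)) hp0.le
    rw [pNorm, ← ENNReal.rpow_mul, one_div_mul_cancel hp0.ne', ENNReal.rpow_one] at h2
    simpa only [hP.enorm_eq_ofReal] using h2
  have := ENNReal.rpow_le_rpow h1 (by positivity : 0 ≤ 1 / p)
  rwa [← ENNReal.rpow_mul, mul_one_div, div_self hp0.ne', ENNReal.rpow_one] at this

theorem pNorm_density_le (hP : IsChaosSequence Pr P) {p : ℝ} (hp : 1 ≤ p) (n : ℕ) {t : cube d}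
    (ht : t ∈ halfOpenCube d) :
    pNorm Pr p (fun ω => ‖density P n t ω‖ₑ) ≤ normProd Pr P p n := by
  induction n with
  | zero => simp [density, normProd, pNorm]
  | succ n ih =>
    simp only [density_succ]
    rw [hP.pNorm_density_mul hp n t (Ψ := fun f => f t) (measurable_pi_apply t), normProd_succ]
    exact mul_le_mul' ih (hP.pNorm_le hp n ht)

theorem lintegral_enorm_density (hP : IsChaosSequence Pr P) (n : ℕ) (t : cube d) :
    ∫⁻ ω, ‖density P n t ω‖ₑ ∂Pr = 1 := by
  have h1 : ∀ F : Ω → ℝ≥0∞, pNorm Pr 1 F = ∫⁻ ω, F ω ∂Pr := fun F => by simp [pNorm]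
  rw [← h1]
  induction n with
  | zero => simp [density, pNorm]
  | succ n ih =>
    simp only [density_succ]
    rw [hP.pNorm_density_mul le_rfl n t (Ψ := fun f => f t) (measurable_pi_apply t), ih, h1,
      hP.lintegral_enorm, one_mul]

/-- Points of a cell of generation `l` are at distance at most `√d b ^ (-l)`, which is `√d b ^ (j -
l)` on the scale of generation `j`. Monotonicity of `L^p` norms passes from `p₀` to `p`. -/
theorem exists_pNorm_sub_le (hP : IsChaosSequence Pr P) (hb : 2 ≤ b) {p p₀ α₀ : ℝ} (hp : 1 ≤ p)
    (hpp₀ : p ≤ p₀) (hα₀ : 0 < α₀) (hholder : UniformHolder Pr b P p₀ α₀) :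
    ∃ C : ℝ≥0∞, C ≠ ∞ ∧ ∀ (j l : ℕ), j ≤ l → ∀ (h : Fin d → Fin (b ^ l)),
      ∀ t ∈ adicCube d b l h, ∀ s ∈ adicCube d b l h,
      pNorm Pr p (fun ω => ‖P j t ω - P j s ω‖ₑ) ≤
        C * ENNReal.ofReal ((b : ℝ) ^ (((j : ℝ) - l) * α₀)) := by
  have hp₀ : 0 < p₀ := by linarith
  have hbR : (0 : ℝ) < b := by positivity
  set H : ℝ≥0∞ := ⨆ (j : ℕ) (h : Fin d → Fin (b ^ j)) (t ∈ adicCube d b j h)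
    (s ∈ adicCube d b j h) (_ : t ≠ s), ∫⁻ ω, ENNReal.ofReal
      (|(P j t ω - P j s ω) / ((b : ℝ) ^ ((j : ℝ) * α₀) * dist t s ^ α₀)| ^ p₀) ∂Pr with hH
  refine ⟨H ^ (1 / p₀) * ENNReal.ofReal (Real.sqrt d ^ α₀), ENNReal.mul_ne_top
    (ENNReal.rpow_ne_top_of_nonneg (by positivity) hholder.ne) ENNReal.ofReal_ne_top, ?_⟩
  intro j l hjl h t ht s hs
  rcases eq_or_ne t s with rfl | hts
  · have : pNorm Pr p (fun ω => ‖P j t ω - P j t ω‖ₑ) = 0 := by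
      simpa using pNorm_zero (Pr := Pr) hp
    rw [this]; exact zero_le
  obtain ⟨h', hh'⟩ := exists_adicCube_subset hb hjl h
  set D : ℝ := (b : ℝ) ^ ((j : ℝ) * α₀) * dist t s ^ α₀ with hD
  have hdist : 0 < dist t s := dist_pos.2 hts
  have hDpos : 0 < D := by positivity
  have h1 : ∫⁻ ω, ENNReal.ofReal (|(P j t ω - P j s ω) / D| ^ p₀) ∂Pr ≤ H := by
    rw [hH]
    refine le_iSup_of_le j (le_iSup_of_le h' (le_iSup_of_le t (le_iSup_of_le (hh' ht)
      (le_iSup_of_le s (le_iSup_of_le (hh' hs) (le_iSup_of_le hts le_rfl))))))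
  have hm : Measurable fun ω => P j t ω - P j s ω :=
    (hP.measurable_apply j t).sub (hP.measurable_apply j s)
  have h2 : ∀ ω, ‖P j t ω - P j s ω‖ₑ
      = ENNReal.ofReal D * ENNReal.ofReal |(P j t ω - P j s ω) / D| := fun ω => by
    rw [← ENNReal.ofReal_mul hDpos.le, abs_div, abs_of_pos hDpos, mul_div_cancel₀ _ hDpos.ne',
      ← Real.norm_eq_abs, ofReal_norm]
  refine (pNorm_le_pNorm hp hpp₀ hm.enorm).trans ?_
  have hma : Measurable fun ω => ENNReal.ofReal |(P j t ω - P j s ω) / D| :=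
    (hm.div_const D).norm.ennreal_ofReal
  simp only [h2]
  rw [pNorm_const_mul (by linarith) _ hma.aemeasurable]
  have h3 : pNorm Pr p₀ (fun ω => ENNReal.ofReal |(P j t ω - P j s ω) / D|) ≤ H ^ (1 / p₀) := by
    unfold pNorm
    refine ENNReal.rpow_le_rpow ?_ (by positivity)
    simp only [ENNReal.ofReal_rpow_of_nonneg (abs_nonneg _) hp₀.le]
    exact h1
  have h4 : D ≤ Real.sqrt d ^ α₀ * (b : ℝ) ^ (((j : ℝ) - l) * α₀) := by
    have h5 := dist_le_of_mem_adicCube hb ht hs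
    calc D ≤ (b : ℝ) ^ ((j : ℝ) * α₀) * (Real.sqrt d * ((b : ℝ) ^ l)⁻¹) ^ α₀ := by
          rw [hD]; gcongr
      _ = _ := by
          rw [Real.mul_rpow (by positivity) (by positivity), Real.inv_rpow (by positivity),
            ← Real.rpow_natCast, ← Real.rpow_mul hbR.le, ← Real.rpow_neg hbR.le, mul_left_comm,
            ← Real.rpow_add hbR]
          congr 2; ring
  calc _ ≤ ENNReal.ofReal (Real.sqrt d ^ α₀ * (b : ℝ) ^ (((j : ℝ) - l) * α₀)) * H ^ (1 / p₀) :=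
        mul_le_mul' (ENNReal.ofReal_le_ofReal h4) h3
    _ = _ := by rw [ENNReal.ofReal_mul (by positivity)]; ring

/-- The Hölder bound in the mean for the density. -/
theorem pNorm_density_sub_le (hP : IsChaosSequence Pr P) (hb : 2 ≤ b) {p α₀ : ℝ} (hp : 1 ≤ p)
    (hα₀ : 0 < α₀) {C : ℝ≥0∞}
    (hC : ∀ (j l : ℕ), j ≤ l → ∀ (h : Fin d → Fin (b ^ l)),
      ∀ t ∈ adicCube d b l h, ∀ s ∈ adicCube d b l h,
      pNorm Pr p (fun ω => ‖P j t ω - P j s ω‖ₑ) ≤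
        C * ENNReal.ofReal ((b : ℝ) ^ (((j : ℝ) - l) * α₀)))
    {n l : ℕ} (hnl : n ≤ l) {h : Fin d → Fin (b ^ l)} {t s : cube d}
    (ht : t ∈ adicCube d b l h) (hs : s ∈ adicCube d b l h) :
    pNorm Pr p (fun ω => ‖density P n t ω - density P n s ω‖ₑ) ≤
      normProd Pr P p n * (n * C) * ENNReal.ofReal ((b : ℝ) ^ (((n : ℝ) - l) * α₀)) := by
  induction n with
  | zero =>
    have : pNorm Pr p (fun ω => ‖density P 0 t ω - density P 0 s ω‖ₑ) = 0 := by
      simpa [density] using pNorm_zero (Pr := Pr) hp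
    rw [this]; exact zero_le
  | succ n ih =>
    have ih := ih (by omega)
    have htH := adicCube_subset_halfOpenCube hb h ht
    have hsH := adicCube_subset_halfOpenCube hb h hs
    have hb1 : (1 : ℝ) ≤ b := by exact_mod_cast (by omega : 1 ≤ b)
    have hmD := fun t => hP.measurable_density_apply n t
    have hmP := fun t => hP.measurable_apply n t
    -- Leibniz rule: each term is a function of the past times a function of `P n`, so its `L^p`
    -- norm factorises. The latest generation has the slowest rate, and each factor adds one error
    -- term, whence the factor `n` in the bound.
    have e : ∀ ω, density P (n + 1) t ω - density P (n + 1) s ω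
        = (density P n t ω - density P n s ω) * P n t ω
          + density P n s ω * (P n t ω - P n s ω) := fun ω => by
      rw [density_succ, density_succ]; ring
    simp only [e]
    have hE : ENNReal.ofReal ((b : ℝ) ^ (((n : ℝ) - l) * α₀)) ≤
        ENNReal.ofReal ((b : ℝ) ^ ((((n + 1 : ℕ) : ℝ) - l) * α₀)) := by
      refine ENNReal.ofReal_le_ofReal (Real.rpow_le_rpow_of_exponent_le hb1 ?_)
      push_cast
      nlinarith
    set E := ENNReal.ofReal ((b : ℝ) ^ (((n : ℝ) - l) * α₀))
    set E' := ENNReal.ofReal ((b : ℝ) ^ ((((n + 1 : ℕ) : ℝ) - l) * α₀))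
    have i1 : pNorm Pr p (fun ω => ‖(density P n t ω - density P n s ω) * P n t ω‖ₑ) =
        pNorm Pr p (fun ω => ‖density P n t ω - density P n s ω‖ₑ) *
          pNorm Pr p (fun ω => ‖P n t ω‖ₑ) := by
      simp only [density_eq_prod_attach]
      exact hP.pNorm_mul hp n
        (Φ := fun f => ∏ j, f j t - ∏ j, f j s) (Ψ := fun f => f t)
        ((measurable_prod_eval n t).sub (measurable_prod_eval n s)) (measurable_pi_apply t)
    have i2 := hP.pNorm_density_mul hp n s (Ψ := fun f => f t - f s)
      ((measurable_pi_apply t).sub (measurable_pi_apply s))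
    calc _ ≤ pNorm Pr p (fun ω => ‖(density P n t ω - density P n s ω) * P n t ω‖ₑ
            + ‖density P n s ω * (P n t ω - P n s ω)‖ₑ) :=
          pNorm_mono hp (Eventually.of_forall fun ω => enorm_add_le _ _)
      _ ≤ normProd Pr P p n * (n * C) * E * supMoment Pr P p n ^ (1 / p)
          + normProd Pr P p n * (C * E) := by
          refine (pNorm_add_le hp
            ((((hmD t).sub (hmD s)).mul (hmP t)).enorm).aemeasurable
            (((hmD s).mul ((hmP t).sub (hmP s))).enorm).aemeasurable).trans ?_
          refine le_trans (add_le_add i1.le i2.le) ?_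
          exact add_le_add (mul_le_mul' ih (hP.pNorm_le hp n htH))
            (mul_le_mul' (hP.pNorm_density_le hp n hsH) (hC n l (by omega) h t ht s hs))
      _ ≤ normProd Pr P p (n + 1) * (n * C) * E' + normProd Pr P p (n + 1) * (C * E') := by
          refine add_le_add ?_ ?_
          · rw [normProd_succ]
            calc _ = normProd Pr P p n * supMoment Pr P p n ^ (1 / p) * (n * C) * E := by ring
              _ ≤ _ := by gcongr
          · gcongr
            exact hP.normProd_le_succ hp n
      _ = _ := by push_cast; ring

theorem pNorm_increment_le (hP : IsChaosSequence Pr P) {p : ℝ} (hp : 1 ≤ p) (n : ℕ) {t : cube d}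
    (ht : t ∈ halfOpenCube d) :
    pNorm Pr p (fun ω => ‖increment P n t ω‖ₑ) ≤ 2 * normProd Pr P p (n + 1) := by
  simp only [increment_eq_sub]
  calc _ ≤ pNorm Pr p (fun ω => ‖density P (n + 1) t ω‖ₑ + ‖density P n t ω‖ₑ) :=
        pNorm_mono hp (Eventually.of_forall fun ω => enorm_sub_le)
    _ ≤ normProd Pr P p (n + 1) + normProd Pr P p (n + 1) := by
        refine (pNorm_add_le hp (hP.measurable_density_apply _ t).enorm.aemeasurable
          (hP.measurable_density_apply _ t).enorm.aemeasurable).trans ?_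
        exact add_le_add (hP.pNorm_density_le hp _ ht)
          ((hP.pNorm_density_le hp _ ht).trans (hP.normProd_le_succ hp n))
    _ = _ := by ring

theorem pNorm_increment_sub_le (hP : IsChaosSequence Pr P) (hb : 2 ≤ b) {p α₀ : ℝ} (hp : 1 ≤ p)
    (hα₀ : 0 < α₀) {C : ℝ≥0∞}
    (hC : ∀ (j l : ℕ), j ≤ l → ∀ (h : Fin d → Fin (b ^ l)),
      ∀ t ∈ adicCube d b l h, ∀ s ∈ adicCube d b l h,
      pNorm Pr p (fun ω => ‖P j t ω - P j s ω‖ₑ) ≤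
        C * ENNReal.ofReal ((b : ℝ) ^ (((j : ℝ) - l) * α₀)))
    {n l : ℕ} (hnl : n + 1 ≤ l) {h : Fin d → Fin (b ^ l)} {t s : cube d}
    (ht : t ∈ adicCube d b l h) (hs : s ∈ adicCube d b l h) :
    pNorm Pr p (fun ω => ‖increment P n t ω - increment P n s ω‖ₑ) ≤
      2 * normProd Pr P p (n + 1) * ((n + 1 : ℕ) * C) *
        ENNReal.ofReal ((b : ℝ) ^ ((((n + 1 : ℕ) : ℝ) - l) * α₀)) := by
  have hb1 : (1 : ℝ) ≤ b := by exact_mod_cast (by omega : 1 ≤ b)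
  have hmD := fun n t => hP.measurable_density_apply n t
  have e : ∀ ω, increment P n t ω - increment P n s ω
      = (density P (n + 1) t ω - density P (n + 1) s ω) - (density P n t ω - density P n s ω) :=
    fun ω => by rw [increment_eq_sub, increment_eq_sub]; ring
  simp only [e]
  have hE : ENNReal.ofReal ((b : ℝ) ^ (((n : ℝ) - l) * α₀)) ≤
      ENNReal.ofReal ((b : ℝ) ^ ((((n + 1 : ℕ) : ℝ) - l) * α₀)) := by
    refine ENNReal.ofReal_le_ofReal (Real.rpow_le_rpow_of_exponent_le hb1 ?_)
    push_cast
    nlinarith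
  calc _ ≤ pNorm Pr p (fun ω => ‖density P (n + 1) t ω - density P (n + 1) s ω‖ₑ
          + ‖density P n t ω - density P n s ω‖ₑ) :=
        pNorm_mono hp (Eventually.of_forall fun ω => enorm_sub_le)
    _ ≤ normProd Pr P p (n + 1) * ((n + 1 : ℕ) * C) *
          ENNReal.ofReal ((b : ℝ) ^ ((((n + 1 : ℕ) : ℝ) - l) * α₀))
        + normProd Pr P p n * (n * C) * ENNReal.ofReal ((b : ℝ) ^ (((n : ℝ) - l) * α₀)) := by
        refine (pNorm_add_le hp ((hmD _ t).sub (hmD _ s)).enorm.aemeasurable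
          ((hmD _ t).sub (hmD _ s)).enorm.aemeasurable).trans ?_
        exact add_le_add (hP.pNorm_density_sub_le hb hp hα₀ hC hnl ht hs)
          (hP.pNorm_density_sub_le hb hp hα₀ hC (by omega) ht hs)
    _ ≤ normProd Pr P p (n + 1) * ((n + 1 : ℕ) * C) *
          ENNReal.ofReal ((b : ℝ) ^ ((((n + 1 : ℕ) : ℝ) - l) * α₀))
        + normProd Pr P p (n + 1) * ((n + 1 : ℕ) * C) *
          ENNReal.ofReal ((b : ℝ) ^ ((((n + 1 : ℕ) : ℝ) - l) * α₀)) := by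
        gcongr
        · exact hP.normProd_le_succ hp n
        · omega
    _ = _ := by ring

end IsChaosSequence

end Moments

/-! ### The type `p` inequality as an `L^p` estimate -/

section TypePNorm

/-- Bounding all coordinates of a summand by one variable `A i` costs `|G|^{1/(2K)}` in the `ℓ^{2K}`
norm; type `p` then replaces the number of summands by its `p`-th root. -/
theorem pNorm_powSum_sum_le {G : Type} [Fintype G] {Ω : Type*} [mΩ : MeasurableSpace Ω]
    {Pr : Measure Ω} [IsProbabilityMeasure Pr] {K : ℕ} (hK : 2 ≤ K) {p C : ℝ} (hp : 1 ≤ p)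
    (hC : 0 ≤ C)
    (hsmooth : ∀ s x : G → ℝ, powSum K (s + x) ^ (p / (2 * K : ℕ)) ≤
      powSum K s ^ (p / (2 * K : ℕ)) + ∑ g, powSumGrad K p s g * x g
        + C * powSum K x ^ (p / (2 * K : ℕ)))
    {ι : Type*} (T : Finset ι) (Y : ι → Ω → G → ℝ) (𝒢 : ι → MeasurableSpace Ω)
    (h𝒢 : ∀ i, 𝒢 i ≤ mΩ)
    (hY : ∀ i ∈ T, ∀ g, AEStronglyMeasurable (fun ω => Y i ω g) Pr)
    (hadapt : ∀ i ∈ T, ∀ j ∈ T, j ≠ i → ∀ g, AEStronglyMeasurable[𝒢 i] (fun ω => Y j ω g) Pr)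
    (hzero : ∀ i ∈ T, ∀ g, Pr[fun ω => Y i ω g | 𝒢 i] =ᵐ[Pr] 0)
    (A : ι → Ω → ℝ≥0∞) {c : ℝ≥0∞} (hc : c ≠ ∞) (hA : ∀ i ∈ T, Measurable (A i))
    (hYA : ∀ i ∈ T, ∀ᵐ ω ∂Pr, ∀ g, ‖Y i ω g‖ₑ ≤ A i ω) (hAc : ∀ i ∈ T, pNorm Pr p (A i) ≤ c) :
    pNorm Pr p (fun ω => ENNReal.ofReal (powSum K (∑ i ∈ T, Y i ω) ^ (1 / (2 * K : ℕ) : ℝ))) ≤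
      ENNReal.ofReal C ^ (1 / p) * (Fintype.card G : ℝ≥0∞) ^ (1 / (2 * K : ℕ) : ℝ) *
        (T.card : ℝ≥0∞) ^ (1 / p) * c := by
  have h0 : 0 < p := by linarith
  have hq : (0 : ℝ) < (2 * K : ℕ) := by exact_mod_cast (by omega : 0 < 2 * K)
  set r : ℝ := p / (2 * K : ℕ) with hr
  have hr0 : 0 < r := by positivity
  set B : ℝ≥0∞ := (Fintype.card G : ℝ≥0∞) ^ r * c ^ p with hB
  have hBtop : B ≠ ∞ := ENNReal.mul_ne_top
    (ENNReal.rpow_ne_top_of_nonneg hr0.le (ENNReal.natCast_ne_top _))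
    (ENNReal.rpow_ne_top_of_nonneg h0.le hc)
  have hlin : ∀ i ∈ T, ∫⁻ ω, ENNReal.ofReal (powSum K (Y i ω) ^ r) ∂Pr ≤ B := by
    intro i hi
    have h1 : ∀ᵐ ω ∂Pr, ENNReal.ofReal (powSum K (Y i ω) ^ r) ≤
        (Fintype.card G : ℝ≥0∞) ^ r * A i ω ^ p := by
      filter_upwards [hYA i hi] with ω hω
      rw [← ENNReal.ofReal_rpow_of_nonneg (powSum_nonneg K _) hr0.le]
      have h2 : ENNReal.ofReal (powSum K (Y i ω)) ≤ Fintype.card G * A i ω ^ (2 * K) := by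
        rw [powSum, ENNReal.ofReal_sum_of_nonneg
          fun g _ => (even_two_mul K).pow_nonneg (Y i ω g)]
        calc _ ≤ ∑ _g : G, A i ω ^ (2 * K) := by
              refine Finset.sum_le_sum fun g _ => ?_
              rw [← abs_pow_two_mul, ENNReal.ofReal_pow (abs_nonneg _), ← Real.norm_eq_abs,
                ofReal_norm]
              have := hω g
              gcongr
          _ = _ := by simp
      refine (ENNReal.rpow_le_rpow h2 hr0.le).trans (le_of_eq ?_)
      rw [ENNReal.mul_rpow_of_nonneg _ _ hr0.le, ← ENNReal.rpow_natCast, ← ENNReal.rpow_mul, hr,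
        mul_div_cancel₀ _ hq.ne']
    refine (lintegral_mono_ae h1).trans ?_
    rw [lintegral_const_mul _ ((hA i hi).pow_const p), hB]
    gcongr
    have := ENNReal.rpow_le_rpow (hAc i hi) h0.le
    rwa [pNorm, ← ENNReal.rpow_mul, one_div_mul_cancel h0.ne', ENNReal.rpow_one] at this
  have hmeasY : ∀ i ∈ T, AEStronglyMeasurable (fun ω => powSum K (Y i ω) ^ r) Pr := fun i hi =>
    aestronglyMeasurable_comp_pi (Φ := fun y : G → ℝ => powSum K y ^ r)
      ((measurable_powSum K).pow_const _) (hY i hi)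
  have hint : ∀ i ∈ T, Integrable (fun ω => powSum K (Y i ω) ^ r) Pr := fun i hi => by
    refine ⟨hmeasY i hi, ?_⟩
    rw [hasFiniteIntegral_iff_ofReal
      (Eventually.of_forall fun ω => Real.rpow_nonneg (powSum_nonneg K _) _)]
    exact (hlin i hi).trans_lt hBtop.lt_top
  obtain ⟨hSint, hSle⟩ := integral_powSum_sum_le hK hp hsmooth T Y 𝒢 h𝒢 hY hadapt hzero hint
  have hYB : ∀ i ∈ T, ∫ ω, powSum K (Y i ω) ^ r ∂Pr ≤ B.toReal := fun i hi => by
    rw [integral_eq_lintegral_of_nonneg_ae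
      (Eventually.of_forall fun ω => Real.rpow_nonneg (powSum_nonneg K _) _) (hmeasY i hi)]
    exact ENNReal.toReal_mono hBtop (hlin i hi)
  have hmain : ∫⁻ ω, ENNReal.ofReal (powSum K (∑ i ∈ T, Y i ω) ^ r) ∂Pr ≤
      ENNReal.ofReal C * T.card * B := by
    rw [← ofReal_integral_eq_lintegral_ofReal hSint
      (Eventually.of_forall fun ω => Real.rpow_nonneg (powSum_nonneg K _) _)]
    calc _ ≤ ENNReal.ofReal (C * (T.card * B.toReal)) := by
          refine ENNReal.ofReal_le_ofReal (hSle.trans ?_)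
          gcongr
          refine (Finset.sum_le_sum hYB).trans ?_
          rw [Finset.sum_const, nsmul_eq_mul]
      _ = _ := by
          rw [ENNReal.ofReal_mul hC, ENNReal.ofReal_mul (by positivity), ENNReal.ofReal_natCast,
            ENNReal.ofReal_toReal hBtop, mul_assoc]
  have hpow : ∀ ω, ENNReal.ofReal (powSum K (∑ i ∈ T, Y i ω) ^ (1 / (2 * K : ℕ) : ℝ)) ^ p
      = ENNReal.ofReal (powSum K (∑ i ∈ T, Y i ω) ^ r) := fun ω => by
    rw [ENNReal.ofReal_rpow_of_nonneg (Real.rpow_nonneg (powSum_nonneg K _) _) h0.le,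
      ← Real.rpow_mul (powSum_nonneg K _), hr]
    congr 2
    ring
  unfold pNorm
  simp only [hpow]
  refine (ENNReal.rpow_le_rpow hmain (by positivity)).trans (le_of_eq ?_)
  have hp' : (0 : ℝ) ≤ 1 / p := by positivity
  rw [hB, ENNReal.mul_rpow_of_nonneg _ _ hp', ENNReal.mul_rpow_of_nonneg _ _ hp',
    ENNReal.mul_rpow_of_nonneg _ _ hp', ← ENNReal.rpow_mul, ← ENNReal.rpow_mul,
    mul_one_div, mul_one_div, div_self h0.ne', ENNReal.rpow_one]
  have : r / p = 1 / (2 * K : ℕ) := by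
    rw [hr]; field_simp
  rw [this]
  ring

end TypePNorm

/-! ### Conditional centring of the cells of one colour -/

section Independence

/-- The law of `X`, `β ∘ W`, `γ ∘ W` is a product of three laws, which can be bracketed either way.
This lets an independent past be added to one of two independent parts of `W`. -/
theorem indepFun_prodMk_of_indepFun {Ω A B C D : Type*} [MeasurableSpace Ω] [MeasurableSpace A]
    [MeasurableSpace B] [MeasurableSpace C] [MeasurableSpace D] {Pr : Measure Ω}
    [IsProbabilityMeasure Pr] {X : Ω → A} {W : Ω → D} {β : D → B} {γ : D → C}
    (hX : Measurable X) (hW : Measurable W) (hβ : Measurable β) (hγ : Measurable γ)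
    (hXW : IndepFun X W Pr) (hBC : IndepFun (fun ω => β (W ω)) (fun ω => γ (W ω)) Pr) :
    IndepFun (fun ω => (X ω, β (W ω))) (fun ω => γ (W ω)) Pr := by
  have hB : Measurable fun ω => β (W ω) := hβ.comp hW
  have hC : Measurable fun ω => γ (W ω) := hγ.comp hW
  have h1 : IndepFun X (fun ω => (β (W ω), γ (W ω))) Pr :=
    hXW.comp measurable_id (hβ.prodMk hγ)
  have h2 : IndepFun X (fun ω => β (W ω)) Pr := hXW.comp measurable_id hβ
  rw [indepFun_iff_map_prod_eq_prod_map_map hX.aemeasurable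
    (hB.prodMk hC).aemeasurable] at h1
  rw [indepFun_iff_map_prod_eq_prod_map_map hX.aemeasurable hB.aemeasurable] at h2
  rw [indepFun_iff_map_prod_eq_prod_map_map hB.aemeasurable hC.aemeasurable] at hBC
  rw [indepFun_iff_map_prod_eq_prod_map_map (hX.prodMk hB).aemeasurable hC.aemeasurable, h2]
  have := Measure.isProbabilityMeasure_map hX.aemeasurable (μ := Pr)
  have := Measure.isProbabilityMeasure_map hB.aemeasurable (μ := Pr)
  have := Measure.isProbabilityMeasure_map hC.aemeasurable (μ := Pr)
  have h3 : Pr.map (fun ω => ((X ω, β (W ω)), γ (W ω)))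
      = (Pr.map (fun ω => (X ω, (β (W ω), γ (W ω))))).map MeasurableEquiv.prodAssoc.symm := by
    rw [Measure.map_map (MeasurableEquiv.measurable _) (hX.prodMk (hB.prodMk hC))]
    rfl
  rw [h3, h1, hBC, ← Measure.prodAssoc_prod, Measure.map_map (MeasurableEquiv.measurable _)
    (MeasurableEquiv.measurable _)]
  simp

theorem indepFun_finset_of_notMem {Ω κ : Type*} [MeasurableSpace Ω] {Pr : Measure Ω}
    {β : κ → Type*} [∀ k, MeasurableSpace (β k)] {X : ∀ k, Ω → β k} (h : iIndepFun X Pr)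
    (hm : ∀ k, Measurable (X k)) {S : Finset κ} {k : κ} (hk : k ∉ S) :
    IndepFun (fun ω (x : S) => X x ω) (X k) Pr :=
  (h.indepFun_finset S {k} (by simpa using hk) hm).comp (φ := id)
    (ψ := fun f : (x : ({k} : Finset κ)) → β x => f ⟨k, Finset.mem_singleton_self k⟩)
    measurable_id (measurable_pi_apply _)

variable {d b : ℕ} {Ω : Type*} [mΩ : MeasurableSpace Ω] {Pr : Measure Ω}
  {P : ℕ → cube d → Ω → ℝ}

/-- The past of the chaos up to generation `m`, together with the values of the next process on the
cells of the finite set `S`. -/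
def knowledge (b : ℕ) (P : ℕ → cube d → Ω → ℝ) (m : ℕ) (S : Finset (Fin d → Fin (b ^ m))) (ω : Ω) :
    (Finset.range (m + 1) → cube d → ℝ) × ((h : S) → adicCube d b m h.1 → ℝ) :=
  (fun j t => P j t ω, fun _ t => P (m + 1) t.1 ω)

theorem IsChaosSequence.measurable_knowledge (hP : IsChaosSequence Pr P) (m : ℕ)
    (S : Finset (Fin d → Fin (b ^ m))) : Measurable (knowledge b P m S) := by
  refine Measurable.prodMk ?_ ?_
  · exact measurable_pi_lambda _ fun j => hP.measurable_path j
  · exact measurable_pi_lambda _ fun h => measurable_pi_lambda _ fun t =>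
      hP.measurable_apply (m + 1) t.1

/-- The past is independent of the whole path of `P (m + 1)`, and the restrictions of this path to
cells of one colour are independent among themselves. -/
theorem IsChaosSequence.indepFun_knowledge [IsProbabilityMeasure Pr] (hP : IsChaosSequence Pr P)
    (m : ℕ) {ι : Type*} (c : (Fin d → Fin (b ^ m)) → ι) (i : ι)
    (hindep : iIndepFun (fun (h : {h : Fin d → Fin (b ^ m) // c h = i}) (ω : Ω)
      (t : adicCube d b m h.1) => P (m + 1) t.1 ω) Pr)
    (S : Finset (Fin d → Fin (b ^ m))) (hS : ∀ h ∈ S, c h = i)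
    {h : Fin d → Fin (b ^ m)} (hh : c h = i) (hhS : h ∉ S) :
    IndepFun (knowledge b P m S) (fun ω (t : adicCube d b m h) => P (m + 1) t.1 ω) Pr := by
  classical
  set S' : Finset {h : Fin d → Fin (b ^ m) // c h = i} := S.subtype _ with hS'
  have hmem : ∀ x : S, (⟨x.1, hS x.1 x.2⟩ : {h : Fin d → Fin (b ^ m) // c h = i}) ∈ S' :=
    fun x => by simp [hS']
  have hmeas : ∀ x : {h : Fin d → Fin (b ^ m) // c h = i}, Measurable fun (ω : Ω)
      (t : adicCube d b m x.1) => P (m + 1) t.1 ω := fun x =>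
    measurable_pi_lambda _ fun t => hP.measurable_apply (m + 1) t.1
  have h1 := indepFun_finset_of_notMem hindep hmeas (S := S') (k := ⟨h, hh⟩) (by simpa [hS'])
  have h2 : IndepFun (fun ω (x : S) (t : adicCube d b m x.1) => P (m + 1) t.1 ω)
      (fun ω (t : adicCube d b m h) => P (m + 1) t.1 ω) Pr :=
    h1.comp
      (φ := fun (f : (x : S') → adicCube d b m x.1.1 → ℝ) (x : S) =>
        f ⟨⟨x.1, hS x.1 x.2⟩, hmem x⟩) (ψ := id)
      (measurable_pi_lambda _ fun x => measurable_pi_apply _) measurable_id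
  exact indepFun_prodMk_of_indepFun
    (X := fun ω (j : Finset.range (m + 1)) t => P j t ω) (W := fun ω t => P (m + 1) t ω)
    (β := fun f (x : S) (t : adicCube d b m x.1) => f t.1)
    (γ := fun f (t : adicCube d b m h) => f t.1)
    (measurable_pi_lambda _ fun j => hP.measurable_path j) (hP.measurable_path (m + 1))
    (measurable_pi_lambda _ fun x => measurable_pi_lambda _ fun t => measurable_pi_apply _)
    (measurable_pi_lambda _ fun t => measurable_pi_apply _) (hP.indepFun_past (m + 1)) h2

/-- The contribution of the cell `h` of generation `m` to the integral of `φ` against the increment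
of generation `m + 1`. -/
noncomputable def cellIncrement (P : ℕ → cube d → Ω → ℝ) (m : ℕ) (h : Fin d → Fin (b ^ m))
    (φ : cube d → ℝ) (ω : Ω) : ℝ :=
  ∫ t, φ t * (adicCube d b m h).indicator (fun t => increment P (m + 1) t ω) t ∂(cubeVolume d)

theorem IsChaosSequence.integrable_density [IsProbabilityMeasure Pr] (hP : IsChaosSequence Pr P)
    (n : ℕ) : Integrable (fun z : cube d × Ω => density P n z.1 z.2) ((cubeVolume d).prod Pr) := by
  refine ⟨(hP.measurable_density n).aestronglyMeasurable, ?_⟩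
  rw [HasFiniteIntegral, lintegral_prod _ (hP.measurable_density n).enorm.aemeasurable]
  simp [hP.lintegral_enorm_density]

theorem IsChaosSequence.integrable_increment [IsProbabilityMeasure Pr] (hP : IsChaosSequence Pr P)
    (n : ℕ) :
    Integrable (fun z : cube d × Ω => increment P n z.1 z.2) ((cubeVolume d).prod Pr) := by
  simp only [increment_eq_sub]
  exact (hP.integrable_density (n + 1)).sub (hP.integrable_density n)

theorem IsChaosSequence.integrable_cell [IsProbabilityMeasure Pr] (hP : IsChaosSequence Pr P)
    (m : ℕ) (h : Fin d → Fin (b ^ m)) {φ : cube d → ℝ} (hφ : Measurable φ) {M : ℝ}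
    (hφM : ∀ t, |φ t| ≤ M) :
    Integrable (fun z : cube d × Ω => φ z.1 *
      (adicCube d b m h).indicator (fun t => increment P (m + 1) t z.2) z.1)
      ((cubeVolume d).prod Pr) := by
  have h1 : Integrable (fun z : cube d × Ω =>
      (adicCube d b m h).indicator (fun t => increment P (m + 1) t z.2) z.1)
      ((cubeVolume d).prod Pr) := by
    have : (fun z : cube d × Ω => (adicCube d b m h).indicator
        (fun t => increment P (m + 1) t z.2) z.1) = (Prod.fst ⁻¹' (adicCube d b m h)).indicator
          (fun z : cube d × Ω => increment P (m + 1) z.1 z.2) := rfl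
    rw [this]
    exact (hP.integrable_increment (m + 1)).indicator
      (measurable_fst (measurableSet_adicCube m h))
  exact h1.bdd_mul (c := M) (hφ.comp measurable_fst).aestronglyMeasurable
    (Eventually.of_forall fun z => hφM z.1)

/-- At a fixed time the integrand is a function of the past and of one value of `P (m + 1)` on the
cell; `aestronglyMeasurable_integral_process` transfers this to the integral. -/
theorem IsChaosSequence.aestronglyMeasurable_cellIncrement [IsProbabilityMeasure Pr]
    (hP : IsChaosSequence Pr P) (m : ℕ) (S : Finset (Fin d → Fin (b ^ m)))
    {h : Fin d → Fin (b ^ m)} (hh : h ∈ S) {φ : cube d → ℝ} (hφ : Measurable φ) {M : ℝ}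
    (hφM : ∀ t, |φ t| ≤ M) :
    AEStronglyMeasurable[MeasurableSpace.comap (knowledge b P m S) inferInstance]
      (cellIncrement P m h φ) Pr := by
  refine aestronglyMeasurable_integral_process (hP.measurable_knowledge m S).comap_le
    (hP.integrable_cell m h hφ hφM) (Eventually.of_forall fun t => ?_)
  refine Measurable.stronglyMeasurable ?_
  by_cases ht : t ∈ adicCube d b m h
  · have : (fun ω => φ t * (adicCube d b m h).indicator (fun t => increment P (m + 1) t ω) t)
        = (fun z : (Finset.range (m + 1) → cube d → ℝ) × ((h : S) → adicCube d b m h.1 → ℝ) =>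
          φ t * ((∏ j, z.1 j t) * (z.2 ⟨h, hh⟩ ⟨t, ht⟩ - 1))) ∘ knowledge b P m S := by
      funext ω
      simp only [Set.indicator_of_mem ht, increment, density_eq_prod_attach, knowledge,
        Function.comp]
    rw [this]
    refine Measurable.comp ?_ (comap_measurable _)
    refine Measurable.const_mul (Measurable.mul ?_ (Measurable.sub_const ?_ _)) _
    · exact (measurable_prod_eval (m + 1) t).comp measurable_fst
    · exact (measurable_pi_apply (⟨t, ht⟩ : adicCube d b m h)).comp
        ((measurable_pi_apply (⟨h, hh⟩ : S)).comp measurable_snd)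
  · simp only [Set.indicator_of_notMem ht, mul_zero]
    exact measurable_const

/-- At a fixed time of the cell the integrand is a function of the past times `P (m + 1) t - 1`,
which is centred and independent of the conditioning σ-algebra. -/
theorem IsChaosSequence.condExp_cellIncrement [IsProbabilityMeasure Pr]
    (hP : IsChaosSequence Pr P) (m : ℕ) (S : Finset (Fin d → Fin (b ^ m)))
    {h : Fin d → Fin (b ^ m)}
    (hindep : IndepFun (knowledge b P m S)
      (fun ω (t : adicCube d b m h) => P (m + 1) t.1 ω) Pr)
    {φ : cube d → ℝ} (hφ : Measurable φ) {M : ℝ} (hφM : ∀ t, |φ t| ≤ M) :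
    Pr[cellIncrement P m h φ | MeasurableSpace.comap (knowledge b P m S) inferInstance]
      =ᵐ[Pr] 0 := by
  refine condExp_integral_process_eq_zero (hP.measurable_knowledge m S).comap_le
    (hP.integrable_cell m h hφ hφM) (Eventually.of_forall fun t s hs => ?_)
  by_cases ht : t ∈ adicCube d b m h
  · obtain ⟨A, hA, rfl⟩ := hs
    simp only [Set.indicator_of_mem ht]
    rw [← integral_indicator (hP.measurable_knowledge m S hA)]
    -- The conditioning event is absorbed in the factor that depends on `knowledge`, so independence
    -- factorises the expectation.
    have h1 : ∀ ω, (knowledge b P m S ⁻¹' A).indicator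
        (fun ω => φ t * increment P (m + 1) t ω) ω
        = (A.indicator (fun z => φ t * ∏ j, z.1 j t) (knowledge b P m S ω)) *
          (P (m + 1) t ω - 1) := fun ω => by
      by_cases hω : knowledge b P m S ω ∈ A
      · rw [Set.indicator_of_mem hω, Set.indicator_of_mem (by exact hω), increment,
          density_eq_prod_attach]
        simp only [knowledge]
        ring
      · rw [Set.indicator_of_notMem hω, Set.indicator_of_notMem (by exact hω), zero_mul]
    simp only [h1]
    have hF : Measurable (A.indicator
        (fun z : (Finset.range (m + 1) → cube d → ℝ) × ((h : S) → adicCube d b m h.1 → ℝ) =>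
          φ t * ∏ j, z.1 j t)) :=
      (((measurable_prod_eval (m + 1) t).comp measurable_fst).const_mul _).indicator hA
    have hψ : Measurable fun f : adicCube d b m h → ℝ => f ⟨t, ht⟩ - 1 :=
      (measurable_pi_apply _).sub_const 1
    have h2 := hindep.comp hF hψ
    have h3 := h2.integral_fun_mul_eq_mul_integral
      (hF.comp (hP.measurable_knowledge m S)).aestronglyMeasurable
      ((hP.measurable_apply (m + 1) t).sub_const 1).aestronglyMeasurable
    refine h3.trans ?_
    have h4 : ∫ ω, (P (m + 1) t ω - 1) ∂Pr = 0 := by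
      rw [integral_sub _ (integrable_const _), hP.mean_one]
      · simp
      · by_contra hi
        have := hP.mean_one (m + 1) t
        rw [integral_undef hi] at this
        exact zero_ne_one this
    exact mul_eq_zero_of_right _ h4
  · simp [Set.indicator_of_notMem ht]

end Independence

/-! ### The supremum over finitely many test functions -/

section IncrementBound

variable {d b : ℕ} {Ω : Type*} [mΩ : MeasurableSpace Ω] {Pr : Measure Ω}
  {P : ℕ → cube d → Ω → ℝ}

theorem IsChaosSequence.integrable_cellIncrement [IsProbabilityMeasure Pr]
    (hP : IsChaosSequence Pr P) (m : ℕ) (h : Fin d → Fin (b ^ m)) {φ : cube d → ℝ}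
    (hφ : Measurable φ) (hφM : ∀ t, |φ t| ≤ 1) : Integrable (cellIncrement P m h φ) Pr :=
  (hP.integrable_cell m h hφ hφM).integral_prod_right

theorem IsChaosSequence.ae_integrable_increment [IsProbabilityMeasure Pr]
    (hP : IsChaosSequence Pr P) (n : ℕ) :
    ∀ᵐ ω ∂Pr, Integrable (fun t => increment P n t ω) (cubeVolume d) :=
  (hP.integrable_increment n).prod_left_ae

theorem integral_mul_increment_eq_sum {Ω : Type*} {P : ℕ → cube d → Ω → ℝ} (hb : 2 ≤ b) (m : ℕ)
    {φ : cube d → ℝ}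
    (hφ : Measurable φ) (hφM : ∀ t, |φ t| ≤ 1) {ω : Ω}
    (hω : Integrable (fun t => increment P (m + 1) t ω) (cubeVolume d)) :
    ∫ t, φ t * increment P (m + 1) t ω ∂(cubeVolume d)
      = ∑ h : Fin d → Fin (b ^ m), cellIncrement P m h φ ω := by
  have h1 : Integrable (fun t => φ t * increment P (m + 1) t ω) (cubeVolume d) :=
    hω.bdd_mul (c := 1) hφ.aestronglyMeasurable (Eventually.of_forall hφM)
  rw [integral_eq_sum_adicCube hb m h1]
  refine Finset.sum_congr rfl fun h _ => ?_
  rw [cellIncrement, ← integral_indicator (measurableSet_adicCube m h)]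
  refine integral_congr_ae (Eventually.of_forall fun t => ?_)
  simp only [Set.indicator]
  split_ifs <;> simp

/-- The moment bound for integrals of finitely many bounded functions against an increment. -/
theorem IsChaosSequence.pNorm_iSup_integral_increment_le [IsProbabilityMeasure Pr]
    (hP : IsChaosSequence Pr P) (hb : 2 ≤ b) {K : ℕ} (hK : 2 ≤ K) {p C : ℝ} (hp : 1 ≤ p)
    (hC : 0 ≤ C)
    (hsmooth : ∀ (G : Type) [Fintype G] (s x : G → ℝ), powSum K (s + x) ^ (p / (2 * K : ℕ)) ≤
      powSum K s ^ (p / (2 * K : ℕ)) + ∑ g, powSumGrad K p s g * x g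
        + C * powSum K x ^ (p / (2 * K : ℕ)))
    (m : ℕ) {N : ℕ} (c : (Fin d → Fin (b ^ m)) → Fin N)
    (hindep : ∀ i, iIndepFun (fun (h : {h : Fin d → Fin (b ^ m) // c h = i}) (ω : Ω)
      (t : adicCube d b m h.1) => P (m + 1) t.1 ω) Pr)
    {G : Type} [Fintype G] (φ : G → cube d → ℝ) (hφ : ∀ g, Measurable (φ g))
    (hφ1 : ∀ g t, |φ g t| ≤ 1) (A : (Fin d → Fin (b ^ m)) → Ω → ℝ≥0∞)
    (hA : ∀ h, Measurable (A h)) {a : ℝ≥0∞} (ha : a ≠ ∞)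
    (hφA : ∀ h, ∀ᵐ ω ∂Pr, ∀ g, ‖cellIncrement P m h (φ g) ω‖ₑ ≤ A h ω)
    (hAa : ∀ h, pNorm Pr p (A h) ≤ a) :
    pNorm Pr p (fun ω => ⨆ g, ‖∫ t, φ g t * increment P (m + 1) t ω ∂(cubeVolume d)‖ₑ) ≤
      N * (ENNReal.ofReal C ^ (1 / p) * (Fintype.card G : ℝ≥0∞) ^ (1 / (2 * K : ℕ) : ℝ) *
        (((b ^ m) ^ d : ℕ) : ℝ≥0∞) ^ (1 / p) * a) := by
  classical
  set Y : (Fin d → Fin (b ^ m)) → Ω → G → ℝ := fun h ω g => cellIncrement P m h (φ g) ω with hYdef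
  set T : Fin N → Finset (Fin d → Fin (b ^ m)) := fun i => Finset.univ.filter fun h => c h = i
  have hYm : ∀ h g, AEStronglyMeasurable (fun ω => Y h ω g) Pr := fun h g =>
    (hP.integrable_cellIncrement m h (hφ g) (hφ1 g)).aestronglyMeasurable
  have hcol : ∀ i, pNorm Pr p (fun ω => ENNReal.ofReal
      (powSum K (∑ h ∈ T i, Y h ω) ^ (1 / (2 * K : ℕ) : ℝ))) ≤
      ENNReal.ofReal C ^ (1 / p) * (Fintype.card G : ℝ≥0∞) ^ (1 / (2 * K : ℕ) : ℝ) *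
        (((b ^ m) ^ d : ℕ) : ℝ≥0∞) ^ (1 / p) * a := by
    intro i
    -- The σ-algebra attached to the cell `h` is generated by the past and the other cells of its
    -- colour.
    refine (pNorm_powSum_sum_le hK hp hC (hsmooth G) (T i) Y
      (fun h => MeasurableSpace.comap (knowledge b P m ((T i).erase h)) inferInstance)
      (fun h => (hP.measurable_knowledge m _).comap_le) (fun h _ g => hYm h g)
      (fun h _ h' hh' hne g => ?_) (fun h hh g => ?_) A ha (fun h _ => hA h)
      (fun h _ => hφA h) (fun h _ => hAa h)).trans ?_
    · exact hP.aestronglyMeasurable_cellIncrement m _ (Finset.mem_erase.2 ⟨hne, hh'⟩) (hφ g)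
        (hφ1 g)
    · refine hP.condExp_cellIncrement m _ ?_ (hφ g) (hφ1 g)
      exact hP.indepFun_knowledge m c i (hindep i) _
        (fun h' hh' => (Finset.mem_filter.1 (Finset.mem_of_mem_erase hh')).2)
        (Finset.mem_filter.1 hh).2 (Finset.notMem_erase h _)
    · gcongr
      refine (Finset.card_filter_le _ _).trans (le_of_eq ?_)
      simp
  -- The triangle inequality splits the sum by colours; within a colour each coordinate is dominated
  -- by the `ℓ^{2K}` norm.
  have hle : ∀ᵐ ω ∂Pr, (⨆ g, ‖∫ t, φ g t * increment P (m + 1) t ω ∂(cubeVolume d)‖ₑ) ≤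
      ∑ i, ENNReal.ofReal (powSum K (∑ h ∈ T i, Y h ω) ^ (1 / (2 * K : ℕ) : ℝ)) := by
    filter_upwards [hP.ae_integrable_increment (m + 1)] with ω hω
    refine iSup_le fun g => ?_
    rw [integral_mul_increment_eq_sum hb m (hφ g) (hφ1 g) hω,
      ← Finset.sum_fiberwise Finset.univ c]
    refine (enorm_sum_le _ _).trans (Finset.sum_le_sum fun i _ => ?_)
    have h1 : ∑ h ∈ Finset.univ.filter (fun h => c h = i), cellIncrement P m h (φ g) ω
        = (∑ h ∈ T i, Y h ω) g := by rw [Finset.sum_apply]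
    rw [h1, ← ofReal_norm, Real.norm_eq_abs]
    exact ENNReal.ofReal_le_ofReal (abs_le_powSum_rpow (by omega) _ g)
  refine (pNorm_mono hp hle).trans ((pNorm_sum_le hp Finset.univ fun i _ => ?_).trans ?_)
  · refine AEStronglyMeasurable.aemeasurable ?_ |>.ennreal_ofReal
    refine aestronglyMeasurable_comp_pi
      (Φ := fun y : G → ℝ => powSum K y ^ (1 / (2 * K : ℕ) : ℝ))
      ((measurable_powSum K).pow_const _) fun g => ?_
    have : (fun ω => (∑ h ∈ T i, Y h ω) g) = ∑ h ∈ T i, fun ω => Y h ω g := by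
      funext ω; simp [Finset.sum_apply]
    rw [this]
    exact Finset.aestronglyMeasurable_sum _ fun h _ => hYm h g
  · refine (Finset.sum_le_sum fun i _ => hcol i).trans (le_of_eq ?_)
    rw [Finset.sum_const, Finset.card_univ, Fintype.card_fin, nsmul_eq_mul]

end IncrementBound

/-! ### Growth rates with uniform constants -/

section Growth

/-- The finitely many exceptional indices are absorbed in the constant. -/
theorem exists_forall_le_of_eventually_le {f g : ℕ → ℝ} (hg : ∀ m, 0 < g m)
    (h : ∀ᶠ m in atTop, f m ≤ g m) : ∃ C : ℝ, 0 < C ∧ ∀ m, f m ≤ C * g m := by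
  obtain ⟨M, hM⟩ := eventually_atTop.1 h
  have hs : ∀ m, 0 ≤ |f m| / g m := fun m => div_nonneg (abs_nonneg _) (hg m).le
  refine ⟨1 + ∑ j ∈ Finset.range M, |f j| / g j,
    add_pos_of_pos_of_nonneg one_pos (Finset.sum_nonneg fun j _ => hs j), fun m => ?_⟩
  rcases le_or_gt M m with hm | hm
  · refine (hM m hm).trans ?_
    have := Finset.sum_nonneg fun j (_ : j ∈ Finset.range M) => hs j
    nlinarith [hg m]
  · have h1 : |f m| / g m ≤ ∑ j ∈ Finset.range M, |f j| / g j :=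
      Finset.single_le_sum (f := fun j => |f j| / g j) (fun j _ => hs j) (Finset.mem_range.2 hm)
    have h2 : |f m| = |f m| / g m * g m := (div_mul_cancel₀ _ (hg m).ne').symm
    calc f m ≤ |f m| := le_abs_self _
      _ = |f m| / g m * g m := h2
      _ ≤ _ := by
        have := (hg m).le
        gcongr
        linarith

theorem exists_natCast_add_one_le_rpow {b : ℝ} (hb : 1 < b) {η : ℝ} (hη : 0 < η) :
    ∃ C : ℝ, 0 < C ∧ ∀ m : ℕ, (m : ℝ) + 1 ≤ C * b ^ (m * η) := by
  have hlog : 0 < Real.log b := Real.log_pos hb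
  have hb0 : 0 < b := by linarith
  refine ⟨1 / (η * Real.log b) + 1, by positivity, fun m => ?_⟩
  have h1 : (m : ℝ) * η * Real.log b ≤ b ^ (m * η) := by
    rw [Real.rpow_def_of_pos hb0]
    have := Real.add_one_le_exp (Real.log b * (m * η))
    linarith
  have h2 : 1 ≤ b ^ ((m : ℝ) * η) := Real.one_le_rpow hb.le (by positivity)
  have h3 : (m : ℝ) ≤ 1 / (η * Real.log b) * b ^ (m * η) := by
    rw [div_mul_eq_mul_div, one_mul, le_div_iff₀ (by positivity)]
    linarith
  linarith

variable {d b : ℕ} {Ω : Type*} [mΩ : MeasurableSpace Ω] {Pr : Measure Ω}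
  {P : ℕ → cube d → Ω → ℝ}

/-- From some generation on every factor of the product is at most `b ^ (ℓ / p)`. -/
theorem exists_normProd_le (hb : 2 ≤ b) {p : ℝ} (hp : 1 ≤ p)
    (hfin : ∀ j, supMoment Pr P p j < ∞) {ℓ : ℝ}
    (hlim : limsupMoment Pr P p < ENNReal.ofReal ((b : ℝ) ^ ℓ)) :
    ∃ C : ℝ, 0 < C ∧ ∀ n : ℕ, normProd Pr P p n ≤ ENNReal.ofReal (C * (b : ℝ) ^ (n * (ℓ / p))) := by
  have hb0 : (0 : ℝ) < b := by positivity
  have h0 : 0 < p := by linarith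
  have hev : ∀ᶠ j in atTop, supMoment Pr P p j < ENNReal.ofReal ((b : ℝ) ^ ℓ) :=
    eventually_lt_of_limsup_lt hlim
  obtain ⟨M, hM⟩ := eventually_atTop.1 hev
  have hstep : ∀ j, M ≤ j → supMoment Pr P p j ^ (1 / p) ≤
      ENNReal.ofReal ((b : ℝ) ^ (ℓ / p)) := fun j hj => by
    refine (ENNReal.rpow_le_rpow (hM j hj).le (by positivity)).trans (le_of_eq ?_)
    rw [ENNReal.ofReal_rpow_of_nonneg (by positivity) (by positivity), ← Real.rpow_mul hb0.le,
      mul_one_div]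
  have hfinN : ∀ n, normProd Pr P p n ≠ ∞ := fun n =>
    ENNReal.prod_ne_top fun j _ => ENNReal.rpow_ne_top_of_nonneg (by positivity) (hfin j).ne
  have hg : ∀ n : ℕ, 0 < (b : ℝ) ^ (n * (ℓ / p)) := fun n => Real.rpow_pos_of_pos hb0 _
  obtain ⟨C, hC, hCle⟩ : ∃ C : ℝ, 0 < C ∧ ∀ n ≤ M,
      (normProd Pr P p n).toReal ≤ C * (b : ℝ) ^ (n * (ℓ / p)) := by
    obtain ⟨C, hC, h⟩ := exists_forall_le_of_eventually_le
      (f := fun n => if n ≤ M then (normProd Pr P p n).toReal else 0) hg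
      (eventually_atTop.2 ⟨M + 1, fun n hn => by
        rw [if_neg (by omega)]; exact (hg n).le⟩)
    exact ⟨C, hC, fun n hn => by simpa [hn] using h n⟩
  refine ⟨C, hC, fun n => ?_⟩
  have hsmall : ∀ n ≤ M, normProd Pr P p n ≤ ENNReal.ofReal (C * (b : ℝ) ^ (n * (ℓ / p))) :=
    fun n hn => by
      rw [← ENNReal.ofReal_toReal (hfinN n)]
      exact ENNReal.ofReal_le_ofReal (hCle n hn)
  rcases le_or_gt n M with hn | hn
  · exact hsmall n hn
  · induction n, hn.le using Nat.le_induction with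
    | base => exact hsmall M le_rfl
    | succ n hn' ih =>
      have ih' : normProd Pr P p n ≤ ENNReal.ofReal (C * (b : ℝ) ^ (n * (ℓ / p))) := by
        rcases hn'.eq_or_lt with h | h
        · exact h ▸ hsmall M le_rfl
        · exact ih h
      rw [normProd_succ]
      refine (mul_le_mul' ih' (hstep n hn')).trans (le_of_eq ?_)
      rw [← ENNReal.ofReal_mul (by positivity), mul_assoc, ← Real.rpow_add hb0]
      congr 3
      push_cast
      ring

end Growth

/-! ### The increments at frequencies of size `b ^ k` -/

section MainEstimate

theorem adicCube_subset_or_disjoint {d b : ℕ} (hb : 2 ≤ b) {m l : ℕ} (hml : m ≤ l)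
    (h : Fin d → Fin (b ^ m)) (h' : Fin d → Fin (b ^ l)) :
    adicCube d b l h' ⊆ adicCube d b m h ∨ Disjoint (adicCube d b l h') (adicCube d b m h) := by
  obtain ⟨h'', hh''⟩ := exists_adicCube_subset hb hml h'
  rcases eq_or_ne h'' h with rfl | hne
  · exact Or.inl hh''
  · exact Or.inr ((pairwise_disjoint_adicCube hb m hne).mono_left hh'')

/-- For `k ≤ m` the decay in `m` suffices; for `m ≤ k` the exponents `θ` over `m` generations and
`α` over the remaining `k - m` both exceed `β + 6η`. In either case `6η max(m, k)` pays for the loss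
`2η(m + k)` and leaves `η(m + k)` for summability. -/
theorem rpow_exponent_bound {b θ α β η m k : ℝ} (hb : 1 ≤ b) (hm : 0 ≤ m)
    (hη : 0 ≤ η) (h1 : β + 6 * η ≤ θ) (h2 : β + 6 * η ≤ α) (hβ : 0 ≤ β) :
    b ^ (2 * η * (m + k) - m * θ) * min 1 (b ^ ((m - k) * α)) ≤
      b ^ (-(k * β)) * b ^ (-(η * (m + k))) := by
  have hb0 : 0 < b := by linarith
  rw [← Real.rpow_add hb0]
  rcases le_total k m with h | h
  · calc _ ≤ b ^ (2 * η * (m + k) - m * θ) * 1 := by gcongr; exact min_le_left _ _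
      _ ≤ _ := by
        rw [mul_one]
        refine Real.rpow_le_rpow_of_exponent_le hb ?_
        have e1 : m * (β + 6 * η) ≤ m * θ := by gcongr
        have e2 : k * β ≤ m * β := by gcongr
        have e3 : η * k ≤ η * m := by gcongr
        linarith
  · calc _ ≤ b ^ (2 * η * (m + k) - m * θ) * b ^ ((m - k) * α) := by
          gcongr; exact min_le_right _ _
      _ ≤ _ := by
        rw [← Real.rpow_add hb0]
        refine Real.rpow_le_rpow_of_exponent_le hb ?_
        have e1 : m * (β + 6 * η) ≤ m * θ := by gcongr
        have e2 : (k - m) * (β + 6 * η) ≤ (k - m) * α := by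
          have : 0 ≤ k - m := by linarith
          gcongr
        have e3 : η * m ≤ η * k := by gcongr
        linarith

theorem ofReal_mul₅ {x₁ x₂ x₃ x₄ : ℝ} (h₁ : 0 ≤ x₁) (h₂ : 0 ≤ x₂) (h₃ : 0 ≤ x₃) (h₄ : 0 ≤ x₄)
    (x₅ : ℝ) : ENNReal.ofReal (x₁ * x₂ * x₃ * x₄ * x₅) = ENNReal.ofReal x₁ * ENNReal.ofReal x₂ *
      ENNReal.ofReal x₃ * ENNReal.ofReal x₄ * ENNReal.ofReal x₅ := by
  rw [ENNReal.ofReal_mul (by positivity), ENNReal.ofReal_mul (by positivity),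
    ENNReal.ofReal_mul (by positivity), ENNReal.ofReal_mul h₁]

variable {d b : ℕ} {Ω : Type*} [mΩ : MeasurableSpace Ω] {Pr : Measure Ω}
  {P : ℕ → cube d → Ω → ℝ}

/-- The summable bound, with rate `b ^ (-k β)`, for the `L^p` norm of the integrals of at most
`c₀ b ^ (k D)` functions against the increments from generation `k₀` on, if the contributions of the
cells are controlled by `freqBound`. -/
def HasIncrementBound (Pr : Measure Ω) (b : ℕ) (P : ℕ → cube d → Ω → ℝ) (p β : ℝ) (k₀ : ℕ)
    (c₀ D : ℝ) : Prop :=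
    ∃ η : ℝ, 0 < η ∧ ∃ C : ℝ, 0 ≤ C ∧ ∀ m, k₀ ≤ m → ∀ (k : ℕ) (G : Type) [Fintype G]
      (φ : G → cube d → ℝ), (∀ g, Measurable (φ g)) → (∀ g t, |φ g t| ≤ 1) →
      (Fintype.card G : ℝ) ≤ c₀ * (b : ℝ) ^ (k * D) →
      (∀ h, ∀ᵐ ω ∂Pr, ∀ g, ‖cellIncrement P m h (φ g) ω‖ₑ ≤ freqBound b (m + 2) k
        (fun t => (adicCube d b m h).indicator (fun t => increment P (m + 1) t ω) t)) →
      pNorm Pr p (fun ω => ⨆ g, ‖∫ t, φ g t * increment P (m + 1) t ω ∂(cubeVolume d)‖ₑ) ≤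
        ENNReal.ofReal (C * (b : ℝ) ^ (-((k : ℝ) * β)) * (b : ℝ) ^ (-(η * (m + k))))

/-- The summable bound for the increments of the integrals of polynomially many functions. -/
theorem IsChaosSequence.exists_pNorm_iSup_increment_bound [IsProbabilityMeasure Pr]
    (hP : IsChaosSequence Pr P) (hb : 2 ≤ b) {p p₀ α₀ β ℓ : ℝ} (hp : 1 ≤ p) (hp2 : p ≤ 2)
    (hpp₀ : p ≤ p₀) (hα₀ : 0 < α₀) (hα₀1 : α₀ ≤ 1) (hfin : ∀ j, supMoment Pr P p j < ∞)
    (hlim : limsupMoment Pr P p < ENNReal.ofReal ((b : ℝ) ^ ℓ))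
    (hholder : UniformHolder Pr b P p₀ α₀) (hβ : 0 ≤ β) (hβα : β < α₀)
    (hβℓ : β < (d * (p - 1) - ℓ) / p) {N : ℕ → ℕ}
    (hN : ∀ ε : ℝ, 0 < ε →
      (fun m : ℕ => (N m : ℝ)) =o[atTop] (fun m : ℕ => (b : ℝ) ^ ((m : ℝ) * ε)))
    (c : ∀ m, (Fin d → Fin (b ^ m)) → Fin (N m)) {k₀ : ℕ}
    (hindep : ∀ m, k₀ ≤ m → ∀ i : Fin (N m),
        iIndepFun (fun (h : {h : Fin d → Fin (b ^ m) // c m h = i}) (ω : Ω)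
            (t : adicCube d b m h.1) => P (m + 1) t.1 ω) Pr) {c₀ D : ℝ} (hc₀ : 0 ≤ c₀) :
    HasIncrementBound Pr b P p β k₀ c₀ D := by
  have hb0 : (0 : ℝ) < b := by positivity
  have hb1 : (1 : ℝ) < b := by exact_mod_cast (by omega : 1 < b)
  have hp0 : 0 < p := by linarith
  set θ : ℝ := (d * (p - 1) - ℓ) / p with hθ
  -- A sixth of the available room, to match the slack required by `rpow_exponent_bound`.
  obtain ⟨η, hη, hη1, hη2⟩ : ∃ η : ℝ, 0 < η ∧ β + 6 * η ≤ θ ∧ β + 6 * η ≤ α₀ := by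
    refine ⟨min (θ - β) (α₀ - β) / 6, div_pos (lt_min (by linarith) (by linarith)) (by norm_num),
      ?_, ?_⟩
    · have := min_le_left (θ - β) (α₀ - β); linarith
    · have := min_le_right (θ - β) (α₀ - β); linarith
  -- `K` is so large that the `2 K`-th root of a family of size `c₀ b ^ (k D)` grows no faster than
  -- `b ^ (k η)`.
  obtain ⟨K, hK2, hKD⟩ : ∃ K : ℕ, 2 ≤ K ∧ D / (2 * K : ℕ) ≤ η := by
    obtain ⟨K, hK⟩ := exists_nat_ge (max 2 (D / η))
    have hK2 : (2 : ℝ) ≤ K := (le_max_left _ _).trans hK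
    refine ⟨K, by exact_mod_cast hK2, ?_⟩
    rw [div_le_iff₀ (by push_cast; linarith)]
    have := (le_max_right 2 (D / η)).trans hK
    rw [div_le_iff₀ hη] at this
    push_cast
    nlinarith
  have hK0 : (0 : ℝ) < (2 * K : ℕ) := by exact_mod_cast (by omega : 0 < 2 * K)
  obtain ⟨Cs, hCs, hsmooth⟩ := exists_powSum_add_rpow_le hK2 hp hp2
  obtain ⟨H, hHtop, hH⟩ := hP.exists_pNorm_sub_le hb hp hpp₀ hα₀ hholder
  obtain ⟨C₁, hC₁, hN'⟩ := exists_forall_le_of_eventually_le (f := fun m => (N m : ℝ))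
    (g := fun m : ℕ => (b : ℝ) ^ ((m : ℝ) * η)) (fun m => Real.rpow_pos_of_pos hb0 _)
    (by
      filter_upwards [(hN η hη).bound zero_lt_one] with m hm
      rwa [one_mul, Real.norm_of_nonneg (by positivity), Real.norm_of_nonneg (by positivity)]
        at hm)
  obtain ⟨C₃, hC₃, hnp⟩ := exists_normProd_le hb hp hfin hlim
  obtain ⟨C₅, hC₅, hpoly⟩ := exists_natCast_add_one_le_rpow hb1 hη
  set h₀ : ℝ := H.toReal
  have hh₀ : 0 ≤ h₀ := ENNReal.toReal_nonneg
  set C₂ : ℝ := c₀ ^ (1 / (2 * K : ℕ) : ℝ)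
  have hC₂ : 0 ≤ C₂ := Real.rpow_nonneg hc₀ _
  set C₄ : ℝ := Cs ^ (1 / p)
  have hC₄ : 0 ≤ C₄ := Real.rpow_nonneg hCs _
  set C : ℝ := C₁ * C₄ * C₂ * (2 * (C₃ * (b : ℝ) ^ (2 * (ℓ / p)))) * ((2 * h₀ + 1) * C₅) *
    ((Real.sqrt d * b + 1) * C₅) * (b : ℝ) ^ (2 * α₀) with hCdef
  refine ⟨η, hη, C, by positivity, fun m hm k G _ φ hφ hφ1 hcard hφA => ?_⟩
  set A : (Fin d → Fin (b ^ m)) → Ω → ℝ≥0∞ := fun h ω => freqBound b (m + 2) k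
    (fun t => (adicCube d b m h).indicator (fun t => increment P (m + 1) t ω) t)
  have hAm : ∀ h, Measurable (A h) := fun h => by
    refine measurable_freqBound (f := fun t ω =>
      (adicCube d b m h).indicator (fun t => increment P (m + 1) t ω) t) (m + 2) k ?_
    exact (hP.measurable_increment (m + 1)).indicator
      (measurable_fst (measurableSet_adicCube m h))
  set v : ℝ := (((b : ℝ) ^ m)⁻¹) ^ d
  set w : ℝ := min 1 ((b : ℝ) ^ ((((m + 2 : ℕ) : ℝ) - k) * α₀))
  have hw0 : 0 ≤ w := le_min zero_le_one (by positivity)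
  set a : ℝ := v * (2 * (C₃ * (b : ℝ) ^ (((m + 2 : ℕ) : ℝ) * (ℓ / p)))) *
    (((m + 2 : ℕ) : ℝ) * h₀ + 1) * ((Real.sqrt d * b + 1) * (k + 1)) * w with ha_def
  have hAa : ∀ h, pNorm Pr p (A h) ≤ ENNReal.ofReal a := by
    intro h
    -- The increment of index `m + 1` involves `P 0, …, P (m + 1)`. Its regularity estimate
    -- therefore starts at generation `m + 2`, although the cell has generation `m`; the mismatch
    -- costs only the constant `b ^ (2 * α₀)`.
    refine (pNorm_freqBound_le hb hp (m + 2) k (hP.measurable_increment (m + 1))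
      (measurableSet_adicCube m h)
      (fun l hl h' => adicCube_subset_or_disjoint hb (by omega) h h') hα₀ hα₀1
      (c := 2 * normProd Pr P p (m + 1 + 1)) (M := (m + 1 + 1 : ℕ) * H)
      (fun t ht => hP.pNorm_increment_le hp (m + 1) ht.2)
      (fun l hl h' _ t ht s hs => hP.pNorm_increment_sub_le hb hp hα₀ hH hl ht hs)).trans ?_
    have e1 : ((m + 1 + 1 : ℕ) : ℝ≥0∞) * H + 1
        = ENNReal.ofReal (((m + 2 : ℕ) : ℝ) * h₀ + 1) := by
      rw [ENNReal.ofReal_add (by positivity) zero_le_one, ENNReal.ofReal_mul (by positivity),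
        ENNReal.ofReal_natCast, ENNReal.ofReal_toReal hHtop, ENNReal.ofReal_one]
    have e2 : 2 * normProd Pr P p (m + 1 + 1) ≤
        ENNReal.ofReal (2 * (C₃ * (b : ℝ) ^ (((m + 2 : ℕ) : ℝ) * (ℓ / p)))) := by
      rw [ENNReal.ofReal_mul (by norm_num), ENNReal.ofReal_ofNat]
      gcongr
      exact hnp (m + 2)
    have e3 : ENNReal.ofReal a = _ := ofReal_mul₅ (by positivity : 0 ≤ v)
      (by positivity : 0 ≤ 2 * (C₃ * (b : ℝ) ^ (((m + 2 : ℕ) : ℝ) * (ℓ / p))))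
      (by positivity : 0 ≤ ((m + 2 : ℕ) : ℝ) * h₀ + 1)
      (by positivity : 0 ≤ (Real.sqrt d * b + 1) * ((k : ℝ) + 1)) w
    rw [e1, cubeVolume_adicCube hb, e3]
    gcongr
  refine (hP.pNorm_iSup_integral_increment_le hb hK2 hp hCs hsmooth m (c m) (hindep m hm) φ hφ hφ1
    A hAm ENNReal.ofReal_ne_top hφA hAa).trans ?_
  have hpi : (0 : ℝ) ≤ 1 / p := by positivity
  have hKi : (0 : ℝ) ≤ 1 / (2 * K : ℕ) := by positivity
  have r1 : ENNReal.ofReal Cs ^ (1 / p) = ENNReal.ofReal C₄ :=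
    ENNReal.ofReal_rpow_of_nonneg hCs hpi
  have r2 : (Fintype.card G : ℝ≥0∞) ^ (1 / (2 * K : ℕ) : ℝ)
      ≤ ENNReal.ofReal (C₂ * (b : ℝ) ^ (k * η)) := by
    rw [← ENNReal.ofReal_natCast, ENNReal.ofReal_rpow_of_nonneg (by positivity) hKi]
    refine ENNReal.ofReal_le_ofReal ((Real.rpow_le_rpow (by positivity) hcard hKi).trans ?_)
    rw [Real.mul_rpow hc₀ (by positivity), ← Real.rpow_mul hb0.le]
    have : (k : ℝ) * D * (1 / (2 * K : ℕ)) ≤ k * η := by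
      calc _ = (k : ℝ) * (D / (2 * K : ℕ)) := by ring
        _ ≤ _ := by gcongr
    have := Real.rpow_le_rpow_of_exponent_le hb1.le this
    gcongr
  have r3 : (((b ^ m) ^ d : ℕ) : ℝ≥0∞) ^ (1 / p)
      = ENNReal.ofReal ((b : ℝ) ^ ((m : ℝ) * d / p)) := by
    rw [← ENNReal.ofReal_natCast, ENNReal.ofReal_rpow_of_nonneg (by positivity) hpi]
    push_cast
    rw [← pow_mul, ← Real.rpow_natCast, ← Real.rpow_mul hb0.le]
    congr 2
    push_cast
    ring
  have r4 : (N m : ℝ≥0∞) ≤ ENNReal.ofReal (C₁ * (b : ℝ) ^ ((m : ℝ) * η)) := by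
    rw [← ENNReal.ofReal_natCast]
    exact ENNReal.ofReal_le_ofReal (hN' m)
  have hreal : C₁ * (b : ℝ) ^ ((m : ℝ) * η) * (C₄ * (C₂ * (b : ℝ) ^ (k * η)) *
      (b : ℝ) ^ ((m : ℝ) * d / p) * a) ≤
      C * (b : ℝ) ^ (-((k : ℝ) * β)) * (b : ℝ) ^ (-(η * (m + k))) := by
    have hw : w ≤ (b : ℝ) ^ (2 * α₀) * min 1 ((b : ℝ) ^ (((m : ℝ) - k) * α₀)) := by
      have : (b : ℝ) ^ ((((m + 2 : ℕ) : ℝ) - k) * α₀)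
          = (b : ℝ) ^ (2 * α₀) * (b : ℝ) ^ (((m : ℝ) - k) * α₀) := by
        rw [← Real.rpow_add hb0]; congr 1; push_cast; ring
      have hge : 1 ≤ (b : ℝ) ^ (2 * α₀) := Real.one_le_rpow hb1.le (by positivity)
      rw [mul_min_of_nonneg _ _ (by positivity), ← this]
      refine le_min ((min_le_left _ _).trans (by linarith)) (min_le_right _ _)
    have hM : ((m + 2 : ℕ) : ℝ) * h₀ + 1 ≤ (2 * h₀ + 1) * C₅ * (b : ℝ) ^ ((m : ℝ) * η) := by
      have : ((m + 2 : ℕ) : ℝ) * h₀ + 1 ≤ (2 * h₀ + 1) * (m + 1) := by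
        push_cast
        have : 0 ≤ (m : ℝ) * h₀ := by positivity
        have : (0 : ℝ) ≤ m := by positivity
        nlinarith
      refine this.trans ?_
      rw [mul_assoc]
      have := hpoly m
      gcongr
    have hk := hpoly k
    have ha : a ≤ v * (2 * (C₃ * (b : ℝ) ^ (((m + 2 : ℕ) : ℝ) * (ℓ / p)))) *
        ((2 * h₀ + 1) * C₅ * (b : ℝ) ^ ((m : ℝ) * η)) *
        ((Real.sqrt d * b + 1) * (C₅ * (b : ℝ) ^ ((k : ℝ) * η))) *
        ((b : ℝ) ^ (2 * α₀) * min 1 ((b : ℝ) ^ (((m : ℝ) - k) * α₀))) := by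
      rw [ha_def]
      gcongr
    have hv : v = (b : ℝ) ^ (-((m : ℝ) * d)) := by
      rw [Real.rpow_neg hb0.le, ← Nat.cast_mul, Real.rpow_natCast, pow_mul]
      exact inv_pow _ _
    have hℓ : (b : ℝ) ^ (((m + 2 : ℕ) : ℝ) * (ℓ / p))
        = (b : ℝ) ^ (2 * (ℓ / p)) * (b : ℝ) ^ ((m : ℝ) * (ℓ / p)) := by
      rw [← Real.rpow_add hb0]; congr 1; push_cast; ring
    -- In order: the number of colours, the number of test functions, the number of cells, the
    -- volume of a cell, the moments of the density, and the polynomial factors in `m` and in `k`.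
    have hexp : (b : ℝ) ^ ((m : ℝ) * η) * (b : ℝ) ^ ((k : ℝ) * η) * (b : ℝ) ^ ((m : ℝ) * d / p) *
        (b : ℝ) ^ (-((m : ℝ) * d)) * (b : ℝ) ^ ((m : ℝ) * (ℓ / p)) * (b : ℝ) ^ ((m : ℝ) * η) *
        (b : ℝ) ^ ((k : ℝ) * η) = (b : ℝ) ^ (2 * η * (m + k) - m * θ) := by
      simp only [← Real.rpow_add hb0]
      congr 1
      rw [hθ]
      field_simp
      ring
    calc _ ≤ C₁ * (b : ℝ) ^ ((m : ℝ) * η) * (C₄ * (C₂ * (b : ℝ) ^ (k * η)) *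
        (b : ℝ) ^ ((m : ℝ) * d / p) * (v * (2 * (C₃ * (b : ℝ) ^ (((m + 2 : ℕ) : ℝ) * (ℓ / p)))) *
        ((2 * h₀ + 1) * C₅ * (b : ℝ) ^ ((m : ℝ) * η)) *
        ((Real.sqrt d * b + 1) * (C₅ * (b : ℝ) ^ ((k : ℝ) * η))) *
        ((b : ℝ) ^ (2 * α₀) * min 1 ((b : ℝ) ^ (((m : ℝ) - k) * α₀))))) := by gcongr
      _ = C * ((b : ℝ) ^ (2 * η * (m + k) - m * θ) * min 1 ((b : ℝ) ^ (((m : ℝ) - k) * α₀))) := by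
        rw [← hexp, hv, hℓ, hCdef]; ring
      _ ≤ C * ((b : ℝ) ^ (-((k : ℝ) * β)) * (b : ℝ) ^ (-(η * (m + k)))) := by
        exact mul_le_mul_of_nonneg_left (rpow_exponent_bound (m := (m : ℝ)) (k := (k : ℝ)) hb1.le
          (Nat.cast_nonneg m) hη.le hη1 hη2 hβ) (by positivity : 0 ≤ C)
      _ = _ := by ring
  refine le_trans ?_ (ENNReal.ofReal_le_ofReal hreal)
  have hv0 : 0 ≤ v := by positivity
  have ha0 : 0 ≤ a := by positivity
  rw [ENNReal.ofReal_mul (by positivity : 0 ≤ C₁ * (b : ℝ) ^ ((m : ℝ) * η)),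
    ENNReal.ofReal_mul (by positivity : 0 ≤ C₄ * (C₂ * (b : ℝ) ^ (k * η)) *
      (b : ℝ) ^ ((m : ℝ) * d / p)),
    ENNReal.ofReal_mul (by positivity : 0 ≤ C₄ * (C₂ * (b : ℝ) ^ (k * η))),
    ENNReal.ofReal_mul hC₄, r1, r3]
  gcongr

end MainEstimate

/-! ### From moment bounds to almost sure bounds -/

section AlmostSureBounds

variable {d b : ℕ} {Ω : Type*} [mΩ : MeasurableSpace Ω] {Pr : Measure Ω}
  {P : ℕ → cube d → Ω → ℝ}

/-- The expectation of the sum is finite, because the `L¹` norm is at most the `L^p` norm. -/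
theorem ae_tsum_lt_top_of_pNorm_le [IsProbabilityMeasure Pr] {p : ℝ} (hp : 1 ≤ p) {ι : Type*}
    [Countable ι] {S : ι → Ω → ℝ≥0∞} (hS : ∀ i, Measurable (S i)) {a : ι → ℝ} (ha : Summable a)
    (h : ∀ i, pNorm Pr p (S i) ≤ ENNReal.ofReal (a i)) : ∀ᵐ ω ∂Pr, ∑' i, S i ω < ∞ := by
  refine ae_lt_top (Measurable.tsum hS) ?_
  rw [lintegral_tsum fun i => (hS i).aemeasurable]
  exact ((ENNReal.tsum_le_tsum fun i => (lintegral_le_pNorm hp (hS i)).trans (h i)).trans_lt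
    ha.tsum_ofReal_lt_top).ne

theorem IsChaosSequence.ae_integrable_density [IsProbabilityMeasure Pr]
    (hP : IsChaosSequence Pr P) :
    ∀ᵐ ω ∂Pr, ∀ n, Integrable (fun t => density P n t ω) (cubeVolume d) :=
  ae_all_iff.2 fun n => (hP.integrable_density n).prod_left_ae

theorem enorm_cellIncrement_le {Ω : Type*} {P : ℕ → cube d → Ω → ℝ} (m : ℕ) (h : Fin d → Fin (b ^ m)) {φ : cube d → ℝ}
    (hφ1 : ∀ t, |φ t| ≤ 1) (ω : Ω) : ‖cellIncrement P m h φ ω‖ₑ ≤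
      ∫⁻ t, ‖(adicCube d b m h).indicator (fun t => increment P (m + 1) t ω) t‖ₑ
        ∂(cubeVolume d) := by
  refine (enorm_integral_le_lintegral_enorm _).trans (lintegral_mono fun t => ?_)
  rw [enorm_mul]
  refine mul_le_of_le_one_left' ?_
  rw [← ofReal_norm]
  exact ENNReal.ofReal_le_one.2 (hφ1 t)

theorem IsChaosSequence.measurable_integral_increment (hP : IsChaosSequence Pr P) (n : ℕ)
    {φ : cube d → ℝ} (hφ : Measurable φ) :
    Measurable fun ω => ‖∫ t, φ t * increment P n t ω ∂(cubeVolume d)‖ₑ := by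
  have h1 : Measurable fun z : Ω × cube d => φ z.2 * increment P n z.2 z.1 :=
    (hφ.comp measurable_snd).mul ((hP.measurable_increment n).comp measurable_swap)
  exact h1.stronglyMeasurable.integral_prod_right'.measurable.enorm

theorem IsChaosSequence.ae_tsum_integral_increment_lt_top [IsProbabilityMeasure Pr]
    (hP : IsChaosSequence Pr P) (hb : 2 ≤ b) {p β : ℝ} (hp : 1 ≤ p) {k₀ : ℕ}
    (hinc : HasIncrementBound Pr b P p β k₀ 1 0) {φ : cube d → ℝ} (hφ : Measurable φ)
    (hφ1 : ∀ t, |φ t| ≤ 1) :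
    ∀ᵐ ω ∂Pr, ∑' m, ‖∫ t, φ t * increment P (k₀ + m + 1) t ω ∂(cubeVolume d)‖ₑ < ∞ := by
  obtain ⟨η, hη, C, hC, h⟩ := hinc
  have hb0 : (0 : ℝ) < b := by positivity
  have hb1 : (1 : ℝ) < b := by exact_mod_cast (by omega : 1 < b)
  refine ae_tsum_lt_top_of_pNorm_le hp
    (fun m => hP.measurable_integral_increment _ hφ)
    (a := fun m => C * (b : ℝ) ^ (-(η * k₀)) * ((b : ℝ) ^ (-η)) ^ m) ?_ fun m => ?_
  · refine Summable.mul_left _ (summable_geometric_of_lt_one (by positivity) ?_)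
    exact Real.rpow_lt_one_of_one_lt_of_neg hb1 (by linarith)
  -- With `k = 0`, `freqBound` is just the `L¹` norm, so any bounded test function is admissible; no
  -- oscillation is needed.
  · have h1 := h (k₀ + m) (by omega) 0 Unit (fun _ => φ) (fun _ => hφ) (fun _ => hφ1) (by simp)
      (fun h' => Eventually.of_forall fun ω _ => by
        rw [freqBound, if_neg (by omega)]
        exact enorm_cellIncrement_le _ h' hφ1 ω)
    simp only [iSup_unique] at h1
    refine h1.trans (le_of_eq ?_)
    rw [← Real.rpow_natCast, ← Real.rpow_mul hb0.le]
    rw [mul_assoc C ((b : ℝ) ^ (-(η * k₀))), ← Real.rpow_add hb0]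
    congr 1
    simp only [Nat.cast_zero, zero_mul, neg_zero, Real.rpow_zero, mul_one]
    congr 2
    push_cast
    ring

theorem integral_mul_density_succ {Ω : Type*} {P : ℕ → cube d → Ω → ℝ} {E : Type*} [NormedRing E] [NormedAlgebra ℝ E]
    {φ : cube d → E} (hφ : AEStronglyMeasurable φ (cubeVolume d)) {M : ℝ} (hφM : ∀ t, ‖φ t‖ ≤ M)
    {ω : Ω} (hω : ∀ n, Integrable (fun t => density P n t ω) (cubeVolume d)) (n : ℕ) :
    ∫ t, density P (n + 1) t ω • φ t ∂(cubeVolume d) = ∫ t, density P n t ω • φ t ∂(cubeVolume d)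
      + ∫ t, increment P n t ω • φ t ∂(cubeVolume d) := by
  have h1 : ∀ n, Integrable (fun t => density P n t ω • φ t) (cubeVolume d) := fun n =>
    (hω n).smul_bdd M hφ (Eventually.of_forall hφM)
  simp only [increment_eq_sub, sub_smul]
  rw [integral_sub (h1 _) (h1 _)]
  abel

/-- Almost sure convergence of the integrals of a bounded function. -/
theorem IsChaosSequence.ae_exists_tendsto_integral [IsProbabilityMeasure Pr]
    (hP : IsChaosSequence Pr P) (hb : 2 ≤ b) {p β : ℝ} (hp : 1 ≤ p) {k₀ : ℕ}
    (hinc : HasIncrementBound Pr b P p β k₀ 1 0) {φ : cube d → ℝ} (hφ : Measurable φ)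
    (hφ1 : ∀ t, |φ t| ≤ 1) :
    ∀ᵐ ω ∂Pr, ∃ l, Tendsto (fun n => ∫ t, density P n t ω • φ t ∂(cubeVolume d)) atTop (𝓝 l) := by
  filter_upwards [hP.ae_integrable_density, hP.ae_tsum_integral_increment_lt_top hb hp hinc hφ hφ1]
    with ω hω hsum
  suffices h : CauchySeq fun n => ∫ t, density P (n + (k₀ + 1)) t ω • φ t ∂(cubeVolume d) by
    obtain ⟨l, hl⟩ := cauchySeq_tendsto_of_complete h
    exact ⟨l, (tendsto_add_atTop_iff_nat (k₀ + 1)).1 hl⟩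
  refine cauchySeq_of_summable_dist ?_
  have h1 : Summable fun m => ‖∫ t, φ t * increment P (k₀ + m + 1) t ω ∂(cubeVolume d)‖ := by
    refine (ENNReal.summable_toReal hsum.ne).congr fun m => ?_
    rw [toReal_enorm]
  refine h1.congr fun m => ?_
  rw [dist_comm, dist_eq_norm, Nat.succ_eq_add_one, add_right_comm m 1,
    integral_mul_density_succ hφ.aestronglyMeasurable hφ1 hω, add_sub_cancel_left]
  simp only [smul_eq_mul, mul_comm (φ _)]
  rw [show m + (k₀ + 1) = k₀ + m + 1 by omega]

/-- The real and the imaginary part of a character. -/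
noncomputable def wavePart (x : EuclideanSpace ℝ (Fin d)) (e : Bool) (t : cube d) : ℝ :=
  if e then (wave x t).re else (wave x t).im

theorem measurable_wavePart (x : EuclideanSpace ℝ (Fin d)) (e : Bool) :
    Measurable (wavePart x e) := by
  have := (continuous_wave x).measurable
  unfold wavePart
  split_ifs
  · exact Complex.measurable_re.comp this
  · exact Complex.measurable_im.comp this

theorem abs_wavePart_le (x : EuclideanSpace ℝ (Fin d)) (e : Bool) (t : cube d) :
    |wavePart x e t| ≤ 1 := by
  unfold wavePart
  split_ifs
  · exact (Complex.abs_re_le_norm _).trans (norm_wave x t).le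
  · exact (Complex.abs_im_le_norm _).trans (norm_wave x t).le

theorem integral_wavePart_mul (x : EuclideanSpace ℝ (Fin d)) (e : Bool) {g : cube d → ℝ}
    (hg : Integrable g (cubeVolume d)) :
    ∫ t, wavePart x e t * g t ∂(cubeVolume d) =
      if e then (∫ t, wave x t * (g t : ℂ) ∂(cubeVolume d)).re
      else (∫ t, wave x t * (g t : ℂ) ∂(cubeVolume d)).im := by
  have h := integrable_wave_mul x hg
  split_ifs with he
  · rw [← Complex.reCLM_apply, ← Complex.reCLM.integral_comp_comm h]
    simp [wavePart, he]
  · rw [← Complex.imCLM_apply, ← Complex.imCLM.integral_comp_comm h]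
    simp [wavePart, he]

theorem enorm_integral_wavePart_mul_le (x : EuclideanSpace ℝ (Fin d)) (e : Bool) {g : cube d → ℝ}
    (hg : Integrable g (cubeVolume d)) : ‖∫ t, wavePart x e t * g t ∂(cubeVolume d)‖ₑ ≤
      ‖∫ t, wave x t * (g t : ℂ) ∂(cubeVolume d)‖ₑ := by
  rw [integral_wavePart_mul x e hg, enorm_le_iff_norm_le]
  split_ifs
  · exact Complex.abs_re_le_norm _
  · exact Complex.abs_im_le_norm _

theorem enorm_integral_wave_mul_le_add (x : EuclideanSpace ℝ (Fin d)) {g : cube d → ℝ}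
    (hg : Integrable g (cubeVolume d)) : ‖∫ t, wave x t * (g t : ℂ) ∂(cubeVolume d)‖ₑ ≤
      ‖∫ t, wavePart x true t * g t ∂(cubeVolume d)‖ₑ +
        ‖∫ t, wavePart x false t * g t ∂(cubeVolume d)‖ₑ := by
  rw [integral_wavePart_mul x _ hg, integral_wavePart_mul x _ hg]
  simp only [if_true, Bool.false_eq_true, if_false]
  rw [← ofReal_norm, ← ofReal_norm, ← ofReal_norm, ← ENNReal.ofReal_add (norm_nonneg _)
    (norm_nonneg _)]
  exact ENNReal.ofReal_le_ofReal (Complex.norm_le_abs_re_add_abs_im _)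

/-- Treats the generations without an independence assumption. A density of fixed generation is
regular of order `α₀` in the mean, and the gap between `β` and `α₀` absorbs the polynomial factor
and leaves a geometric one. -/
theorem IsChaosSequence.exists_pNorm_freqBound_density_le [IsProbabilityMeasure Pr]
    (hP : IsChaosSequence Pr P) (hb : 2 ≤ b) {p p₀ α₀ β : ℝ} (hp : 1 ≤ p)
    (hpp₀ : p ≤ p₀) (hα₀ : 0 < α₀) (hα₀1 : α₀ ≤ 1) (hfin : ∀ j, supMoment Pr P p j < ∞)
    (hholder : UniformHolder Pr b P p₀ α₀) (hβα : β < α₀) (n : ℕ) :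
    ∃ η : ℝ, 0 < η ∧ ∃ C : ℝ, ∀ k : ℕ,
      pNorm Pr p (fun ω => freqBound b n k (fun t => density P n t ω)) ≤
        ENNReal.ofReal (C * (b : ℝ) ^ (-((k : ℝ) * β)) * (b : ℝ) ^ (-(η * k))) := by
  have hb0 : (0 : ℝ) < b := by positivity
  have hb1 : (1 : ℝ) < b := by exact_mod_cast (by omega : 1 < b)
  obtain ⟨H, hHtop, hH⟩ := hP.exists_pNorm_sub_le hb hp hpp₀ hα₀ hholder
  set η : ℝ := (α₀ - β) / 2 with hη_def
  have hη : 0 < η := by rw [hη_def]; linarith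
  obtain ⟨C₅, hC₅, hpoly⟩ := exists_natCast_add_one_le_rpow hb1 hη
  have hnp : normProd Pr P p n ≠ ∞ :=
    ENNReal.prod_ne_top fun j _ => ENNReal.rpow_ne_top_of_nonneg (by positivity) (hfin j).ne
  have htop : normProd Pr P p n * ((n : ℝ≥0∞) * H + 1) ≠ ∞ :=
    ENNReal.mul_ne_top hnp (ENNReal.add_ne_top.2 ⟨ENNReal.mul_ne_top (by simp) hHtop, by simp⟩)
  set c : ℝ := (normProd Pr P p n * ((n : ℝ≥0∞) * H + 1)).toReal
  have hc : 0 ≤ c := ENNReal.toReal_nonneg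
  refine ⟨η, hη, c * ((Real.sqrt d * b + 1) * C₅) * (b : ℝ) ^ (n * α₀), fun k => ?_⟩
  have h1 := pNorm_freqBound_le hb hp n k (hP.measurable_density n) MeasurableSet.univ
    (fun l _ h => Or.inl (Set.subset_univ _)) hα₀ hα₀1 (c := normProd Pr P p n) (M := n * H)
    (fun t ht => hP.pNorm_density_le hp n ht.2)
    (fun l hl h _ t ht s hs => by
      have := hP.pNorm_density_sub_le hb hp hα₀ hH hl ht hs
      simpa [mul_assoc] using this)
  simp only [Set.indicator_univ, measure_univ, one_mul] at h1
  refine h1.trans ?_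
  rw [← ENNReal.ofReal_toReal htop, ← ENNReal.ofReal_mul hc, ← ENNReal.ofReal_mul (by positivity)]
  refine ENNReal.ofReal_le_ofReal ?_
  have h2 : min 1 ((b : ℝ) ^ (((n : ℝ) - k) * α₀)) ≤ (b : ℝ) ^ (n * α₀) * (b : ℝ) ^ (-(k * α₀)) := by
    refine (min_le_right _ _).trans (le_of_eq ?_)
    rw [← Real.rpow_add hb0]
    congr 1
    ring
  have h3 : (b : ℝ) ^ ((k : ℝ) * η) * (b : ℝ) ^ (-(k * α₀))
      = (b : ℝ) ^ (-((k : ℝ) * β)) * (b : ℝ) ^ (-(η * k)) := by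
    rw [← Real.rpow_add hb0, ← Real.rpow_add hb0]
    congr 1
    rw [hη_def]
    ring
  calc _ ≤ c * ((Real.sqrt d * b + 1) * (C₅ * (b : ℝ) ^ ((k : ℝ) * η))) *
        ((b : ℝ) ^ (n * α₀) * (b : ℝ) ^ (-(k * α₀))) := by
        have := hpoly k
        gcongr
    _ = c * ((Real.sqrt d * b + 1) * C₅) * (b : ℝ) ^ (n * α₀) *
        ((b : ℝ) ^ ((k : ℝ) * η) * (b : ℝ) ^ (-(k * α₀))) := by ring
    _ = _ := by rw [h3]; ring

theorem summable_geometric_prod {r : ℝ} (h0 : 0 ≤ r) (h1 : r < 1) :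
    Summable fun z : ℕ × ℕ => r ^ z.1 * r ^ z.2 :=
  (summable_geometric_of_lt_one h0 h1).mul_of_nonneg (summable_geometric_of_lt_one h0 h1)
    (fun _ => pow_nonneg h0 _) (fun _ => pow_nonneg h0 _)

/-- Almost sure decay of the Fourier transforms of the approximating measures along sparse sets of
frequencies, uniformly in the generation. -/
theorem IsChaosSequence.ae_exists_fourier_bound [IsProbabilityMeasure Pr]
    (hP : IsChaosSequence Pr P) (hd : 1 ≤ d) (hb : 2 ≤ b) {p p₀ α₀ β c₀ D : ℝ} (hp : 1 ≤ p)
    (hpp₀ : p ≤ p₀) (hα₀ : 0 < α₀) (hα₀1 : α₀ ≤ 1) (hfin : ∀ j, supMoment Pr P p j < ∞)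
    (hholder : UniformHolder Pr b P p₀ α₀) (hβα : β < α₀) {k₀ : ℕ}
    (hinc : HasIncrementBound Pr b P p β k₀ c₀ D) (F : ℕ → Finset (EuclideanSpace ℝ (Fin d)))
    (hF : ∀ k, ∀ x ∈ F k, (b : ℝ) ^ k ≤ ‖x‖)
    (hcard : ∀ k, (F k).card * 2 ≤ c₀ * (b : ℝ) ^ (k * D)) :
    ∀ᵐ ω ∂Pr, ∃ C : ℝ, ∀ k, ∀ x ∈ F k, ∀ n,
      ‖∫ t, wave x t * (density P (k₀ + n + 1) t ω : ℂ) ∂(cubeVolume d)‖ ≤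
        C * (b : ℝ) ^ (-((k : ℝ) * β)) := by
  have hb0 : (0 : ℝ) < b := by positivity
  have hb1 : (1 : ℝ) < b := by exact_mod_cast (by omega : 1 < b)
  obtain ⟨η₀, hη₀, C₀, hinit⟩ :=
    hP.exists_pNorm_freqBound_density_le hb hp hpp₀ hα₀ hα₀1 hfin hholder hβα (k₀ + 1)
  obtain ⟨η, hη, C₁, hC₁, hinc⟩ := hinc
  set S : ℕ → ℕ → Ω → ℝ≥0∞ := fun k m ω => ⨆ g : F k × Bool,
    ‖∫ t, wavePart g.1.1 g.2 t * increment P (k₀ + m + 1) t ω ∂(cubeVolume d)‖ₑ with hS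
  have hSm : ∀ k m, Measurable (S k m) := fun k m => Measurable.iSup fun g =>
    hP.measurable_integral_increment _ (measurable_wavePart _ _)
  have hSle : ∀ k m, pNorm Pr p (S k m) ≤ ENNReal.ofReal
      (C₁ * (b : ℝ) ^ (-((k : ℝ) * β)) * (b : ℝ) ^ (-(η * ((k₀ + m : ℕ) + k)))) := fun k m => by
    refine hinc (k₀ + m) (by omega) k (F k × Bool) (fun g => wavePart g.1.1 g.2)
      (fun g => measurable_wavePart _ _) (fun g => abs_wavePart_le _ _) ?_ fun h => ?_
    · simpa using hcard k
    · filter_upwards [hP.ae_integrable_increment (k₀ + m + 1)] with ω hω g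
      exact (enorm_integral_wavePart_mul_le _ _ (hω.indicator (measurableSet_adicCube _ h))).trans
        (enorm_integral_wave_mul_le_freqBound hd hb _ _ _ (hF k _ g.1.2))
  have hw : ∀ k : ℕ, (b : ℝ) ^ ((k : ℝ) * β) * (b : ℝ) ^ (-((k : ℝ) * β)) = 1 := fun k => by
    rw [← Real.rpow_add hb0, add_neg_cancel, Real.rpow_zero]
  -- Summing over the frequency scale and the generation together makes the final constant
  -- independent of both.
  have hsumS : ∀ᵐ ω ∂Pr, ∑' z : ℕ × ℕ, ENNReal.ofReal ((b : ℝ) ^ ((z.1 : ℝ) * β)) *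
      S z.1 z.2 ω < ∞ := by
    refine ae_tsum_lt_top_of_pNorm_le hp (fun z => (hSm z.1 z.2).const_mul _)
      (((summable_geometric_prod (r := (b : ℝ) ^ (-η)) (by positivity)
        (Real.rpow_lt_one_of_one_lt_of_neg hb1 (by linarith))).mul_left
          (C₁ * (b : ℝ) ^ (-(η * k₀))))) fun z => ?_
    rw [pNorm_const_mul hp _ (hSm z.1 z.2).aemeasurable]
    refine (mul_le_mul_right (hSle z.1 z.2) _).trans (le_of_eq ?_)
    rw [← ENNReal.ofReal_mul (by positivity)]
    congr 1
    have e : (b : ℝ) ^ (-(η * ((k₀ + z.2 : ℕ) + z.1))) =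
        (b : ℝ) ^ (-(η * k₀)) * (((b : ℝ) ^ (-η)) ^ z.1 * ((b : ℝ) ^ (-η)) ^ z.2) := by
      rw [← Real.rpow_natCast, ← Real.rpow_natCast, ← Real.rpow_mul hb0.le, ← Real.rpow_mul hb0.le,
        ← Real.rpow_add hb0, ← Real.rpow_add hb0]
      congr 1
      push_cast
      ring
    rw [e]
    linear_combination (C₁ * ((b : ℝ) ^ (-(η * k₀)) * (((b : ℝ) ^ (-η)) ^ z.1 *
      ((b : ℝ) ^ (-η)) ^ z.2))) * hw z.1
  have hsum0 : ∀ᵐ ω ∂Pr, ∑' k : ℕ, ENNReal.ofReal ((b : ℝ) ^ ((k : ℝ) * β)) *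
      freqBound b (k₀ + 1) k (fun t => density P (k₀ + 1) t ω) < ∞ := by
    have hm := fun k => measurable_freqBound (b := b) (k₀ + 1) k (hP.measurable_density (k₀ + 1))
    refine ae_tsum_lt_top_of_pNorm_le hp (fun k => (hm k).const_mul _)
      ((summable_geometric_of_lt_one (r := (b : ℝ) ^ (-η₀)) (by positivity)
        (Real.rpow_lt_one_of_one_lt_of_neg hb1 (by linarith))).mul_left C₀) fun k => ?_
    rw [pNorm_const_mul hp _ (hm k).aemeasurable]
    refine (mul_le_mul_right (hinit k) _).trans (le_of_eq ?_)
    rw [← ENNReal.ofReal_mul (by positivity)]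
    congr 1
    rw [← Real.rpow_natCast, ← Real.rpow_mul hb0.le, neg_mul]
    linear_combination (C₀ * (b : ℝ) ^ (-(η₀ * k))) * hw k
  filter_upwards [hP.ae_integrable_density, hsumS, hsum0] with ω hω hT hU
  have hωi : ∀ n, Integrable (fun t => increment P n t ω) (cubeVolume d) := fun n => by
    simp only [increment_eq_sub]
    exact (hω _).sub (hω _)
  set T := ∑' z : ℕ × ℕ, ENNReal.ofReal ((b : ℝ) ^ ((z.1 : ℝ) * β)) * S z.1 z.2 ω
  set U := ∑' k : ℕ, ENNReal.ofReal ((b : ℝ) ^ ((k : ℝ) * β)) *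
      freqBound b (k₀ + 1) k (fun t => density P (k₀ + 1) t ω)
  -- `U` bounds the initial density; `T` bounds all later increments and is counted once for the
  -- real and once for the imaginary part.
  refine ⟨(U + 2 * T).toReal, fun k x hx n => ?_⟩
  have h1 : ‖∫ t, wave x t * (density P (k₀ + n + 1) t ω : ℂ) ∂(cubeVolume d)‖ₑ ≤
      freqBound b (k₀ + 1) k (fun t => density P (k₀ + 1) t ω) +
        2 * ∑ j ∈ Finset.range n, S k j ω := by
    induction n with
    | zero => simpa using enorm_integral_wave_mul_le_freqBound hd hb _ _ _ (hF k x hx)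
    | succ n ih =>
      have h2 := integral_mul_density_succ (continuous_wave x).aestronglyMeasurable
        (fun t => (norm_wave x t).le) hω (k₀ + n + 1)
      simp only [Complex.real_smul, mul_comm _ (wave x _)] at h2
      have h3 : ∀ e, ‖∫ t, wavePart x e t * increment P (k₀ + n + 1) t ω ∂(cubeVolume d)‖ₑ ≤
          S k n ω := fun e => le_iSup (fun g : F k × Bool =>
        ‖∫ t, wavePart g.1.1 g.2 t * increment P (k₀ + n + 1) t ω ∂(cubeVolume d)‖ₑ) (⟨x, hx⟩, e)
      rw [show k₀ + (n + 1) + 1 = k₀ + n + 1 + 1 by omega, h2, Finset.sum_range_succ, mul_add,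
        ← add_assoc]
      refine (enorm_add_le _ _).trans (add_le_add ih ?_)
      refine (enorm_integral_wave_mul_le_add x (hωi _)).trans ?_
      rw [two_mul]
      exact add_le_add (h3 true) (h3 false)
  have h4 : ENNReal.ofReal ((b : ℝ) ^ ((k : ℝ) * β)) *
      ‖∫ t, wave x t * (density P (k₀ + n + 1) t ω : ℂ) ∂(cubeVolume d)‖ₑ ≤ U + 2 * T := by
    refine (mul_le_mul_right h1 _).trans ?_
    rw [mul_add]
    refine add_le_add (ENNReal.le_tsum (f := fun k : ℕ => ENNReal.ofReal ((b : ℝ) ^ ((k : ℝ) * β)) *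
      freqBound b (k₀ + 1) k (fun t => density P (k₀ + 1) t ω)) k) ?_
    rw [mul_left_comm, Finset.mul_sum]
    refine mul_le_mul_right ?_ _
    refine le_trans (le_of_eq ?_) (ENNReal.sum_le_tsum ((Finset.range n).map
      ⟨fun j => (k, j), fun i j h => (Prod.mk.inj h).2⟩))
    rw [Finset.sum_map]
    rfl
  have htop : U + 2 * T ≠ ∞ := ENNReal.add_ne_top.2 ⟨hU.ne, ENNReal.mul_ne_top (by simp) hT.ne⟩
  rw [← ENNReal.ofReal_toReal htop, ← ofReal_norm, ← ENNReal.ofReal_mul (by positivity),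
    ENNReal.ofReal_le_ofReal_iff ENNReal.toReal_nonneg] at h4
  calc _ = ((b : ℝ) ^ ((k : ℝ) * β) *
        ‖∫ t, wave x t * (density P (k₀ + n + 1) t ω : ℂ) ∂(cubeVolume d)‖) *
        (b : ℝ) ^ (-((k : ℝ) * β)) := by linear_combination (-‖∫ t, wave x t *
          (density P (k₀ + n + 1) t ω : ℂ) ∂(cubeVolume d)‖) * hw k
    _ ≤ _ := by gcongr

end AlmostSureBounds

/-! ### Weak convergence, and continuity of the Fourier transform -/

section WeakConvergence

theorem abs_integral_sub_le {X : Type*} [MeasurableSpace X] [TopologicalSpace X]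
    [OpensMeasurableSpace X] [CompactSpace X] {μ : Measure X} [IsFiniteMeasure μ]
    (f g : C(X, ℝ)) : dist (∫ x, f x ∂μ) (∫ x, g x ∂μ) ≤ μ.real Set.univ * dist f g := by
  have hi : ∀ f : C(X, ℝ), Integrable f μ := fun f =>
    Integrable.of_bound f.continuous.aestronglyMeasurable ‖f‖
      (Eventually.of_forall f.norm_coe_le_norm)
  rw [dist_eq_norm, ← integral_sub (hi f) (hi g), mul_comm]
  refine norm_integral_le_of_norm_le_const (Eventually.of_forall fun x => ?_)
  rw [← dist_eq_norm]
  exact ContinuousMap.dist_apply_le_dist x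

/-- On a compact space, finite measures converge weakly as soon as their integrals of the functions
of a dense family, and of the constant function `1`, converge. -/
theorem exists_tendsto_of_dense {X : Type*} [MeasurableSpace X] [TopologicalSpace X] [T2Space X]
    [BorelSpace X] [CompactSpace X] {ν : ℕ → FiniteMeasure X} {s : Set C(X, ℝ)} (hs : Dense s)
    (hmass : ∃ l, Tendsto (fun n => (ν n : Measure X).real Set.univ) atTop (𝓝 l))
    (h : ∀ f ∈ s, ∃ l, Tendsto (fun n => ∫ x, f x ∂(ν n : Measure X)) atTop (𝓝 l)) :
    ∃ μ, Tendsto ν atTop (𝓝 μ) := by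
  obtain ⟨l, hl⟩ := hmass
  obtain ⟨M, hM⟩ := hl.bddAbove_range
  have hM' : ∀ n, (ν n : Measure X).real Set.univ ≤ M := fun n => hM ⟨n, rfl⟩
  have hM0 : 0 ≤ M := measureReal_nonneg.trans (hM' 0)
  have hK := isCompact_setOfPred_finiteMeasure_le_of_compactSpace X M.toNNReal
  -- Measures of bounded mass form a compact set, so a limit exists along a nonprincipal
  -- ultrafilter. Convergence on `s` along `atTop` must be to the integrals of that limit.
  have hle : (Ultrafilter.map ν (hyperfilter ℕ) : Filter (FiniteMeasure X)) ≤
      𝓟 {μ : FiniteMeasure X | μ.mass ≤ M.toNNReal} := by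
    rw [le_principal_iff]
    rw [Ultrafilter.coe_map, Filter.mem_map]
    refine Filter.mem_of_superset univ_mem fun n _ => ?_
    change (ν n).mass ≤ M.toNNReal
    rw [Real.le_toNNReal_iff_coe_le hM0]
    exact hM' n
  obtain ⟨μ, -, hμ⟩ := hK.ultrafilter_le_nhds _ hle
  have hμ' : Tendsto ν (hyperfilter ℕ) (𝓝 μ) := hμ
  refine ⟨μ, ?_⟩
  rw [FiniteMeasure.tendsto_iff_forall_integral_tendsto] at hμ' ⊢
  have hhyp : (hyperfilter ℕ : Filter ℕ) ≤ atTop := by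
    rw [← Nat.cofinite_eq_atTop]; exact hyperfilter_le_cofinite
  -- Bounded masses make the functionals equicontinuous for the supremum norm; hence the set of
  -- functions whose integrals converge is closed and, containing a dense set, is everything.
  have hequi : Equicontinuous fun n (f : C(X, ℝ)) => ∫ x, f x ∂(ν n : Measure X) := by
    refine (LipschitzWith.uniformEquicontinuous _ M.toNNReal fun n => ?_).equicontinuous
    refine LipschitzWith.of_dist_le_mul fun f g => (abs_integral_sub_le f g).trans ?_
    rw [Real.coe_toNNReal _ hM0]
    exact mul_le_mul_of_nonneg_right (hM' n) dist_nonneg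
  have hcont : Continuous fun f : C(X, ℝ) => ∫ x, f x ∂(μ : Measure X) :=
    (LipschitzWith.of_dist_le_mul (K := (μ : Measure X).real Set.univ |>.toNNReal) fun f g => by
      rw [Real.coe_toNNReal _ measureReal_nonneg]
      exact abs_integral_sub_le f g).continuous
  have hclosed := hequi.isClosed_setOfPred_tendsto (l := atTop) hcont
  have hsub : s ⊆ {f : C(X, ℝ) | Tendsto (fun n => ∫ x, f x ∂(ν n : Measure X)) atTop
      (𝓝 (∫ x, f x ∂(μ : Measure X)))} := fun f hf => by
    obtain ⟨l, hl⟩ := h f hf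
    have := tendsto_nhds_unique (hl.mono_left hhyp)
      (hμ' (BoundedContinuousFunction.mkOfCompact f))
    subst this
    exact hl
  intro f
  have := hclosed.closure_subset_iff.2 hsub (hs f.toContinuousMap)
  exact this

variable {d b : ℕ}

instance : CompactSpace (cube d) := by
  rw [← isCompact_iff_compactSpace]
  have h : cube d = (EuclideanSpace.equiv (Fin d) ℝ).toHomeomorph ⁻¹'
      (Set.univ.pi fun _ => Set.Icc (0 : ℝ) 1) := by
    ext x
    simp only [cube, Set.mem_ofPred_eq, Set.mem_preimage, Set.mem_univ_pi]
    rfl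
  rw [h, Homeomorph.isCompact_preimage]
  exact isCompact_univ_pi fun _ => isCompact_Icc

variable {Ω : Type*} [mΩ : MeasurableSpace Ω] {Pr : Measure Ω} {P : ℕ → cube d → Ω → ℝ}

theorem IsChaosSequence.approxMeasure_eq (hP : IsChaosSequence Pr P) (m : ℕ) (ω : Ω) :
    approxMeasure P m ω =
      (cubeVolume d).withDensity fun t => ENNReal.ofReal (density P (m + 1) t ω) := by
  unfold approxMeasure density
  congr 1
  funext t
  rw [ENNReal.ofReal_prod_of_nonneg fun j _ => hP.nonneg j t ω]

theorem IsChaosSequence.integral_approxMeasure (hP : IsChaosSequence Pr P) (m : ℕ) (ω : Ω)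
    {E : Type*} [NormedAddCommGroup E] [NormedSpace ℝ E] (φ : cube d → E) :
    ∫ t, φ t ∂(approxMeasure P m ω) =
      ∫ t, density P (m + 1) t ω • φ t ∂(cubeVolume d) := by
  have hm : Measurable fun t => density P (m + 1) t ω :=
    (hP.measurable_density (m + 1)).comp measurable_prodMk_right
  rw [hP.approxMeasure_eq, integral_withDensity_eq_integral_toReal_smul hm.ennreal_ofReal
    (Eventually.of_forall fun t => ENNReal.ofReal_lt_top)]
  refine integral_congr_ae (Eventually.of_forall fun t => ?_)
  simp only [ENNReal.toReal_ofReal (hP.density_nonneg (m + 1) t ω)]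

theorem IsChaosSequence.isFiniteMeasure_approxMeasure (hP : IsChaosSequence Pr P) {ω : Ω}
    (hω : ∀ n, Integrable (fun t => density P n t ω) (cubeVolume d)) (m : ℕ) :
    IsFiniteMeasure (approxMeasure P m ω) := by
  rw [hP.approxMeasure_eq]
  exact isFiniteMeasure_withDensity_ofReal (hω (m + 1)).2

theorem coe_approx {Ω : Type*} {P : ℕ → cube d → Ω → ℝ} {m : ℕ} {ω : Ω} (h : IsFiniteMeasure (approxMeasure P m ω)) :
    (approx P m ω : Measure (cube d)) = approxMeasure P m ω := by
  have h1 : approx P m ω = ⟨approxMeasure P m ω, h⟩ := dif_pos h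
  rw [h1]
  rfl

/-- Almost sure weak convergence of the approximating measures. -/
theorem IsChaosSequence.ae_tendsto_approx [IsProbabilityMeasure Pr]
    (hP : IsChaosSequence Pr P) (hb : 2 ≤ b) {p β : ℝ} (hp : 1 ≤ p) {k₀ : ℕ}
    (hinc : HasIncrementBound Pr b P p β k₀ 1 0) :
    ∀ᵐ ω ∂Pr, (∀ m, IsFiniteMeasure (approxMeasure P m ω)) ∧
      Tendsto (fun m => approx P m ω) atTop (𝓝 (chaosMeasure P ω)) := by
  have hone := hP.ae_exists_tendsto_integral hb hp hinc (φ := fun _ => 1) measurable_const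
    (fun _ => by simp)
  -- A countable dense family leaves one null set; the factor `(‖f‖ + 1)⁻¹` makes each test function
  -- bounded by one.
  have hdense : ∀ᵐ ω ∂Pr, ∀ i : ℕ, ∃ l, Tendsto (fun n => ∫ t, density P n t ω •
      ((‖TopologicalSpace.denseSeq C(cube d, ℝ) i‖ + 1)⁻¹ *
        TopologicalSpace.denseSeq C(cube d, ℝ) i t) ∂(cubeVolume d)) atTop (𝓝 l) := by
    refine ae_all_iff.2 fun i => ?_
    set f := TopologicalSpace.denseSeq C(cube d, ℝ) i
    refine hP.ae_exists_tendsto_integral hb hp hinc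
      (f.continuous.measurable.const_mul _) fun t => ?_
    have h0 : 0 < ‖f‖ + 1 := by positivity
    rw [abs_mul, abs_of_pos (inv_pos.2 h0), inv_mul_le_iff₀ h0, mul_one]
    have := f.norm_coe_le_norm t
    rw [Real.norm_eq_abs] at this
    linarith
  filter_upwards [hP.ae_integrable_density, hone, hdense] with ω hω hone hdense
  have hfin := hP.isFiniteMeasure_approxMeasure hω
  refine ⟨hfin, tendsto_nhds_limUnder ?_⟩
  refine exists_tendsto_of_dense (TopologicalSpace.denseRange_denseSeq C(cube d, ℝ)) ?_ ?_
  · obtain ⟨l, hl⟩ := hone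
    refine ⟨l, ((tendsto_add_atTop_iff_nat 1).2 hl).congr fun m => ?_⟩
    rw [coe_approx (hfin m), ← hP.integral_approxMeasure]
    simp
  · rintro _ ⟨i, rfl⟩
    obtain ⟨l, hl⟩ := hdense i
    set f := TopologicalSpace.denseSeq C(cube d, ℝ) i
    have h0 : ‖f‖ + 1 ≠ 0 := by positivity
    refine ⟨(‖f‖ + 1) * l, (((tendsto_add_atTop_iff_nat 1).2 hl).const_mul _).congr fun m => ?_⟩
    rw [coe_approx (hfin m), ← hP.integral_approxMeasure, ← integral_const_mul]
    simp only [mul_inv_cancel_left₀ h0]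

theorem tendsto_fourierTransform {ν : ℕ → FiniteMeasure (cube d)} {μ : FiniteMeasure (cube d)}
    (h : Tendsto ν atTop (𝓝 μ)) (x : EuclideanSpace ℝ (Fin d)) :
    Tendsto (fun n => fourierTransform (ν n) x) atTop (𝓝 (fourierTransform μ x)) := by
  have hi : ∀ ρ : FiniteMeasure (cube d), Integrable (wave x) (ρ : Measure (cube d)) := fun ρ =>
    Integrable.of_bound (continuous_wave x).aestronglyMeasurable 1
      (Eventually.of_forall fun t => (norm_wave x t).le)
  have hre : ∀ ρ : FiniteMeasure (cube d), ((∫ t, (wave x t).re ∂(ρ : Measure (cube d)) : ℝ) : ℂ) +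
      ((∫ t, (wave x t).im ∂(ρ : Measure (cube d)) : ℝ) : ℂ) * Complex.I =
        fourierTransform ρ x := fun ρ => integral_re_add_im (hi ρ)
  rw [FiniteMeasure.tendsto_iff_forall_integral_tendsto] at h
  simp only [← hre]
  have h1 := h (BoundedContinuousFunction.mkOfCompact
    ⟨fun t => (wave x t).re, Complex.continuous_re.comp (continuous_wave x)⟩)
  have h2 := h (BoundedContinuousFunction.mkOfCompact
    ⟨fun t => (wave x t).im, Complex.continuous_im.comp (continuous_wave x)⟩)
  exact ((Complex.continuous_ofReal.tendsto _).comp h1).add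
    (((Complex.continuous_ofReal.tendsto _).comp h2).mul_const _)

theorem norm_coe_cube_le (t : cube d) : ‖t.1‖ ≤ Real.sqrt d := by
  rw [EuclideanSpace.norm_eq]
  refine Real.sqrt_le_sqrt ?_
  calc ∑ i, ‖t.1 i‖ ^ 2 ≤ ∑ _i : Fin d, (1 : ℝ) := by
        refine Finset.sum_le_sum fun i _ => pow_le_one₀ (norm_nonneg _) ?_
        rw [Real.norm_of_nonneg (t.2 i).1]
        exact (t.2 i).2
    _ = d := by simp

theorem norm_wave_sub_le (x y : EuclideanSpace ℝ (Fin d)) (t : cube d) :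
    ‖wave x t - wave y t‖ ≤ 2 * Real.pi * Real.sqrt d * ‖x - y‖ := by
  have h1 : wave x t = wave y t * wave (x - y) t := by
    simp only [wave, ← Complex.exp_add, inner_sub_left]
    congr 1
    push_cast
    ring
  rw [h1, ← mul_sub_one, norm_mul, norm_wave, one_mul, wave_eq_exp, mul_comm _ Complex.I]
  refine Real.norm_exp_I_mul_ofReal_sub_one_le.trans ?_
  rw [Real.norm_eq_abs, abs_mul, abs_mul, abs_neg, abs_of_pos Real.pi_pos, abs_of_pos two_pos]
  have := (abs_real_inner_le_norm (x - y) t.1).trans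
    (mul_le_mul_of_nonneg_left (norm_coe_cube_le t) (norm_nonneg _))
  calc _ ≤ 2 * Real.pi * (‖x - y‖ * Real.sqrt d) := by gcongr
    _ = _ := by ring

/-- The characters are Lipschitz in the frequency, uniformly on the cube, because its points have
norm at most `√d`. -/
theorem norm_fourierTransform_sub_le (μ : FiniteMeasure (cube d))
    (x y : EuclideanSpace ℝ (Fin d)) : ‖fourierTransform μ x - fourierTransform μ y‖ ≤
      2 * Real.pi * Real.sqrt d * (μ : Measure (cube d)).real Set.univ * ‖x - y‖ := by
  have hi : ∀ x, Integrable (wave x) (μ : Measure (cube d)) := fun x =>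
    Integrable.of_bound (continuous_wave x).aestronglyMeasurable 1
      (Eventually.of_forall fun t => (norm_wave x t).le)
  have h1 : fourierTransform μ x - fourierTransform μ y =
      ∫ t, (wave x t - wave y t) ∂(μ : Measure (cube d)) := (integral_sub (hi x) (hi y)).symm
  rw [h1]
  refine (norm_integral_le_of_norm_le_const
    (Eventually.of_forall (norm_wave_sub_le x y))).trans (le_of_eq ?_)
  ring

end WeakConvergence

/-! ### From frequency grids to all frequencies -/

section FourierDecay

variable {d b : ℕ}

open Classical in
/-- A finite set of frequencies of norm at least `b ^ k`, of spacing `b ^ (-k)`. -/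
noncomputable def frequencyGrid (d b k : ℕ) : Finset (EuclideanSpace ℝ (Fin d)) :=
  ((Fintype.piFinset fun _ : Fin d =>
      Finset.Icc (-(b : ℤ) ^ (2 * k + 1)) ((b : ℤ) ^ (2 * k + 1))).image
    fun n => WithLp.toLp 2 fun i => (n i : ℝ) / (b : ℝ) ^ k).filter fun x => (b : ℝ) ^ k ≤ ‖x‖

theorem le_norm_of_mem_frequencyGrid {k : ℕ} {x : EuclideanSpace ℝ (Fin d)}
    (hx : x ∈ frequencyGrid d b k) : (b : ℝ) ^ k ≤ ‖x‖ := (Finset.mem_filter.1 hx).2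

/-- Only polynomial growth in `b ^ k` matters. Coordinates up to `b ^ (k + 1)` at spacing `b ^ (-k)`
have numerators up to `b ^ (2 k + 1)`. -/
theorem card_frequencyGrid_le (hb : 2 ≤ b) (k : ℕ) :
    (frequencyGrid d b k).card * 2 ≤ 2 * (3 * (b : ℝ)) ^ d * (b : ℝ) ^ (k * (2 * d : ℝ)) := by
  have hb1 : (1 : ℝ) ≤ b := by exact_mod_cast (by omega : 1 ≤ b)
  have h1 : (frequencyGrid d b k).card ≤ (2 * b ^ (2 * k + 1) + 1) ^ d := by
    refine (Finset.card_filter_le _ _).trans (Finset.card_image_le.trans (le_of_eq ?_))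
    rw [Fintype.card_piFinset_const, Int.card_Icc]
    congr 1
    have : ((b : ℤ) ^ (2 * k + 1) + 1 - -(b : ℤ) ^ (2 * k + 1)) =
        ((2 * b ^ (2 * k + 1) + 1 : ℕ) : ℤ) := by push_cast; ring
    rw [this, Int.toNat_natCast]
  have h2 : ((2 * b ^ (2 * k + 1) + 1 : ℕ) : ℝ) ≤ 3 * b * (b : ℝ) ^ (2 * k) := by
    push_cast
    have : 1 ≤ (b : ℝ) ^ (2 * k + 1) := one_le_pow₀ hb1
    calc _ ≤ 3 * (b : ℝ) ^ (2 * k + 1) := by linarith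
      _ = _ := by ring
  have h3 : ((frequencyGrid d b k).card : ℝ) ≤ (3 * b * (b : ℝ) ^ (2 * k)) ^ d := by
    calc ((frequencyGrid d b k).card : ℝ) ≤ ((2 * b ^ (2 * k + 1) + 1 : ℕ) : ℝ) ^ d := by
          exact_mod_cast h1
      _ ≤ _ := by gcongr
  have h4 : (b : ℝ) ^ (k * (2 * d : ℝ)) = ((b : ℝ) ^ (2 * k)) ^ d := by
    rw [← pow_mul, ← Real.rpow_natCast]
    congr 1
    push_cast
    ring
  rw [h4]
  calc _ ≤ (3 * b * (b : ℝ) ^ (2 * k)) ^ d * 2 := by gcongr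
    _ = _ := by rw [mul_pow]; ring

/-- Rounding away from zero. -/
theorem exists_int_round {L x : ℝ} (hL : 0 < L) {M : ℤ} (hM : |x| * L ≤ M) :
    ∃ n ∈ Finset.Icc (-M) M, |x| ≤ |(n : ℝ) / L| ∧ |x - n / L| ≤ 1 / L := by
  have hn : ∀ n : ℤ, x - n / L = (x * L - n) / L := fun n => by field_simp
  have hx : |x| = |x * L| / L := by rw [abs_mul, abs_of_pos hL, mul_div_cancel_right₀ _ hL.ne']
  have hM' : |x * L| ≤ M := by rwa [abs_mul, abs_of_pos hL]
  have hM2 := abs_le.1 hM'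
  rcases le_total 0 (x * L) with h | h
  · have h1 := Int.le_ceil (x * L)
    have h2 := Int.ceil_lt_add_one (x * L)
    refine ⟨⌈x * L⌉, Finset.mem_Icc.2 ⟨?_, Int.ceil_le.2 hM2.2⟩, ?_, ?_⟩
    · have h3 : (0 : ℤ) ≤ M := by exact_mod_cast h.trans hM2.2
      have h4 : 0 ≤ ⌈x * L⌉ := Int.ceil_nonneg h
      omega
    · rw [hx, abs_div, abs_of_pos hL, abs_of_nonneg h, abs_of_nonneg (h.trans h1)]
      gcongr
    · rw [hn, abs_div, abs_of_pos hL]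
      gcongr
      rw [abs_le]
      constructor <;> linarith
  · have h1 := Int.floor_le (x * L)
    have h2 := Int.lt_floor_add_one (x * L)
    refine ⟨⌊x * L⌋, Finset.mem_Icc.2 ⟨Int.le_floor.2 (by push_cast; exact hM2.1), ?_⟩, ?_, ?_⟩
    · have h3 : (0 : ℤ) ≤ M := by exact_mod_cast (abs_nonneg _).trans hM'
      have h4 : ((⌊x * L⌋ : ℤ) : ℝ) ≤ 0 := h1.trans h
      have h5 : ⌊x * L⌋ ≤ 0 := by exact_mod_cast h4
      omega
    · rw [hx, abs_div, abs_of_pos hL, abs_of_nonpos h, abs_of_nonpos (h1.trans h)]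
      gcongr
    · rw [hn, abs_div, abs_of_pos hL]
      gcongr
      rw [abs_le]
      constructor <;> linarith

/-- Rounding every coordinate away from zero cannot decrease the norm, so the rounded point still
has norm at least `b ^ k`, as membership in the grid requires. -/
theorem exists_mem_frequencyGrid (hb : 2 ≤ b) {k : ℕ} {x : EuclideanSpace ℝ (Fin d)}
    (hx : (b : ℝ) ^ k ≤ ‖x‖) (hx' : ‖x‖ ≤ (b : ℝ) ^ (k + 1)) :
    ∃ y ∈ frequencyGrid d b k, ‖x - y‖ ≤ Real.sqrt d * ((b : ℝ) ^ k)⁻¹ := by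
  have hL : (0 : ℝ) < (b : ℝ) ^ k := by positivity
  have h1 : ∀ i, ∃ n ∈ Finset.Icc (-(b : ℤ) ^ (2 * k + 1)) ((b : ℤ) ^ (2 * k + 1)),
      |x i| ≤ |(n : ℝ) / (b : ℝ) ^ k| ∧ |x i - n / (b : ℝ) ^ k| ≤ 1 / (b : ℝ) ^ k := fun i => by
    refine exists_int_round hL ?_
    have h2 : |x i| ≤ ‖x‖ := by
      rw [← Real.norm_eq_abs]
      exact PiLp.norm_apply_le x i
    push_cast
    calc |x i| * (b : ℝ) ^ k ≤ (b : ℝ) ^ (k + 1) * (b : ℝ) ^ k := by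
          gcongr
          exact h2.trans hx'
      _ = _ := by ring
  choose n hn hle hdist using h1
  refine ⟨WithLp.toLp 2 fun i => (n i : ℝ) / (b : ℝ) ^ k, ?_, ?_⟩
  · refine Finset.mem_filter.2 ⟨Finset.mem_image.2 ⟨n, Fintype.mem_piFinset.2 hn, rfl⟩, ?_⟩
    refine hx.trans ?_
    rw [EuclideanSpace.norm_eq, EuclideanSpace.norm_eq]
    refine Real.sqrt_le_sqrt (Finset.sum_le_sum fun i _ => ?_)
    have := hle i
    simp only [Real.norm_eq_abs]
    gcongr
  · rw [EuclideanSpace.norm_eq, Real.sqrt_le_left (by positivity), mul_pow,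
      Real.sq_sqrt (by positivity)]
    calc _ ≤ ∑ _i : Fin d, (((b : ℝ) ^ k)⁻¹) ^ 2 := by
          refine Finset.sum_le_sum fun i _ => ?_
          have := hdist i
          rw [one_div] at this
          simp only [Real.norm_eq_abs]
          gcongr
          exact this
      _ = _ := by simp

/-- Decay of the Fourier transform along the grids of frequencies implies decay. -/
theorem fourierDecay_of_frequencyGrid (hb : 2 ≤ b) {μ : FiniteMeasure (cube d)} {β C : ℝ}
    (hβ : 0 ≤ β) (hβ1 : β ≤ 1)
    (hC : ∀ k, ∀ x ∈ frequencyGrid d b k, ‖fourierTransform μ x‖ ≤ C * (b : ℝ) ^ (-((k : ℝ) * β))) :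
    FourierDecay μ (2 * β) := by
  have hb0 : (0 : ℝ) < b := by positivity
  have hb1 : (1 : ℝ) < b := by exact_mod_cast (by omega : 1 < b)
  set K : ℝ := 2 * Real.pi * Real.sqrt d * (μ : Measure (cube d)).real Set.univ with hK
  have hK0 : 0 ≤ K := by have := Real.pi_pos; positivity
  set A : ℝ := (|C| + K * Real.sqrt d) * (b : ℝ) ^ β with hA
  refine IsBigO.of_bound (A ^ 2) ?_
  filter_upwards [tendsto_norm_cobounded_atTop.eventually_ge_atTop (1 : ℝ)] with x hx
  have hx0 : 0 < ‖x‖ := by linarith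
  obtain ⟨k, hk, hk'⟩ := exists_nat_pow_near hx hb1
  obtain ⟨y, hy, hxy⟩ := exists_mem_frequencyGrid hb hk hk'.le
  -- As `β ≤ 1`, the Lipschitz error from the spacing of the grid is within the desired decay.
  have h1 : ((b : ℝ) ^ k)⁻¹ ≤ (b : ℝ) ^ (-((k : ℝ) * β)) := by
    rw [← Real.rpow_natCast, ← Real.rpow_neg hb0.le]
    refine Real.rpow_le_rpow_of_exponent_le hb1.le (neg_le_neg ?_)
    exact mul_le_of_le_one_right (Nat.cast_nonneg k) hβ1
  have h2 : (b : ℝ) ^ (-((k : ℝ) * β)) ≤ (b : ℝ) ^ β * ‖x‖ ^ (-β) := by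
    have h3 : ((b : ℝ) ^ (k + 1)) ^ (-β) ≤ ‖x‖ ^ (-β) :=
      Real.rpow_le_rpow_of_nonpos hx0 hk'.le (by linarith)
    calc (b : ℝ) ^ (-((k : ℝ) * β)) = (b : ℝ) ^ β * ((b : ℝ) ^ (k + 1)) ^ (-β) := by
          rw [← Real.rpow_natCast, ← Real.rpow_mul hb0.le, ← Real.rpow_add hb0]
          congr 1
          push_cast
          ring
      _ ≤ _ := by gcongr
  have h4 : ‖fourierTransform μ x‖ ≤ A * ‖x‖ ^ (-β) := by
    calc ‖fourierTransform μ x‖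
        ≤ ‖fourierTransform μ y‖ + ‖fourierTransform μ x - fourierTransform μ y‖ :=
          norm_le_norm_add_norm_sub' _ _
      _ ≤ |C| * (b : ℝ) ^ (-((k : ℝ) * β)) + K * (Real.sqrt d * ((b : ℝ) ^ k)⁻¹) := by
          refine add_le_add ((hC k y hy).trans ?_)
            ((norm_fourierTransform_sub_le μ x y).trans ?_)
          · gcongr
            exact le_abs_self C
          · gcongr
      _ ≤ |C| * (b : ℝ) ^ (-((k : ℝ) * β)) + K * (Real.sqrt d * (b : ℝ) ^ (-((k : ℝ) * β))) := by
          gcongr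
      _ = (|C| + K * Real.sqrt d) * (b : ℝ) ^ (-((k : ℝ) * β)) := by ring
      _ ≤ (|C| + K * Real.sqrt d) * ((b : ℝ) ^ β * ‖x‖ ^ (-β)) := by gcongr
      _ = _ := by rw [hA]; ring
  rw [Real.norm_of_nonneg (by positivity), Real.norm_of_nonneg (by positivity)]
  calc ‖fourierTransform μ x‖ ^ 2 ≤ (A * ‖x‖ ^ (-β)) ^ 2 := by gcongr
    _ = A ^ 2 * ‖x‖ ^ (-(2 * β)) := by
      rw [mul_pow, ← Real.rpow_natCast (‖x‖ ^ (-β)), ← Real.rpow_mul hx0.le]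
      congr 2
      push_cast
      ring

variable {Ω : Type*} [mΩ : MeasurableSpace Ω] {Pr : Measure Ω} {P : ℕ → cube d → Ω → ℝ}

/-- The bound on the grids is uniform in the generation, so it passes to the weak limit at each
frequency of the grids. -/
theorem IsChaosSequence.ae_fourierDecay [IsProbabilityMeasure Pr]
    (hP : IsChaosSequence Pr P) (hd : 1 ≤ d) (hb : 2 ≤ b) {p p₀ α₀ β : ℝ} (hp : 1 ≤ p)
    (hpp₀ : p ≤ p₀) (hα₀ : 0 < α₀) (hα₀1 : α₀ ≤ 1) (hfin : ∀ j, supMoment Pr P p j < ∞)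
    (hholder : UniformHolder Pr b P p₀ α₀) (hβ : 0 ≤ β) (hβα : β < α₀) {k₀ : ℕ}
    (hinc : ∀ c₀ D : ℝ, 0 ≤ c₀ → HasIncrementBound Pr b P p β k₀ c₀ D) :
    ∀ᵐ ω ∂Pr, FourierDecay (chaosMeasure P ω) (2 * β) := by
  filter_upwards [hP.ae_exists_fourier_bound hd hb hp hpp₀ hα₀ hα₀1 hfin hholder hβα
    (hinc (2 * (3 * (b : ℝ)) ^ d) (2 * d) (by positivity)) (frequencyGrid d b)
    (fun k x hx => le_norm_of_mem_frequencyGrid hx) (card_frequencyGrid_le hb),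
    hP.ae_tendsto_approx hb hp (hinc 1 0 zero_le_one)] with ω hω hlim
  obtain ⟨C, hC⟩ := hω
  refine fourierDecay_of_frequencyGrid hb hβ (by linarith) (C := C) fun k x hx => ?_
  have h1 := ((tendsto_add_atTop_iff_nat k₀).2 (tendsto_fourierTransform hlim.2 x)).norm
  refine le_of_tendsto' h1 fun n => ?_
  have h2 : fourierTransform (approx P (n + k₀) ω) x =
      ∫ t, wave x t * (density P (k₀ + n + 1) t ω : ℂ) ∂(cubeVolume d) := by
    change ∫ t, wave x t ∂(approx P (n + k₀) ω : Measure (cube d)) = _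
    rw [coe_approx (hlim.1 _), hP.integral_approxMeasure, add_comm n k₀]
    simp only [Complex.real_smul, mul_comm]
  rw [h2]
  exact hC k x hx n

end FourierDecay

/-! ### The structure function and the choice of exponents -/

section StructureFunction

variable {d b : ℕ} {Ω : Type*} [mΩ : MeasurableSpace Ω] {Pr : Measure Ω}
  {P : ℕ → cube d → Ω → ℝ}

theorem IsChaosSequence.supMoment_le [IsProbabilityMeasure Pr] (hP : IsChaosSequence Pr P)
    {p q : ℝ} (hp : 1 ≤ p) (hpq : p ≤ q) (j : ℕ) :
    supMoment Pr P p j ≤ supMoment Pr P q j ^ (p / q) := by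
  have h := ENNReal.rpow_le_rpow (hP.supMoment_rpow_le hp hpq j) (by linarith : 0 ≤ p)
  rwa [← ENNReal.rpow_mul, ← ENNReal.rpow_mul, one_div_mul_cancel (by linarith), ENNReal.rpow_one,
    one_div_mul_eq_div] at h

theorem IsChaosSequence.one_le_limsupMoment [IsProbabilityMeasure Pr] (hP : IsChaosSequence Pr P)
    {p : ℝ} (hp : 1 ≤ p) : 1 ≤ limsupMoment Pr P p :=
  le_limsup_of_frequently_le (Eventually.of_forall fun j => hP.one_le_supMoment hp j).frequently

theorem IsChaosSequence.limsupMoment_lt_top [IsProbabilityMeasure Pr] (hP : IsChaosSequence Pr P)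
    {p q : ℝ} (hp : 1 ≤ p) (hpq : p ≤ q) (h : limsupMoment Pr P q < ∞) :
    limsupMoment Pr P p < ∞ := by
  obtain ⟨A, hA, hA'⟩ := exists_between h
  have h1 : limsupMoment Pr P p ≤ A ^ (p / q) := by
    refine limsup_le_of_le (by isBoundedDefault) ?_
    filter_upwards [eventually_lt_of_limsup_lt hA] with j hj
    have : 0 ≤ p / q := div_nonneg (by linarith) (by linarith)
    exact (hP.supMoment_le hp hpq j).trans (ENNReal.rpow_le_rpow hj.le this)
  exact h1.trans_lt (ENNReal.rpow_lt_top_of_nonneg (div_nonneg (by linarith) (by linarith)) hA'.ne)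

/-- The moments are at least one, so `Θ(p) ≤ d (p - 1) log b`, and `2 (p - 1) ≤ p` for `p ≤ 2`. -/
theorem IsChaosSequence.structureFunction_div_le [IsProbabilityMeasure Pr]
    (hP : IsChaosSequence Pr P) (hb : 2 ≤ b) {p : ℝ} (hp : 1 ≤ p) (hp2 : p ≤ 2)
    (hfin : limsupMoment Pr P p < ∞) :
    2 * structureFunction Pr b P p / (p * Real.log b) ≤ d := by
  have hlog : 0 < Real.log b := Real.log_pos (by exact_mod_cast (by omega : 1 < b))
  have h1 : 0 ≤ Real.log (limsupMoment Pr P p).toReal := by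
    refine Real.log_nonneg ?_
    rw [← ENNReal.toReal_one]
    exact ENNReal.toReal_mono hfin.ne (hP.one_le_limsupMoment hp)
  rw [div_le_iff₀ (by positivity), structureFunction]
  have h2 : (d : ℝ) * (2 * (p - 1)) * Real.log b ≤ d * p * Real.log b := by
    gcongr
    linarith
  linarith

/-- Ensures that the real supremum in `fourierBound` is a genuine one and not the default value. -/
theorem IsChaosSequence.bddAbove_structureFunction [IsProbabilityMeasure Pr]
    (hP : IsChaosSequence Pr P) (hb : 2 ≤ b) {p₀ : ℝ} (hp₀ : p₀ ≤ 2)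
    (hmoment : MandelbrotKahane Pr b P p₀) :
    BddAbove (Set.range fun p : Set.Ioc (1 : ℝ) p₀ =>
      2 * structureFunction Pr b P (p : ℝ) / ((p : ℝ) * Real.log b)) := by
  refine ⟨d, ?_⟩
  rintro _ ⟨p, rfl⟩
  exact hP.structureFunction_div_le hb p.2.1.le (p.2.2.trans hp₀)
    (hP.limsupMoment_lt_top p.2.1.le p.2.2 (hmoment.2.trans ENNReal.ofReal_lt_top))

theorem IsChaosSequence.fourierBound_le [IsProbabilityMeasure Pr]
    (hP : IsChaosSequence Pr P) (hb : 2 ≤ b) {p₀ α₀ : ℝ} (hp₀ : p₀ ∈ Set.Ioc (1 : ℝ) 2)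
    (hmoment : MandelbrotKahane Pr b P p₀) : fourierBound Pr b P p₀ α₀ ≤ d := by
  have : Nonempty (Set.Ioc (1 : ℝ) p₀) := ⟨⟨p₀, hp₀.1, le_rfl⟩⟩
  refine (min_le_right _ _).trans (ciSup_le fun p => ?_)
  exact hP.structureFunction_div_le hb p.2.1.le (p.2.2.trans hp₀.2)
    (hP.limsupMoment_lt_top p.2.1.le p.2.2 (hmoment.2.trans ENNReal.ofReal_lt_top))

/-- The Mandelbrot–Kahane condition says exactly that `Θ(p₀) > 0`, so the term `p = p₀` of the
supremum is positive. -/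
theorem IsChaosSequence.fourierBound_pos [IsProbabilityMeasure Pr]
    (hP : IsChaosSequence Pr P) (hb : 2 ≤ b) {p₀ α₀ : ℝ} (hp₀ : p₀ ∈ Set.Ioc (1 : ℝ) 2)
    (hα₀ : 0 < α₀) (hmoment : MandelbrotKahane Pr b P p₀) : 0 < fourierBound Pr b P p₀ α₀ := by
  have hb0 : (0 : ℝ) < b := by positivity
  have hlog : 0 < Real.log b := Real.log_pos (by exact_mod_cast (by omega : 1 < b))
  have hp : 0 < p₀ := by linarith [hp₀.1]
  refine lt_min (by linarith) (lt_of_lt_of_le ?_ (le_ciSup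
    (hP.bddAbove_structureFunction hb hp₀.2 hmoment) ⟨p₀, hp₀.1, le_rfl⟩))
  refine div_pos (mul_pos two_pos ?_) (mul_pos hp hlog)
  have h1 := hP.one_le_limsupMoment hp₀.1.le
  have h2 := hmoment.2
  have h3 : (limsupMoment Pr P p₀).toReal < (b : ℝ) ^ ((d : ℝ) * (p₀ - 1)) :=
    (ENNReal.lt_ofReal_iff_toReal_lt (h2.trans ENNReal.ofReal_lt_top).ne).1 h2
  have h4 : 0 < (limsupMoment Pr P p₀).toReal :=
    ENNReal.toReal_pos (zero_lt_one.trans_le h1).ne' (h2.trans ENNReal.ofReal_lt_top).ne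
  have h5 := Real.log_lt_log h4 h3
  rw [Real.log_rpow hb0] at h5
  rw [structureFunction]
  linarith

theorem IsChaosSequence.exists_hasIncrementBound [IsProbabilityMeasure Pr]
    (hP : IsChaosSequence Pr P) (hb : 2 ≤ b) {p₀ α₀ β : ℝ} (hp₀ : p₀ ∈ Set.Ioc (1 : ℝ) 2)
    (hα₀ : α₀ ∈ Set.Ioc (0 : ℝ) 1) (hindep : SubexponentialPartition Pr b P)
    (hmoment : MandelbrotKahane Pr b P p₀) (hholder : UniformHolder Pr b P p₀ α₀)
    (hβ : 0 ≤ β) (hβ' : 2 * β < fourierBound Pr b P p₀ α₀) :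
    β < α₀ ∧ ∃ p, 1 ≤ p ∧ p ≤ p₀ ∧ (∀ j, supMoment Pr P p j < ∞) ∧
      ∃ k₀, ∀ c₀ D : ℝ, 0 ≤ c₀ → HasIncrementBound Pr b P p β k₀ c₀ D := by
  have hb0 : (0 : ℝ) < b := by positivity
  have hlog : 0 < Real.log b := Real.log_pos (by exact_mod_cast (by omega : 1 < b))
  obtain ⟨hβ1, hβ2⟩ := lt_min_iff.1 hβ'
  have : Nonempty (Set.Ioc (1 : ℝ) p₀) := ⟨⟨p₀, hp₀.1, le_rfl⟩⟩
  obtain ⟨⟨p, hp1, hpp₀⟩, hp⟩ := exists_lt_of_lt_ciSup hβ2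
  have hβα : β < α₀ := by linarith
  have hp0 : 0 < p := by linarith
  have hfin : ∀ j, supMoment Pr P p j < ∞ := fun j =>
    (hP.supMoment_le hp1.le hpp₀ j).trans_lt (ENNReal.rpow_lt_top_of_nonneg
      (div_nonneg hp0.le (by linarith)) (hmoment.1 j).ne)
  have hL : limsupMoment Pr P p < ∞ :=
    hP.limsupMoment_lt_top hp1.le hpp₀ (hmoment.2.trans ENNReal.ofReal_lt_top)
  have hL0 : 0 < (limsupMoment Pr P p).toReal :=
    ENNReal.toReal_pos (zero_lt_one.trans_le (hP.one_le_limsupMoment hp1.le)).ne' hL.ne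
  -- Room for `ℓ` is the inequality `β < Θ(p) / (p log b)`: the lower bound makes the moments
  -- eventually smaller than `b ^ ℓ`, the upper one says `β < (d (p - 1) - ℓ) / p`.
  obtain ⟨ℓ, hℓ1, hℓ2⟩ : ∃ ℓ, Real.log (limsupMoment Pr P p).toReal / Real.log b < ℓ ∧
      ℓ < d * (p - 1) - β * p := by
    refine exists_between ?_
    rw [lt_div_iff₀ (by positivity), structureFunction] at hp
    rw [div_lt_iff₀ hlog]
    linarith
  have hlim : limsupMoment Pr P p < ENNReal.ofReal ((b : ℝ) ^ ℓ) := by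
    rw [ENNReal.lt_ofReal_iff_toReal_lt hL.ne, ← Real.log_lt_log_iff hL0 (by positivity),
      Real.log_rpow hb0]
    rwa [div_lt_iff₀ hlog] at hℓ1
  obtain ⟨k₀, -, N, c, -, hN, hind⟩ := hindep
  refine ⟨hβα, p, hp1.le, hpp₀, hfin, k₀, fun c₀ D hc₀ => ?_⟩
  refine hP.exists_pNorm_iSup_increment_bound hb hp1.le (hpp₀.trans hp₀.2) hpp₀ hα₀.1 hα₀.2 hfin
    hlim hholder hβ hβα ?_ hN c hind hc₀
  rw [lt_div_iff₀ hp0]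
  linarith

end StructureFunction

end Chaos

/-! ### Conclusion -/

theorem theorem1p3 {d b : ℕ} (hd : 1 ≤ d) (hb : 2 ≤ b)
    {Ω : Type*} [MeasurableSpace Ω] (Pr : Measure Ω) [IsProbabilityMeasure Pr]
    (P : ℕ → Chaos.cube d → Ω → ℝ) (hP : Chaos.IsChaosSequence Pr P)
    (p₀ : ℝ) (hp₀ : p₀ ∈ Set.Ioc (1 : ℝ) 2) (α₀ : ℝ) (hα₀ : α₀ ∈ Set.Ioc (0 : ℝ) 1)
    (hindep : Chaos.SubexponentialPartition Pr b P)
    (hmoment : Chaos.MandelbrotKahane Pr b P p₀)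
    (hholder : Chaos.UniformHolder Pr b P p₀ α₀) :
    0 < Chaos.fourierBound Pr b P p₀ α₀ ∧
    ∀ᵐ ω ∂Pr,
      ((∀ m, IsFiniteMeasure (Chaos.approxMeasure P m ω)) ∧
        Tendsto (fun m => Chaos.approx P m ω) atTop (𝓝 (Chaos.chaosMeasure P ω))) ∧
      (Chaos.chaosMeasure P ω ≠ 0 →
        Chaos.PolynomialFourierDecay (Chaos.chaosMeasure P ω) ∧
        Chaos.fourierBound Pr b P p₀ α₀ ≤ Chaos.fourierDim (Chaos.chaosMeasure P ω)) := by
  have hpos := hP.fourierBound_pos hb hp₀ hα₀.1 hmoment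
  have hle : Chaos.fourierBound Pr b P p₀ α₀ ≤ d := hP.fourierBound_le hb hp₀ hmoment
  -- The rate `β = 0` is enough for weak convergence.
  obtain ⟨-, p, hp, -, -, k₀, hinc⟩ := hP.exists_hasIncrementBound hb hp₀ hα₀ hindep hmoment
    hholder le_rfl (by simpa using hpos)
  have hlim := hP.ae_tendsto_approx hb hp (hinc 1 0 zero_le_one)
  -- Rational exponents keep the exceptional sets countable in number; the exponent `q` corresponds
  -- to the rate `β = q / 2`.
  have hdecay : ∀ᵐ ω ∂Pr, ∀ q : ℚ, 0 ≤ (q : ℝ) → (q : ℝ) < Chaos.fourierBound Pr b P p₀ α₀ →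
      Chaos.FourierDecay (Chaos.chaosMeasure P ω) q := by
    refine ae_all_iff.2 fun q => ?_
    by_cases hq : 0 ≤ (q : ℝ) ∧ (q : ℝ) < Chaos.fourierBound Pr b P p₀ α₀
    · obtain ⟨hβα, p, hp, hpp₀, hfin, k₀, hinc⟩ := hP.exists_hasIncrementBound hb hp₀ hα₀ hindep
        hmoment hholder (β := q / 2) (by linarith [hq.1]) (by linarith [hq.2])
      filter_upwards [hP.ae_fourierDecay hd hb hp hpp₀ hα₀.1 hα₀.2 hfin hholder
        (by linarith [hq.1]) hβα hinc] with ω hω _ _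
      rwa [mul_div_cancel₀ _ two_ne_zero] at hω
    · exact Eventually.of_forall fun ω h1 h2 => absurd ⟨h1, h2⟩ hq
  refine ⟨hpos, ?_⟩
  filter_upwards [hlim, hdecay] with ω hω hω'
  refine ⟨hω, fun _ => ⟨?_, le_of_forall_lt fun D hD => ?_⟩⟩
  · obtain ⟨q, hq0, hq⟩ := exists_rat_btwn hpos
    exact ⟨q, hq0, hω' q hq0.le hq⟩
  -- The maximum with `0` keeps `q` nonnegative when `D` is negative; `hle` keeps it below `d`, the
  -- range over which `fourierDim` takes its supremum.
  · obtain ⟨q, hq0, hq⟩ := exists_rat_btwn (max_lt hD hpos)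
    have hq0' := max_lt_iff.1 hq0
    exact hq0'.1.trans_le (le_csSup ⟨d, fun D' hD' => hD'.1.2.le⟩
      ⟨⟨hq0'.2.le, hq.trans_le hle⟩, hω' q hq0'.2.le hq⟩)
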